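/- Let $G=(V,E)$ be a directed tree on $n$ nodes, i.e. a loopless directed graph whose underlying undirected graph is a tree (each undirected edge may be present in one or in both directions), with edge weights $w:E\to\{0,1,2,\dots\}$, node thresholds $t:V\to\{0,1,2,\dots\}$ and node costs $c:V\to\{1,2,\dots\}$. For $S\subseteq V$ put $\mathrm{Influenced}[S,0]=S$ and, for $\tau\ge 1$, $$\mathrm{Influenced}[S,\tau]=\mathrm{Influenced}[S,\tau-1]\cup\Big\{u:\ \sum_{v\in \mathrm{Influenced}[S,\tau-1],\ (v,u)\in E} w(v,u)\ \ge\ t(u)\Big\}.$$ The $(\lambda,\beta)$-MIS problem, for integers $\lambda,\beta\ge 1$, asks for a set $S\subseteq V$ with $\sum_{v\in S}c(v)\le\beta$ for which $|\mathrm{Influenced}[S,\lambda]|$ is as large as possible. There is one algorithm (a program for a random access machine with unit-cost addition, subtraction, comparison and memory access, which is given $n$, $|E|$, $\lambda$, $\beta$, the list of edges with their weights in arbitrary order, the thresholds and the costs) that solves the $(\lambda,\beta)$-MIS problem on every such weighted directed tree. Let $\Delta$ be the maximum in-degree and $W=\sum_{e\in E}w(e)$ the total edge weight. If $n\ge 2$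 and all edge weights are positive, the algorithm runs in time $$O(\Delta\,\lambda^2\,W\,\beta^3);$$ in general, when edge weights may be $0$ or $n=1$, it runs in time $O\big((\Delta W+n)\,\lambda^2\beta^3\big)$. The constants in the $O(\cdot)$ are absolute. -/

import Mathlib

namespace MIS

/-! ### Influence diffusion in weighted directed graphs -/

/-- A weighted directed graph together with thresholds `t` and positive vertex costs `c`.
`w u v` is the weight of the arc `(u, v)`; it is only ever used when `(u, v)` is an arc. -/
structure Network (V : Type*) where
  graph : Digraph V
  w : V → V → ℕ
  t : V → ℕ
  c : V → ℕ
  c_pos : ∀ v, 1 ≤ c v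

namespace Network

variable {V : Type*} [Fintype V]

open Classical in
/-- The set of incoming neighbours of `u`. -/
noncomputable def inNbrs (N : Network V) (u : V) : Finset V :=
  Finset.univ.filter fun v => N.graph.Adj v u

open Classical in
/-- `N.influenced S τ` is the set of nodes influenced within round `τ` from the target set `S`. -/
noncomputable def influenced (N : Network V) (S : Finset V) : ℕ → Finset V
  | 0 => S
  | τ + 1 => influenced N S τ ∪
      Finset.univ.filter fun u => N.t u ≤ ∑ v ∈ N.inNbrs u ∩ influenced N S τ, N.w v u

/-- Total cost of a set of nodes. -/
def cost (N : Network V) (S : Finset V) : ℕ := ∑ v ∈ S, N.c v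

/-- `S` is an optimal solution for latency bound `lam` and budget `β`: its cost is within the
budget, and no target set within the budget influences more nodes within round `lam`. -/
def IsMaxInfluencing (N : Network V) (lam β : ℕ) (S : Finset V) : Prop :=
  N.cost S ≤ β ∧
    ∀ S' : Finset V, N.cost S' ≤ β →
      (N.influenced S' lam).card ≤ (N.influenced S lam).card

/-- A directed tree: no loops, and forgetting the orientation of the arcs leaves a tree. Each edge
of that tree may be present in one direction or in both. -/
def IsDirectedTree (N : Network V) : Prop :=
  (∀ v, ¬ N.graph.Adj v v) ∧ N.graph.toSimpleGraphInclusive.IsTree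

/-- The maximum in-degree. -/
noncomputable def maxInDegree (N : Network V) : ℕ :=
  Finset.univ.sup fun v => (N.inNbrs v).card

/-- The sum of the weights of all arcs. -/
noncomputable def totalWeight (N : Network V) : ℕ :=
  ∑ v, ∑ u ∈ N.inNbrs v, N.w u v

end Network

/-! ### A random access machine with unit-cost operations

Programs are structured programs over natural-number registers and one-dimensional arrays with
indirect addressing. The arithmetic operations are addition and truncated subtraction only (there
is no unit-cost multiplication). A fixed program mentions only finitely many registers and
arrays. -/

/-- Arithmetic expressions; `read a e` is the content of cell `e` of array `a`. -/
inductive Expr where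
  | const (k : ℕ)
  | reg (x : ℕ)
  | read (a : ℕ) (e : Expr)
  | add (e₁ e₂ : Expr)
  | sub (e₁ e₂ : Expr)

/-- Programs. -/
inductive Cmd where
  | skip
  /-- put the value of `e` into register `x` -/
  | assign (x : ℕ) (e : Expr)
  /-- put the value of `e` into cell `i` of array `a` -/
  | store (a : ℕ) (i e : Expr)
  | seq (p q : Cmd)
  /-- if `e₁ ≤ e₂` then `p` else `q` -/
  | ifLE (e₁ e₂ : Expr) (p q : Cmd)
  /-- while `e₁ < e₂` do `p` -/
  | whileLT (e₁ e₂ : Expr) (p : Cmd)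

/-- Memory contents: registers and arrays. -/
@[ext] structure State where
  reg : ℕ → ℕ
  arr : ℕ → ℕ → ℕ

/-- The value of an expression. -/
def Expr.eval (s : State) : Expr → ℕ
  | .const k => k
  | .reg x => s.reg x
  | .read a e => s.arr a (e.eval s)
  | .add e₁ e₂ => e₁.eval s + e₂.eval s
  | .sub e₁ e₂ => e₁.eval s - e₂.eval s

/-- The number of steps for evaluating an expression: one for each constant, register access,
array access and arithmetic operation. -/
def Expr.steps : Expr → ℕ
  | .const _ => 1
  | .reg _ => 1
  | .read _ e => e.steps + 1
  | .add e₁ e₂ => e₁.steps + e₂.steps + 1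
  | .sub e₁ e₂ => e₁.steps + e₂.steps + 1

/-- `s` with register `x` set to `k`. -/
def State.setReg (s : State) (x k : ℕ) : State :=
  { s with reg := Function.update s.reg x k }

/-- `s` with cell `i` of array `a` set to `k`. -/
def State.setArr (s : State) (a i k : ℕ) : State :=
  { s with arr := Function.update s.arr a (Function.update (s.arr a) i k) }

/-- `Exec p s k s'`: the program `p`, started in `s`, halts in `s'` after exactly `k` steps. -/
inductive Exec : Cmd → State → ℕ → State → Prop where
  | skip (s : State) : Exec .skip s 1 s
  | assign (s : State) (x : ℕ) (e : Expr) :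
      Exec (.assign x e) s (e.steps + 1) (s.setReg x (e.eval s))
  | store (s : State) (a : ℕ) (i e : Expr) :
      Exec (.store a i e) s (i.steps + e.steps + 1) (s.setArr a (i.eval s) (e.eval s))
  | seq {p q : Cmd} {s s' s'' : State} {k l : ℕ} :
      Exec p s k s' → Exec q s' l s'' → Exec (.seq p q) s (k + l) s''
  | ifTrue {e₁ e₂ : Expr} {p q : Cmd} {s s' : State} {k : ℕ} :
      e₁.eval s ≤ e₂.eval s → Exec p s k s' →
      Exec (.ifLE e₁ e₂ p q) s (e₁.steps + e₂.steps + 1 + k) s'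
  | ifFalse {e₁ e₂ : Expr} {p q : Cmd} {s s' : State} {k : ℕ} :
      ¬ e₁.eval s ≤ e₂.eval s → Exec q s k s' →
      Exec (.ifLE e₁ e₂ p q) s (e₁.steps + e₂.steps + 1 + k) s'
  | whileStop {e₁ e₂ : Expr} {p : Cmd} {s : State} :
      ¬ e₁.eval s < e₂.eval s →
      Exec (.whileLT e₁ e₂ p) s (e₁.steps + e₂.steps + 1) s
  | whileLoop {e₁ e₂ : Expr} {p : Cmd} {s s' s'' : State} {k l : ℕ} :
      e₁.eval s < e₂.eval s → Exec p s k s' → Exec (.whileLT e₁ e₂ p) s' l s'' →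
      Exec (.whileLT e₁ e₂ p) s (e₁.steps + e₂.steps + 1 + k + l) s''

/-- The machine is deterministic: step count and final state are unique. -/
theorem Exec.deterministic {p : Cmd} {s s₁ s₂ : State} {k₁ k₂ : ℕ}
    (h₁ : Exec p s k₁ s₁) (h₂ : Exec p s k₂ s₂) : k₁ = k₂ ∧ s₁ = s₂ := by
  induction h₁ generalizing k₂ s₂ with
  | skip s => cases h₂; exact ⟨rfl, rfl⟩
  | assign s x e => cases h₂; exact ⟨rfl, rfl⟩
  | store s a i e => cases h₂; exact ⟨rfl, rfl⟩
  | seq _ _ ih ih' =>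
    cases h₂ with
    | seq a b =>
      obtain ⟨rfl, rfl⟩ := ih a
      obtain ⟨rfl, rfl⟩ := ih' b
      exact ⟨rfl, rfl⟩
  | ifTrue h _ ih =>
    cases h₂ with
    | ifTrue _ a => obtain ⟨rfl, rfl⟩ := ih a; exact ⟨rfl, rfl⟩
    | ifFalse h' _ => exact absurd h h'
  | ifFalse h _ ih =>
    cases h₂ with
    | ifTrue h' _ => exact absurd h' h
    | ifFalse _ a => obtain ⟨rfl, rfl⟩ := ih a; exact ⟨rfl, rfl⟩
  | whileStop h =>
    cases h₂ with
    | whileStop _ => exact ⟨rfl, rfl⟩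
    | whileLoop h' _ _ => exact absurd h' h
  | whileLoop h _ _ ih ih' =>
    cases h₂ with
    | whileStop h' => exact absurd h h'
    | whileLoop _ a b =>
      obtain ⟨rfl, rfl⟩ := ih a
      obtain ⟨rfl, rfl⟩ := ih' b
      exact ⟨rfl, rfl⟩

/-! ### Input and output -/

/-- `L` lists the arcs of the network, each exactly once, in some order. -/
def IsArcList {n : ℕ} (N : Network (Fin n)) (L : List (Fin n × Fin n)) : Prop :=
  L.Nodup ∧ ∀ u v, (u, v) ∈ L ↔ N.graph.Adj u v

/-- The initial memory. Registers 0 to 3 hold the number of nodes, the number of arcs, the latency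
bound and the budget. Arrays 0, 1, 2 hold the tails, the heads and the weights of the listed arcs,
arrays 3 and 4 the thresholds and the costs. Everything else is 0. -/
def inputState {n : ℕ} (N : Network (Fin n)) (L : List (Fin n × Fin n)) (lam β : ℕ) : State where
  reg := fun x => match x with
    | 0 => n
    | 1 => L.length
    | 2 => lam
    | 3 => β
    | _ => 0
  arr := fun a i => match a with
    | 0 => if h : i < L.length then ((L[i]'h).1 : ℕ) else 0
    | 1 => if h : i < L.length then ((L[i]'h).2 : ℕ) else 0
    | 2 => if h : i < L.length then N.w (L[i]'h).1 (L[i]'h).2 else 0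
    | 3 => if h : i < n then N.t ⟨i, h⟩ else 0
    | 4 => if h : i < n then N.c ⟨i, h⟩ else 0
    | _ => 0

/-- The set of nodes that is read off at the end: the nodes marked by a nonzero entry of
array 5. -/
def outputSet (n : ℕ) (s : State) : Finset (Fin n) :=
  Finset.univ.filter fun v => s.arr 5 (v : ℕ) ≠ 0

end MIS

/-!
A target set `S` together with the times at which it influences the vertices can be checked
locally: an assignment of times, in which `Λ = lam + 1` stands for "not within round `lam`", is
*certified* if each vertex has time `0` or `Λ`, or receives at least its threshold from vertices
with earlier times. The times that `S` produces are certified, and conversely every certified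
assignment with time `0` exactly on `S` counts at most the influenced vertices
(`mem_influenced_of_certified`). So the problem is to maximise, over certified assignments whose
time-`0` vertices cost at most `β`, the number of vertices with a time below `Λ`
(`isMaxInfluencing_of_best`); on a tree this can be done by dynamic programming.

The tree is processed by removing leaves: a leaf `v` of the remaining tree is absorbed by its only
neighbour `p`. A remaining vertex `u` keeps two tables, one for the vertices that it has absorbed
through arcs into `u` that are absent or have weight `0`, and one for those absorbed through arcs
of positive weight. An entry is indexed by the time `τ` of `u`, a budget `b`, and, in the second
table, the weight `σ` that the absorbed children have to supply before time `τ`; as `σ` is capped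
by the threshold and by the weight of the arcs into `u`, the second table has `cap u + 1` rows for
each time. When `v` is absorbed, `combine` turns its two tables into the best values given the
time of `p`, and `absorb` merges them into one of the tables of `p`; both are max-plus
convolutions in the budget (`conv_rooted`, `conv_childSol`). Only one row per time has to be
computed when the arc from `v` to `p` has weight `0`, and `cap p + 1` rows otherwise, so each arc
of positive weight costs at most `inWeight p + 2` rows. Summing over all arcs gives `O(n + Δ W)`
rows per time, which is what `Network.potential` accounts for; each row costs `O(lam β²)` steps.

The table entries are cells of a heap. Each cell stores a best count and represents the set that
attains it as the union of two older cells, so that a join of two solutions takes constant time;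
the optimal target set is recovered at the end by one pass over the heap from the top
(`markCells`). Leaves are found without adjacency lists: for every vertex the program maintains
the numbers and the sums of its remaining in- and out-neighbours, and the sums identify the
neighbour of a leaf (`card_aliveNbrs_eq_one_iff`).

Programs are verified with the total-correctness judgement `Ok`, which carries a step budget. If
all weights are positive, each edge of the tree carries an arc of weight at least `1`. This gives
`n ≤ W + 1`, and the term `n` in the bound is absorbed by `Δ W`.
-/

namespace MIS

set_option linter.unusedSectionVars false

/-! ### Total correctness with a step budget -/

/-- `Ok p s k Q`: started in `s`, the program `p` halts after at most `k` steps, in a state that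
satisfies `Q`. -/
def Ok (p : Cmd) (s : State) (k : ℕ) (Q : State → Prop) : Prop :=
  ∃ j s', Exec p s j s' ∧ j ≤ k ∧ Q s'

local infixr:60 " ;; " => Cmd.seq

namespace Ok

variable {p q : Cmd} {s : State} {k l : ℕ} {Q R : State → Prop}

theorem weaken (h : Ok p s k Q) (hk : k ≤ l) (hQ : ∀ s', Q s' → R s') : Ok p s l R := by
  obtain ⟨j, s', he, hj, hq⟩ := h
  exact ⟨j, s', he, hj.trans hk, hQ s' hq⟩

theorem le (h : Ok p s k Q) (hk : k ≤ l) : Ok p s l Q := h.weaken hk fun _ => id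

theorem skip (h : Q s) : Ok .skip s 1 Q := ⟨1, s, .skip s, le_rfl, h⟩

theorem assign {x : ℕ} {e : Expr} (h : Q (s.setReg x (e.eval s))) :
    Ok (.assign x e) s (e.steps + 1) Q := ⟨_, _, .assign s x e, le_rfl, h⟩

theorem store {a : ℕ} {i e : Expr} (h : Q (s.setArr a (i.eval s) (e.eval s))) :
    Ok (.store a i e) s (i.steps + e.steps + 1) Q := ⟨_, _, .store s a i e, le_rfl, h⟩

theorem seq (h : Ok p s k R) (h' : ∀ s', R s' → Ok q s' l Q) : Ok (p ;; q) s (k + l) Q := by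
  obtain ⟨j, s', he, hj, hr⟩ := h
  obtain ⟨j', s'', he', hj', hq⟩ := h' s' hr
  exact ⟨j + j', s'', .seq he he', by omega, hq⟩

theorem seq_seq {r : Cmd} (h : Ok (p ;; q) s k R) (h' : ∀ s', R s' → Ok r s' l Q) :
    Ok (p ;; q ;; r) s (k + l) Q := by
  obtain ⟨j, s', he, hj, hr⟩ := h
  obtain ⟨j', s'', he', hj', hq⟩ := h' s' hr
  cases he with
  | seq he₁ he₂ => exact ⟨_, s'', .seq he₁ (.seq he₂ he'), by omega, hq⟩

theorem assign_seq {x : ℕ} {e : Expr} (h : Ok q (s.setReg x (e.eval s)) k Q) :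
    Ok (.assign x e ;; q) s (e.steps + 1 + k) Q :=
  seq (assign (Q := fun s' => s' = s.setReg x (e.eval s)) rfl) (by rintro _ rfl; exact h)

theorem store_seq {a : ℕ} {i e : Expr} (h : Ok q (s.setArr a (i.eval s) (e.eval s)) k Q) :
    Ok (.store a i e ;; q) s (i.steps + e.steps + 1 + k) Q :=
  seq (store (Q := fun s' => s' = s.setArr a (i.eval s) (e.eval s)) rfl)
    (by rintro _ rfl; exact h)

theorem ifLE {e₁ e₂ : Expr} (h₁ : e₁.eval s ≤ e₂.eval s → Ok p s k Q)
    (h₂ : e₂.eval s < e₁.eval s → Ok q s k Q) :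
    Ok (.ifLE e₁ e₂ p q) s (e₁.steps + e₂.steps + 1 + k) Q := by
  by_cases h : e₁.eval s ≤ e₂.eval s
  · obtain ⟨j, s', he, hj, hq⟩ := h₁ h
    exact ⟨_, s', .ifTrue h he, by omega, hq⟩
  · obtain ⟨j, s', he, hj, hq⟩ := h₂ (by omega)
    exact ⟨_, s', .ifFalse h he, by omega, hq⟩

/-- The rule for loops with amortised costs. In `I m s`, the number `m` is a bound on the steps that
remain; as the loop test itself takes a step, it decreases, so the loop halts. -/
theorem whileLT {e₁ e₂ : Expr} (I : ℕ → State → Prop)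
    (hbody : ∀ m s, I m s → e₁.eval s < e₂.eval s →
      ∃ k m', Ok p s k (I m') ∧ e₁.steps + e₂.steps + 1 + k + m' ≤ m)
    (hend : ∀ m s, I m s → ¬ e₁.eval s < e₂.eval s → e₁.steps + e₂.steps + 1 ≤ m ∧ Q s) :
    ∀ m s, I m s → Ok (.whileLT e₁ e₂ p) s m Q := by
  intro m
  induction m using Nat.strong_induction_on with
  | _ m ih =>
    intro s hI
    by_cases h : e₁.eval s < e₂.eval s
    · obtain ⟨k, m', ⟨j, s', he, hj, hI'⟩, hm⟩ := hbody m s hI h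
      obtain ⟨j', s'', he', hj', hq⟩ := ih m' (by omega) s' hI'
      exact ⟨_, s'', .whileLoop h he he', by omega, hq⟩
    · obtain ⟨hm, hq⟩ := hend m s hI h
      exact ⟨_, s, .whileStop h, hm, hq⟩

/-- The rule for loops that run through `i = 0, …, N - 1` at a cost of at most `c i`. -/
theorem forLT_sum {e₁ e₂ : Expr} (N : ℕ) (c : ℕ → ℕ) (I : ℕ → State → Prop) (h0 : I 0 s)
    (htest : ∀ i s, I i s → (e₁.eval s < e₂.eval s ↔ i < N))
    (hbody : ∀ i s, i < N → I i s → Ok p s (c i) (I (i + 1))) :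
    Ok (.whileLT e₁ e₂ p) s
      (∑ i ∈ Finset.range N, (e₁.steps + e₂.steps + 1 + c i) +
        (e₁.steps + e₂.steps + 1)) (I N) := by
  set d := e₁.steps + e₂.steps + 1 with hd
  refine whileLT (fun m s => ∃ i ≤ N, m + ∑ i ∈ Finset.range i, (d + c i) =
    ∑ i ∈ Finset.range N, (d + c i) + d ∧ I i s) ?_ ?_ _ s ⟨0, Nat.zero_le _, by simp, h0⟩
  · rintro m s ⟨i, hi, hm, hI⟩ ht
    have hlt := (htest i s hI).1 ht
    have hle : ∑ i ∈ Finset.range (i + 1), (d + c i) ≤ ∑ i ∈ Finset.range N, (d + c i) :=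
      Finset.sum_le_sum_of_subset (Finset.range_mono hlt)
    have hsucc := Finset.sum_range_succ (fun i => d + c i) i
    refine ⟨c i, m - (d + c i), (hbody i s hlt hI).weaken le_rfl
      fun s' h => ⟨i + 1, hlt, by omega, h⟩, by omega⟩
  · rintro m s ⟨i, hi, hm, hI⟩ ht
    have hN : i = N := le_antisymm hi (not_lt.1 fun h => ht ((htest i s hI).2 h))
    subst hN
    exact ⟨by omega, hI⟩

/-- The rule for loops that run through `i = 0, …, N - 1` at a cost of at most `c` each. -/
theorem forLT {e₁ e₂ : Expr} (N c : ℕ) (I : ℕ → State → Prop) (h0 : I 0 s)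
    (htest : ∀ i s, I i s → (e₁.eval s < e₂.eval s ↔ i < N))
    (hbody : ∀ i s, i < N → I i s → Ok p s c (I (i + 1))) :
    Ok (.whileLT e₁ e₂ p) s ((N + 1) * (e₁.steps + e₂.steps + 1 + c)) (I N) := by
  refine (forLT_sum N (fun _ => c) I h0 htest hbody).le ?_
  rw [Finset.sum_const, Finset.card_range, smul_eq_mul, Nat.succ_mul]
  omega

end Ok

@[simp] theorem State.setReg_reg (s : State) (x k y : ℕ) :
    (s.setReg x k).reg y = if y = x then k else s.reg y := by
  simp [State.setReg, Function.update_apply]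

@[simp] theorem State.setReg_arr (s : State) (x k : ℕ) : (s.setReg x k).arr = s.arr := rfl

@[simp] theorem State.setArr_reg (s : State) (a i k : ℕ) : (s.setArr a i k).reg = s.reg := rfl

@[simp] theorem State.setArr_arr (s : State) (a i k b j : ℕ) :
    (s.setArr a i k).arr b j = if b = a ∧ j = i then k else s.arr b j := by
  by_cases h : b = a
  · subst h; simp [State.setArr, Function.update_apply]
  · simp [State.setArr, h]

attribute [simp] Expr.eval Expr.steps

section

/-! ### Optimal entries and max-plus convolution -/

section Best

variable {V : Type*} {x y : ℕ} {S T : Finset V} {C D : Set (ℕ × Finset V)}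

/-- The pair of a number `x` and a set `S` records a best element of the family `C` of pairs
(count, set): `x = 0` says that `C` is empty, and `x = k + 1` that `(k, S)` is an element of `C`
with the largest count. -/
def Best (x : ℕ) (S : Finset V) (C : Set (ℕ × Finset V)) : Prop :=
  (x = 0 ∧ C = ∅) ∨ ∃ k, x = k + 1 ∧ (k, S) ∈ C ∧ ∀ q ∈ C, q.1 ≤ k

/-- All sums (of counts, and unions of sets) of an element of `C` and an element of `D`. -/
def joins [DecidableEq V] (C D : Set (ℕ × Finset V)) : Set (ℕ × Finset V) :=
  {q | ∃ c ∈ C, ∃ d ∈ D, q = (c.1 + d.1, c.2 ∪ d.2)}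

/-- The convolution of two families that are indexed by a budget. -/
def conv [DecidableEq V] (F G : ℕ → Set (ℕ × Finset V)) (b : ℕ) : Set (ℕ × Finset V) :=
  {q | ∃ j ≤ b, q ∈ joins (F j) (G (b - j))}

theorem Best.joins [DecidableEq V] (h : Best x S C) (h' : Best y T D) (hx : 1 ≤ x) (hy : 1 ≤ y) :
    Best (x + y - 1) (S ∪ T) (joins C D) := by
  obtain ⟨h0, -⟩ | ⟨k, rfl, hk, hmax⟩ := h
  · omega
  obtain ⟨h0, -⟩ | ⟨l, rfl, hl, hmax'⟩ := h'
  · omega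
  refine .inr ⟨k + l, by omega, ⟨_, hk, _, hl, rfl⟩, ?_⟩
  rintro _ ⟨c, hc, d, hd, rfl⟩
  exact Nat.add_le_add (hmax c hc) (hmax' d hd)

theorem setOf_exists_lt_succ {α : Type*} (P : ℕ → Set α) (i : ℕ) :
    {q | ∃ j < i + 1, q ∈ P j} = {q | ∃ j < i, q ∈ P j} ∪ P i := by
  ext q
  constructor
  · rintro ⟨j, hj, hq⟩
    obtain hj | rfl := Nat.lt_succ_iff_lt_or_eq.1 hj
    exacts [.inl ⟨j, hj, hq⟩, .inr hq]
  · rintro (⟨j, hj, hq⟩ | hq)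
    exacts [⟨j, hj.trans (Nat.lt_succ_self i), hq⟩, ⟨i, Nat.lt_succ_self i, hq⟩]

theorem Best.eq_empty (h : Best 0 S C) : C = ∅ := by
  obtain ⟨-, h⟩ | ⟨k, h, -⟩ := h
  · exact h
  · omega

theorem joins_eq_empty [DecidableEq V] (h : C = ∅ ∨ D = ∅) : joins C D = ∅ := by
  ext q
  simp only [joins, Set.mem_ofPred_eq, Set.mem_empty_iff_false, iff_false]
  rintro ⟨c, hc, d, hd, -⟩
  rcases h with rfl | rfl <;> simp_all

theorem Best.union_left (h : Best x S C) (h' : Best y T D) (hxy : y ≤ x) : Best x S (C ∪ D) := by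
  obtain ⟨rfl, rfl⟩ | ⟨k, rfl, hk, hmax⟩ := h
  · obtain rfl : y = 0 := by omega
    exact .inl ⟨rfl, by rw [h'.eq_empty, Set.union_self]⟩
  · refine .inr ⟨k, rfl, .inl hk, ?_⟩
    rintro q (hq | hq)
    · exact hmax q hq
    · obtain ⟨-, rfl⟩ | ⟨l, rfl, -, hmax'⟩ := h'
      · simp at hq
      · have := hmax' q hq
        omega

theorem Best.union_right (h : Best x S C) (h' : Best y T D) (hxy : x ≤ y) : Best y T (C ∪ D) := by
  rw [Set.union_comm]
  exact h'.union_left h hxy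

end Best

/-! ### Memory layout

A table entry is a heap cell `i`: the array `aVal` holds its number, in the encoding of `Best`, and
its set is the union of the sets of the cells `aL[i]` and `aR[i]`. The register `rTop` is the first
free cell.

The registers 4 to 6 hold the constants `β + 1`, `Λ` and `Λ + 1`. Register 9 is the vertex under
examination, register 11 its parent, register 10 a vertex that has not been absorbed. The registers
from 20 on are the arguments and the local variables of subroutines; `rVal`, `rL` and `rR` form an
accumulator (a count and two cells whose union is the set).

Array 5 receives the marks of the output. The arrays 6 to 9 hold the numbers and the sums of the
in-neighbours and of the out-neighbours of a vertex, the arrays 10 and 11 the sums of the weights of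
its incoming and outgoing arcs. The arrays 12 to 15 describe the tables of a vertex, see `Tables`,
and array 16 holds the multiples of `β + 1`, which the machine cannot compute by multiplication. -/

notation "aVal" => 20
notation "aL" => 21
notation "aR" => 22
notation "rWid" => 4
notation "rInf" => 5
notation "rTimes" => 6
notation "rB" => 30
notation "rX" => 40
notation "rY" => 41
notation "rJ" => 43
notation "rP" => 44
notation "rQ" => 45
notation "rTop" => 60
notation "rVal" => 61
notation "rL" => 62
notation "rR" => 63

/-- The set that is represented by the cell `i` of a heap with child pointers `l` and `r`: the
cells below `n` are singletons, the cell `n` is the empty set, the other cells are unions.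
A pointer that does not point downwards is ignored. -/
def cellSet (n : ℕ) (l r : ℕ → ℕ) (i : ℕ) : Finset (Fin n) :=
  if h : i < n then {⟨i, h⟩}
  else if i = n then ∅
  else (if l i < i then cellSet n l r (l i) else ∅) ∪ (if r i < i then cellSet n l r (r i) else ∅)
termination_by i

section cellSet

variable {n : ℕ} {l r l' r' : ℕ → ℕ} {i : ℕ}

theorem cellSet_of_lt (h : i < n) : cellSet n l r i = {⟨i, h⟩} := by
  rw [cellSet, dif_pos h]

theorem cellSet_self : cellSet n l r n = ∅ := by
  rw [cellSet]; simp

theorem cellSet_of_gt (h : n < i) (hl : l i < i) (hr : r i < i) :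
    cellSet n l r i = cellSet n l r (l i) ∪ cellSet n l r (r i) := by
  rw [cellSet, dif_neg (by omega), if_neg (by omega), if_pos hl, if_pos hr]

theorem cellSet_congr {m : ℕ} (h : ∀ j < m, l j = l' j ∧ r j = r' j) (hi : i < m) :
    cellSet n l r i = cellSet n l' r' i := by
  induction i using Nat.strong_induction_on with
  | _ i ih =>
    rw [cellSet, cellSet.eq_def n l' r' i, (h i hi).1, (h i hi).2]
    split_ifs with h1 h2 h3 h4 h4
    all_goals first | rfl | skip
    · rw [ih _ h3 (by omega), ih _ h4 (by omega)]
    · rw [ih _ h3 (by omega)]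
    · rw [ih _ h4 (by omega)]

end cellSet

/-- The set of the cell `i` in the memory `s`. -/
def State.cell (n : ℕ) (s : State) (i : ℕ) : Finset (Fin n) := cellSet n (s.arr aL) (s.arr aR) i

/-- The heap of `s` is well formed: the cell `n` is an entry for the empty set with count 0, and the
pointers of all later cells point downwards. -/
structure HeapOk (n : ℕ) (s : State) : Prop where
  lt_top : n < s.reg rTop
  val : s.arr aVal n = 1
  left : ∀ i, n < i → i < s.reg rTop → s.arr aL i < i
  right : ∀ i, n < i → i < s.reg rTop → s.arr aR i < i

/-- The heap of `s'` extends the heap of `s`. -/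
structure Grow (n : ℕ) (s s' : State) : Prop where
  top : s.reg rTop ≤ s'.reg rTop
  old : ∀ a, 20 ≤ a → ∀ i < s.reg rTop, s'.arr a i = s.arr a i
  heap : HeapOk n s → HeapOk n s'

namespace Grow

variable {n : ℕ} {s s' s'' : State}

theorem trans (h : Grow n s s') (h' : Grow n s' s'') : Grow n s s'' where
  top := h.top.trans h'.top
  old a ha i hi := (h'.old a ha i (hi.trans_le h.top)).trans (h.old a ha i hi)
  heap := h'.heap ∘ h.heap

theorem cell_eq (h : Grow n s s') {i : ℕ} (hi : i < s.reg rTop) : s'.cell n i = s.cell n i :=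
  cellSet_congr (fun j hj => ⟨h.old _ (by simp) j hj, h.old _ (by simp) j hj⟩) hi

/-- Changes outside of the heap do not affect it. -/
theorem of_eq (ht : s'.reg rTop = s.reg rTop) (ha : ∀ a, 20 ≤ a → s'.arr a = s.arr a) :
    Grow n s s' where
  top := ht.ge
  old a h i _ := by rw [ha a h]
  heap h := ⟨by rw [ht]; exact h.lt_top, by rw [ha _ (by simp)]; exact h.val,
    by rw [ht, ha _ (by simp)]; exact h.left, by rw [ht, ha _ (by simp)]; exact h.right⟩

end Grow

/-- What a program does that computes new heap cells: it leaves the registers below `r` unchanged,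
as well as the arrays other than those of the heap, and the allocated part of the heap. -/
structure Step (n r : ℕ) (s s' : State) : Prop where
  reg : ∀ x < r, s'.reg x = s.reg x
  arr : ∀ a < 20, ∀ i, s'.arr a i = s.arr a i
  top : s.reg rTop ≤ s'.reg rTop
  old : ∀ a, ∀ i < s.reg rTop, s'.arr a i = s.arr a i
  heap : HeapOk n s → HeapOk n s'

namespace Step

variable {n r r' : ℕ} {s s' s'' : State}

theorem rfl' : Step n r s s :=
  ⟨fun _ _ => rfl, fun _ _ _ => rfl, le_rfl, fun _ _ _ => rfl, id⟩

theorem trans (h : Step n r s s') (h' : Step n r s' s'') : Step n r s s'' where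
  reg x hx := (h'.reg x hx).trans (h.reg x hx)
  arr a ha i := (h'.arr a ha i).trans (h.arr a ha i)
  top := h.top.trans h'.top
  old a i hi := (h'.old a i (hi.trans_le h.top)).trans (h.old a i hi)
  heap := h'.heap ∘ h.heap

theorem mono (h : Step n r s s') (hr : r' ≤ r) : Step n r' s s' :=
  ⟨fun x hx => h.reg x (hx.trans_le hr), h.arr, h.top, h.old, h.heap⟩

theorem grow (h : Step n r s s') : Grow n s s' :=
  ⟨h.top, fun a _ => h.old a, h.heap⟩

theorem cell_eq (h : Step n r s s') {i : ℕ} (hi : i < s.reg rTop) : s'.cell n i = s.cell n i :=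
  h.grow.cell_eq hi

/-- Assignments to registers that are not protected are steps. -/
theorem setReg {x k : ℕ} (hx : r ≤ x) (hx' : x ≠ rTop) : Step n r s (s.setReg x k) where
  reg y hy := by simp; omega
  arr _ _ _ := rfl
  top := by simp [hx'.symm]
  old _ _ _ := rfl
  heap h := ⟨by simpa [hx'.symm] using h.lt_top, h.val,
    by simpa [hx'.symm] using h.left, by simpa [hx'.symm] using h.right⟩

end Step

variable {n : ℕ}

/-- The cell `i` is allocated and holds a best element of `C`. -/
def Opt (s : State) (i : ℕ) (C : Set (ℕ × Finset (Fin n))) : Prop :=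
  i < s.reg rTop ∧ Best (s.arr aVal i) (s.cell n i) C

/-- The accumulator registers hold a best element of `C`, the set being given by two cells. -/
def Acc (s : State) (C : Set (ℕ × Finset (Fin n))) : Prop :=
  s.reg rL < s.reg rTop ∧ s.reg rR < s.reg rTop ∧
    Best (s.reg rVal) (s.cell n (s.reg rL) ∪ s.cell n (s.reg rR)) C

/-- The cells from `i` on hold best elements of `F 0, …, F β`. -/
def Row (β : ℕ) (s : State) (i : ℕ) (F : ℕ → Set (ℕ × Finset (Fin n))) : Prop :=
  ∀ b ≤ β, Opt s (i + b) (F b)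

theorem Opt.grow {s s' : State} {i : ℕ} {C : Set (ℕ × Finset (Fin n))} (h : Opt s i C)
    (hs : Grow n s s') : Opt s' i C := by
  refine ⟨h.1.trans_le hs.top, ?_⟩
  rw [hs.cell_eq h.1, hs.old _ (by simp) i h.1]
  exact h.2

theorem Opt.step {r : ℕ} {s s' : State} {i : ℕ} {C : Set (ℕ × Finset (Fin n))} (h : Opt s i C)
    (hs : Step n r s s') : Opt s' i C := h.grow hs.grow

theorem Row.step {r β : ℕ} {s s' : State} {i : ℕ} {F : ℕ → Set (ℕ × Finset (Fin n))}
    (h : Row β s i F) (hs : Step n r s s') : Row β s' i F := fun b hb => (h b hb).step hs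

/-! ### Filling a row of a table -/

/-- Compare the accumulator with the join of the cells `rP` and `rQ`, and keep the better one. -/
def candidate : Cmd :=
  .ifLE (.const 1) (.read aVal (.reg rP))
    (.ifLE (.const 1) (.read aVal (.reg rQ))
      (.ifLE (.add (.reg rVal) (.const 2)) (.add (.read aVal (.reg rP)) (.read aVal (.reg rQ)))
        (.assign rVal (.sub (.add (.read aVal (.reg rP)) (.read aVal (.reg rQ))) (.const 1)) ;;
          .assign rL (.reg rP) ;; .assign rR (.reg rQ))
        .skip)
      .skip)
    .skip

theorem candidate_ok {s : State} {C D E : Set (ℕ × Finset (Fin n))} (hC : Acc s C)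
    (hD : Opt s (s.reg rP) D) (hE : Opt s (s.reg rQ) E) :
    Ok candidate s 40 fun s' => Step n 46 s s' ∧ s'.reg rTop = s.reg rTop ∧
      Acc s' (C ∪ joins D E) := by
  unfold candidate
  refine (Ok.ifLE (k := 30) (fun h1 => (Ok.ifLE (k := 24) (fun h2 => (Ok.ifLE (k := 14)
    (fun h3 => ?_) fun h3 => ?_).le ?_) fun h2 => ?_).le ?_) fun h1 => ?_).le ?_
  · refine Ok.le (Ok.assign_seq (Ok.assign_seq (Ok.assign ⟨?_, ?_, ?_⟩))) (by simp)
    · exact (Step.setReg (by simp) (by simp)).trans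
        ((Step.setReg (by simp) (by simp)).trans (Step.setReg (by simp) (by simp)))
    · simp
    · simp only [Expr.eval] at h1 h2 h3
      refine ⟨by simpa using hD.1, by simpa using hE.1, ?_⟩
      have := hC.2.2.union_right (hD.2.joins hE.2 h1 h2) (by omega)
      simpa [State.cell] using this
  · refine Ok.le (Ok.skip ⟨.rfl', rfl, hC.1, hC.2.1, ?_⟩) (by simp)
    simp only [Expr.eval] at h1 h2 h3
    exact hC.2.2.union_left (hD.2.joins hE.2 h1 h2) (by omega)
  · simp
  · refine Ok.le (Ok.skip ⟨.rfl', rfl, hC.1, hC.2.1, ?_⟩) (by simp)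
    simp only [Expr.eval, Nat.lt_one_iff] at h2
    rw [joins_eq_empty (.inr (h2 ▸ hE.2).eq_empty), Set.union_empty]
    exact hC.2.2
  · simp
  · refine Ok.le (Ok.skip ⟨.rfl', rfl, hC.1, hC.2.1, ?_⟩) (by simp)
    simp only [Expr.eval, Nat.lt_one_iff] at h1
    rw [joins_eq_empty (.inl (h1 ▸ hD.2).eq_empty), Set.union_empty]
    exact hC.2.2
  · simp

/-- Improve the accumulator by the convolution, at budget `rB`, of the rows `rX` and `rY`. -/
def convolve : Cmd :=
  .assign rJ (.const 0) ;;
  .whileLT (.reg rJ) (.add (.reg rB) (.const 1))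
    (.assign rP (.add (.reg rX) (.reg rJ)) ;;
      .assign rQ (.add (.reg rY) (.sub (.reg rB) (.reg rJ))) ;;
      candidate ;;
      .assign rJ (.add (.reg rJ) (.const 1)))

theorem Acc.congr {s s' : State} {C : Set (ℕ × Finset (Fin n))} (h : Acc s C)
    (hl : s'.reg rL = s.reg rL) (hr : s'.reg rR = s.reg rR) (hv : s'.reg rVal = s.reg rVal)
    (ht : s'.reg rTop = s.reg rTop) (ha : s'.arr = s.arr) : Acc s' C := by
  simpa only [Acc, State.cell, hl, hr, hv, ht, ha] using h

theorem convolve_ok {s : State} {β : ℕ} {C : Set (ℕ × Finset (Fin n))}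
    {F G : ℕ → Set (ℕ × Finset (Fin n))} (hC : Acc s C) (hF : Row β s (s.reg rX) F)
    (hG : Row β s (s.reg rY) G) (hb : s.reg rB ≤ β) :
    Ok convolve s (80 * (β + 2)) fun s' => Step n 43 s s' ∧ s'.reg rTop = s.reg rTop ∧
      Acc s' (C ∪ conv F G (s.reg rB)) := by
  unfold convolve
  refine (Ok.assign_seq (Ok.weaken (Ok.forLT (s.reg rB + 1) 64
    (fun i s' => Step n 43 s s' ∧ s'.reg rTop = s.reg rTop ∧ s'.reg rJ = i ∧
      Acc s' (C ∪ {q | ∃ j < i, q ∈ joins (F j) (G (s.reg rB - j))})) ?_ ?_ ?_) le_rfl ?_)).le ?_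
  · refine ⟨.setReg (by simp) (by simp), by simp, by simp, ?_⟩
    have : C ∪ {q | ∃ j < 0, q ∈ joins (F j) (G (s.reg rB - j))} = C := by simp
    rw [this]
    exact hC.congr (by simp) (by simp) (by simp) (by simp) (by simp)
  · rintro i s' ⟨h1, h2, h3, h4⟩
    simp only [Expr.eval, h3, h1.reg rB (by simp)]
  · rintro i s1 hi ⟨h1, h2, h3, h4⟩
    have hX := h1.reg rX (by simp)
    have hY := h1.reg rY (by simp)
    have hB := h1.reg rB (by simp)
    set s2 := (s1.setReg rP (s.reg rX + i)).setReg rQ (s.reg rY + (s.reg rB - i)) with hs2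
    have hstep : Step n 43 s1 s2 :=
      (Step.setReg (by simp) (by simp)).trans (Step.setReg (by simp) (by simp))
    have hcand := candidate_ok (n := n) (s := s2)
      (h4.congr (by simp [hs2]) (by simp [hs2]) (by simp [hs2]) (by simp [hs2]) (by simp [hs2]))
      (D := F i) (E := G (s.reg rB - i))
      (by simpa [hs2] using ((hF i (by omega)).step (h1.trans hstep)))
      (by simpa [hs2] using ((hG (s.reg rB - i) (by omega)).step (h1.trans hstep)))
    refine Ok.le (Ok.assign_seq (Ok.assign_seq (Ok.seq (k := 40) (R := fun s' => Step n 43 s1 s' ∧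
      s'.reg rTop = s.reg rTop ∧ s'.reg rJ = i ∧
      Acc s' (C ∪ {q | ∃ j < i + 1, q ∈ joins (F j) (G (s.reg rB - j))})) ?_ ?_)))
      (k := 4 + (6 + (40 + 4))) (by simp)
    · simp only [Expr.eval, State.setReg_reg, hX, hY, hB, h3]
      norm_num
      refine hcand.weaken le_rfl ?_
      rintro s' ⟨g1, g2, g3⟩
      refine ⟨hstep.trans (g1.mono (by simp)), ?_, ?_, ?_⟩
      · rw [g2, ← h2]; simp [hs2]
      · rw [g1.reg rJ (by simp), ← h3]; simp [hs2]
      · convert g3 using 1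
        rw [Set.union_assoc, ← setOf_exists_lt_succ fun j => joins (F j) (G (s.reg rB - j))]
        simp
    · rintro s' ⟨g1, g2, g3, g4⟩
      refine Ok.assign ⟨h1.trans (g1.trans (.setReg (by simp) (by simp))), by simpa using g2,
        by simp [g3], ?_⟩
      exact g4.congr (by simp) (by simp) (by simp) (by simp) (by simp)
  · rintro s' ⟨h1, h2, -, h4⟩
    refine ⟨h1, h2, ?_⟩
    convert h4 using 2
    ext q
    simp [conv]
  · simp only [Expr.steps]
    nlinarith

/-- Allocate a new heap cell for the accumulator. -/
def push : Cmd :=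
  .store aVal (.reg rTop) (.reg rVal) ;; .store aL (.reg rTop) (.reg rL) ;;
  .store aR (.reg rTop) (.reg rR) ;; .assign rTop (.add (.reg rTop) (.const 1))

theorem push_ok {s : State} {C : Set (ℕ × Finset (Fin n))} (hh : HeapOk n s) (hC : Acc s C) :
    Ok push s 20 fun s' => Step n 60 s s' ∧ s'.reg rTop = s.reg rTop + 1 ∧
      Opt s' (s.reg rTop) C := by
  unfold push
  refine (Ok.store_seq (Ok.store_seq (Ok.store_seq (Ok.assign ?_)))).le (by simp)
  simp only [Expr.eval, State.setArr_reg]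
  have hstep : Step n 60 s ((((s.setArr aVal (s.reg rTop) (s.reg rVal)).setArr aL (s.reg rTop)
      (s.reg rL)).setArr aR (s.reg rTop) (s.reg rR)).setReg rTop (s.reg rTop + 1)) := by
    refine ⟨fun x hx => by simp; omega, fun a ha i => ?_, by simp, fun a i hi => ?_, fun h =>
      ⟨?_, ?_, fun i h1 h2 => ?_, fun i h1 h2 => ?_⟩⟩
    · have h1 : a ≠ 20 := by omega
      have h2 : a ≠ 21 := by omega
      have h3 : a ≠ 22 := by omega
      simp [h1, h2, h3]
    · simp [hi.ne]
    · simpa using h.lt_top.trans (Nat.lt_succ_self _)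
    · simpa [h.lt_top.ne] using h.val
    · simp only [State.setReg_reg, if_true] at h2
      by_cases hi : i = s.reg rTop
      · subst hi; simpa using hC.1
      · simpa [hi] using h.left i h1 (by omega)
    · simp only [State.setReg_reg, if_true] at h2
      by_cases hi : i = s.reg rTop
      · subst hi; simpa using hC.2.1
      · simpa [hi] using h.right i h1 (by omega)
  refine ⟨hstep, by simp, by simp, ?_⟩
  have hcell : ∀ i < s.reg rTop, _ = _ := fun i hi => hstep.cell_eq hi
  unfold State.cell at hcell ⊢
  rw [cellSet_of_gt hh.lt_top (by simpa using hC.1) (by simpa using hC.2.1)]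
  simp only [State.setReg_arr, State.setArr_arr, and_self, if_true] at hcell ⊢
  norm_num at hcell ⊢
  rw [hcell _ hC.1, hcell _ hC.2.1]
  exact hC.2.2

/-- Empty the accumulator. The register 0 holds the number `n` of vertices, so that both cells of
the accumulator become the empty set. -/
def resetAcc : Cmd := .assign rVal (.const 0) ;; .assign rL (.reg 0) ;; .assign rR (.reg 0)

theorem resetAcc_ok {s : State} (hh : HeapOk n s) (hn : s.reg 0 = n) :
    Ok resetAcc s 6 fun s' => Step n 60 s s' ∧ s'.reg rTop = s.reg rTop ∧
      Acc s' (∅ : Set (ℕ × Finset (Fin n))) := by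
  unfold resetAcc
  refine (Ok.assign_seq (Ok.assign_seq (Ok.assign ⟨?_, ?_, ?_⟩))).le (by simp)
  · exact (Step.setReg (by simp) (by simp)).trans
      ((Step.setReg (by simp) (by simp)).trans (Step.setReg (by simp) (by simp)))
  · simp
  · exact ⟨by simpa [hn] using hh.lt_top, by simpa [hn] using hh.lt_top, .inl ⟨by simp, rfl⟩⟩

/-- Allocate a row of cells, one for each budget `rB`; `body` computes the entry in the
accumulator. -/
def fillRow (body : Cmd) : Cmd :=
  .assign rB (.const 0) ;;
  .whileLT (.reg rB) (.reg rWid)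
    (resetAcc ;; body ;; push ;; .assign rB (.add (.reg rB) (.const 1)))

theorem fillRow_ok {body : Cmd} {s : State} {β c : ℕ} {F : ℕ → Set (ℕ × Finset (Fin n))}
    (hh : HeapOk n s) (hn : s.reg 0 = n) (hwid : s.reg rWid = β + 1)
    (hbody : ∀ s', Step n 30 s s' → s'.reg rB ≤ β → Acc s' (∅ : Set (ℕ × Finset (Fin n))) →
      Ok body s' c fun s'' => Step n 31 s' s'' ∧ s''.reg rTop = s'.reg rTop ∧
        Acc s'' (F (s'.reg rB))) :
    Ok (fillRow body) s ((β + 3) * (c + 40)) fun s' => Step n 30 s s' ∧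
      s'.reg rTop = s.reg rTop + (β + 1) ∧ Row β s' (s.reg rTop) F := by
  unfold fillRow
  refine (Ok.assign_seq (Ok.weaken (Ok.forLT (β + 1) (6 + (c + (20 + 4)))
    (fun i s' => Step n 30 s s' ∧ s'.reg rTop = s.reg rTop + i ∧ s'.reg rB = i ∧
      ∀ b < i, Opt s' (s.reg rTop + b) (F b)) ?_ ?_ ?_) le_rfl ?_)).le ?_
  · exact ⟨.setReg (by simp) (by simp), by simp, by simp, by simp⟩
  · rintro i s' ⟨h1, h2, h3, h4⟩
    simp only [Expr.eval, h3, h1.reg rWid (by simp), hwid]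
  · rintro i s1 hi ⟨h1, h2, h3, h4⟩
    refine Ok.seq (resetAcc_ok (h1.heap hh) ((h1.reg 0 (by simp)).trans hn)) ?_
    rintro s2 ⟨g1, g2, g3⟩
    have hB2 : s2.reg rB = i := (g1.reg rB (by simp)).trans h3
    refine Ok.seq (hbody s2 (h1.trans (g1.mono (by simp))) (by omega) g3) ?_
    rintro s3 ⟨k1, k2, k3⟩
    refine Ok.seq (push_ok (k1.heap (g1.heap (h1.heap hh))) k3) ?_
    rintro s4 ⟨l1, l2, l3⟩
    have hB4 : s4.reg rB = i := ((l1.reg rB (by simp)).trans (k1.reg rB (by simp))).trans hB2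
    have h14 : Step n 30 s1 s4 :=
      (g1.mono (by simp)).trans ((k1.mono (by simp)).trans (l1.mono (by simp)))
    have hset : Step n 30 s4 (s4.setReg rB (i + 1)) := .setReg (by simp) (by simp)
    refine Ok.assign ?_
    simp only [Expr.eval, hB4]
    refine ⟨h1.trans (h14.trans hset), ?_, by simp, fun b hb => ?_⟩
    · have : s4.reg rTop = s.reg rTop + (i + 1) := by omega
      simpa using this
    · obtain hb | rfl := Nat.lt_succ_iff_lt_or_eq.1 hb
      · exact ((h4 b hb).step h14).step hset
      · have e : s3.reg rTop = s.reg rTop + b := by omega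
        rw [e, hB2] at l3
        exact l3.step hset
  · rintro s' ⟨h1, h2, -, h4⟩
    exact ⟨h1, h2, fun b hb => h4 b (by omega)⟩
  · simp only [Expr.steps]
    nlinarith

end

section

/-! ### The two table transformations -/

variable {n : ℕ}

/-- A table at address `i`, which has for each time `τ ≤ Λ` a block of `R` rows. -/
def Tab (β Λ : ℕ) (s : State) (i R : ℕ) (F : ℕ → ℕ → ℕ → Set (ℕ × Finset (Fin n))) : Prop :=
  ∀ τ ≤ Λ, ∀ σ < R, Row β s (i + (τ * R + σ) * (β + 1)) (F τ σ)

theorem Tab.step {β Λ r i R : ℕ} {s s' : State} {F : ℕ → ℕ → ℕ → Set (ℕ × Finset (Fin n))}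
    (h : Tab β Λ s i R F) (hs : Step n r s s') : Tab β Λ s' i R F :=
  fun τ hτ σ hσ => (h τ hτ σ hσ).step hs

theorem Tab.grow {β Λ i R : ℕ} {s s' : State} {F : ℕ → ℕ → ℕ → Set (ℕ × Finset (Fin n))}
    (h : Tab β Λ s i R F) (hs : Grow n s s') : Tab β Λ s' i R F :=
  fun τ hτ σ hσ b hb => (h τ hτ σ hσ b hb).grow hs

/-- The registers that hold the number `β + 1` of entries of a row, the time `Λ` that stands for
"never", the number of times, and the number of vertices. -/
structure Consts (n β Λ : ℕ) (s : State) : Prop where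
  num : s.reg 0 = n
  wid : s.reg rWid = β + 1
  inf : s.reg rInf = Λ
  times : s.reg rTimes = Λ + 1

theorem Consts.step {β Λ r : ℕ} {s s' : State} (h : Consts n β Λ s) (hs : Step n r s s')
    (hr : 7 ≤ r) : Consts n β Λ s' :=
  ⟨(hs.reg _ (by omega)).trans h.num, (hs.reg _ (by omega)).trans h.wid,
    (hs.reg _ (by omega)).trans h.inf, (hs.reg _ (by omega)).trans h.times⟩

/-- The weight that the absorbed children of a vertex have to supply if the vertex is to be
influenced at time `τ`, where `T` is its threshold, `w` is the weight of the arc from the parent,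
and `τp` is the time of the parent. -/
def demand (Λ T w τp τ : ℕ) : ℕ :=
  if τ ≤ 0 then 0 else if Λ ≤ τ then 0 else if τ ≤ τp then T else T - w

/-- Compute an entry of the table that describes a vertex from the point of view of its parent, by
running through the times of the vertex below the register `x`. -/
def combineEntry (x : ℕ) : Cmd :=
  .assign 31 (.const 0) ;; .assign rX (.reg 20) ;; .assign 32 (.reg 21) ;;
  .whileLT (.reg 31) (.reg x)
    (.ifLE (.reg 31) (.const 0) (.assign rY (.reg 32))
      (.ifLE (.reg rInf) (.reg 31) (.assign rY (.reg 32))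
        (.ifLE (.reg 31) (.reg 25) (.assign rY (.add (.reg 32) (.reg 23)))
          (.assign rY (.add (.reg 32) (.sub (.reg 23) (.reg 24)))))) ;;
      convolve ;;
      .assign rX (.add (.reg rX) (.reg rWid)) ;;
      .assign 32 (.add (.reg 32) (.reg 22)) ;;
      .assign 31 (.add (.reg 31) (.const 1)))

theorem combineEntry_ok {s : State} {β Λ T w x ℓ τp : ℕ}
    {H : ℕ → ℕ → Set (ℕ × Finset (Fin n))} {G : ℕ → ℕ → ℕ → Set (ℕ × Finset (Fin n))}
    (hc : Consts n β Λ s) (hx30 : x < 30) (hx : s.reg x = ℓ) (hℓ : ℓ ≤ Λ + 1)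
    (hτp : s.reg 25 = τp)
    (hH : Tab β Λ s (s.reg 20) 1 fun τ _ => H τ) (hG : Tab β Λ s (s.reg 21) (T + 1) G)
    (h22 : s.reg 22 = (T + 1) * (β + 1)) (h23 : s.reg 23 = T * (β + 1))
    (h24 : s.reg 24 = w * (β + 1)) (hb : s.reg rB ≤ β)
    (hacc : Acc s (∅ : Set (ℕ × Finset (Fin n)))) :
    Ok (combineEntry x) s ((Λ + 3) * (80 * (β + 2) + 60)) fun s' => Step n 31 s s' ∧
      s'.reg rTop = s.reg rTop ∧
      Acc s' {q | ∃ τ < ℓ, q ∈ conv (H τ) (G τ (demand Λ T w τp τ)) (s.reg rB)} := by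
  unfold combineEntry
  refine (Ok.assign_seq (Ok.assign_seq (Ok.assign_seq (Ok.weaken (Ok.forLT ℓ
    (20 + (80 * (β + 2) + (4 + (4 + 4))))
    (fun i s' => Step n 31 s s' ∧ s'.reg rTop = s.reg rTop ∧ s'.reg 31 = i ∧
      s'.reg rX = s.reg 20 + i * (β + 1) ∧
      s'.reg 32 = s.reg 21 + i * ((T + 1) * (β + 1)) ∧ s'.reg rB = s.reg rB ∧
      Acc s' {q | ∃ τ < i, q ∈ conv (H τ) (G τ (demand Λ T w τp τ)) (s.reg rB)})
    ?_ ?_ ?_) le_rfl ?_)))).le ?_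
  · refine ⟨(Step.setReg (by simp) (by simp)).trans
      ((Step.setReg (by simp) (by simp)).trans (Step.setReg (by simp) (by simp))),
      by simp, by simp, by simp, by simp, by simp, ?_⟩
    simp only [Nat.not_lt_zero, false_and, exists_false]
    exact hacc.congr (by simp) (by simp) (by simp) (by simp) (by simp)
  · rintro i s' ⟨h1, h2, h3, -⟩
    simp only [Expr.eval, h3, h1.reg x (by omega), hx]
  · rintro i s1 hi ⟨h1, h2, h3, h4, h5, hB, h6⟩
    have hc1 := hc.step h1 (by simp)
    refine Ok.seq (R := fun s' => s' = s1.setReg rY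
      (s1.reg 32 + demand Λ T w τp i * (β + 1))) ?_ ?_
    · refine (Ok.ifLE (k := 16) (fun g1 => ?_) fun g1 => (Ok.ifLE (k := 10) (fun g2 => ?_) fun g2 =>
        (Ok.ifLE (k := 6) (fun g3 => ?_) fun g3 => ?_).le ?_).le ?_).le ?_
      all_goals simp only [Expr.eval, Expr.steps, h3, hc1.inf, h1.reg 25 (by simp), hτp] at *
      · refine (Ok.assign ?_).le (by simp)
        simp [demand, g1]
      · refine (Ok.assign ?_).le (by simp)
        simp [demand, g2]
      · refine (Ok.assign ?_).le (by simp)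
        have : ¬ Λ ≤ i := by omega
        simp [demand, g1.ne', this, g3, h1.reg 23 (by simp), h23]
      · refine (Ok.assign ?_).le (by simp)
        have e1 : ¬ Λ ≤ i := by omega
        have e2 : ¬ i ≤ τp := by omega
        simp [demand, g1.ne', e1, e2, h1.reg 23 (by simp), h23, h1.reg 24 (by simp), h24,
          Nat.sub_mul]
      all_goals norm_num
    rintro s2 hs2
    have h12 : Step n 31 s1 s2 := hs2 ▸ .setReg (by simp) (by simp)
    have h02 := h1.trans h12
    have hd : demand Λ T w τp i < T + 1 := by
      unfold demand; split_ifs <;> omega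
    have hrowX : Row β s2 (s2.reg rX) (H i) := by
      have := (hH i (by omega) 0 (by simp)).step h02
      simpa [hs2, h4] using this
    have hrowY : Row β s2 (s2.reg rY) (G i (demand Λ T w τp i)) := by
      have := (hG i (by omega) _ hd).step h02
      have e : s2.reg rY = s.reg 21 + (i * (T + 1) + demand Λ T w τp i) * (β + 1) := by
        simp only [hs2, State.setReg_reg, h5]; norm_num; ring
      rwa [e]
    have hacc2 := h6.congr (s' := s2) (by simp [hs2]) (by simp [hs2]) (by simp [hs2])
      (by simp [hs2]) (by simp [hs2])
    have hB2 : s2.reg rB = s.reg rB := by simp [hs2, hB]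
    refine Ok.seq (convolve_ok hacc2 hrowX hrowY (by omega)) ?_
    rintro s3 ⟨g1, g2, g3⟩
    have hX3 := g1.reg rX (by simp)
    have h323 := g1.reg 32 (by simp)
    have h313 := g1.reg 31 (by simp)
    have hB3 := g1.reg rB (by simp)
    have hc3 := (hc.step h02 (by simp)).step g1 (by simp)
    have h03 := h02.trans (g1.mono (by simp))
    have h22' := h03.reg 22 (by simp)
    refine Ok.assign_seq (Ok.assign_seq (Ok.assign ⟨?_, ?_, ?_, ?_, ?_, ?_, ?_⟩))
    · exact h03.trans ((Step.setReg (by simp) (by simp)).trans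
        ((Step.setReg (by simp) (by simp)).trans (Step.setReg (by simp) (by simp))))
    · simp [g2, hs2, h2]
    · simp [h313, hs2, h3]
    · simp [hX3, hs2, h4, hc3.wid]; ring
    · simp [h323, hs2, h5, h22', h22]; ring
    · simp [hB3, hB2]
    · rw [setOf_exists_lt_succ]
      rw [hB2] at g3
      exact g3.congr (by simp) (by simp) (by simp) (by simp) (by simp)
  · rintro s' ⟨h1, h2, -, -, -, -, h6⟩
    exact ⟨h1, h2, h6⟩
  · simp only [Expr.steps]
    nlinarith

/-- Compute the table that describes a vertex from the point of view of its parent, with one row for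
each time of the parent. -/
def combine (x : ℕ) : Cmd :=
  .assign 25 (.const 0) ;;
  .whileLT (.reg 25) (.reg rTimes)
    (fillRow (combineEntry x) ;; .assign 25 (.add (.reg 25) (.const 1)))

theorem combine_ok {s : State} {β Λ T w x : ℕ} {ℓ : ℕ → ℕ}
    {H : ℕ → ℕ → Set (ℕ × Finset (Fin n))} {G : ℕ → ℕ → ℕ → Set (ℕ × Finset (Fin n))}
    (hh : HeapOk n s) (hc : Consts n β Λ s) (hx30 : x < 30)
    (hx : ∀ s', Step n 25 s s' → s'.reg x = ℓ (s'.reg 25)) (hℓ : ∀ i ≤ Λ, ℓ i ≤ Λ + 1)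
    (hH : Tab β Λ s (s.reg 20) 1 fun τ _ => H τ) (hG : Tab β Λ s (s.reg 21) (T + 1) G)
    (h22 : s.reg 22 = (T + 1) * (β + 1)) (h23 : s.reg 23 = T * (β + 1))
    (h24 : s.reg 24 = w * (β + 1)) :
    Ok (combine x) s ((Λ + 3) * ((β + 3) * ((Λ + 3) * (80 * (β + 2) + 60) + 40) + 10))
      fun s' => Step n 25 s s' ∧ s'.reg rTop = s.reg rTop + (Λ + 1) * (β + 1) ∧
      Tab β Λ s' (s.reg rTop) 1 fun τp _ b =>
        {q | ∃ τ < ℓ τp, q ∈ conv (H τ) (G τ (demand Λ T w τp τ)) b} := by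
  unfold combine
  set c := (β + 3) * ((Λ + 3) * (80 * (β + 2) + 60) + 40) with hcdef
  refine (Ok.assign_seq (Ok.weaken (Ok.forLT (Λ + 1) (c + 4)
    (fun i s' => Step n 25 s s' ∧ s'.reg rTop = s.reg rTop + i * (β + 1) ∧ s'.reg 25 = i ∧
      ∀ τp < i, Row β s' (s.reg rTop + τp * (β + 1))
        fun b => {q | ∃ τ < ℓ τp, q ∈ conv (H τ) (G τ (demand Λ T w τp τ)) b})
    ?_ ?_ ?_) le_rfl ?_)).le ?_
  · exact ⟨.setReg (by simp) (by simp), by simp, by simp, by simp⟩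
  · rintro i s' ⟨h1, -, h3, -⟩
    simp only [Expr.eval, h3, h1.reg rTimes (by simp), hc.times]
  · rintro i s1 hi ⟨h1, h2, h3, h4⟩
    refine Ok.seq (fillRow_ok (F := fun b =>
      {q | ∃ τ < ℓ i, q ∈ conv (H τ) (G τ (demand Λ T w i τ)) b}) (β := β)
      (c := (Λ + 3) * (80 * (β + 2) + 60)) (h1.heap hh) ((h1.reg 0 (by simp)).trans hc.num)
      ((h1.reg rWid (by simp)).trans hc.wid) ?_) ?_
    · intro s2 h12 hb hacc
      have h02 := h1.trans (h12.mono (by simp))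
      have h25 : s2.reg 25 = i := (h12.reg 25 (by simp)).trans h3
      have e20 := h02.reg 20 (by simp)
      have e21 := h02.reg 21 (by simp)
      refine combineEntry_ok (hc.step h02 (by simp)) hx30 ((hx s2 h02).trans (by rw [h25]))
        (hℓ i (by omega)) h25 ?_ ?_
        ((h02.reg 22 (by simp)).trans h22) ((h02.reg 23 (by simp)).trans h23)
        ((h02.reg 24 (by simp)).trans h24) hb hacc
      · rw [e20]; exact hH.step h02
      · rw [e21]; exact hG.step h02
    · rintro s2 ⟨g1, g2, g3⟩
      have h25 : s2.reg 25 = i := (g1.reg 25 (by simp)).trans h3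
      have hset : Step n 25 s2 (s2.setReg 25 (i + 1)) := .setReg (by simp) (by simp)
      refine Ok.assign ?_
      simp only [Expr.eval, h25]
      have g1' := g1.mono (r' := 25) (by simp)
      refine ⟨(h1.trans g1').trans hset, ?_, by simp, fun τp hτp => ?_⟩
      · simp [g2, h2]; ring
      · obtain hτp | rfl := Nat.lt_succ_iff_lt_or_eq.1 hτp
        · exact ((h4 τp hτp).step g1').step hset
        · rw [h2] at g3
          exact g3.step hset
  · rintro s' ⟨h1, h2, -, h4⟩
    refine ⟨h1, h2, fun τ hτ σ hσ => ?_⟩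
    obtain rfl : σ = 0 := by omega
    simpa using h4 τ (by omega)
  · simp only [Expr.steps]
    nlinarith

/-- Compute an entry of the table of a vertex after the absorption of a child, which helps the
vertex (second convolution) or need not (first convolution). -/
def absorbEntry : Cmd :=
  .assign rX (.add (.reg 20) (.reg 26)) ;; .assign rY (.reg 24) ;; convolve ;;
  .assign rX (.add (.reg 20) (.sub (.reg 26) (.reg 22))) ;; .assign rY (.reg 23) ;; convolve

theorem absorbEntry_ok {s : State} {β c σ w : ℕ} {Z Z' A B : ℕ → Set (ℕ × Finset (Fin n))}
    (h26 : s.reg 26 = σ * (β + 1)) (h22 : s.reg 22 = w * (β + 1)) (h20 : s.reg 20 = c)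
    (hZ : Row β s (c + σ * (β + 1)) Z) (hZ' : Row β s (c + (σ - w) * (β + 1)) Z')
    (hA : Row β s (s.reg 23) A) (hB : Row β s (s.reg 24) B) (hb : s.reg rB ≤ β)
    (hacc : Acc s (∅ : Set (ℕ × Finset (Fin n)))) :
    Ok absorbEntry s (160 * (β + 2) + 20) fun s' => Step n 31 s s' ∧
      s'.reg rTop = s.reg rTop ∧ Acc s' (conv Z B (s.reg rB) ∪ conv Z' A (s.reg rB)) := by
  unfold absorbEntry
  refine Ok.le (k := 4 + (2 + (80 * (β + 2) + (6 + (2 + (80 * (β + 2))))))) (Ok.assign_seq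
    (Ok.assign_seq ?_)) (by omega)
  set s1 := (s.setReg rX (s.reg 20 + s.reg 26)).setReg rY (s.reg 24) with hs1
  have h01 : Step n 31 s s1 :=
    (Step.setReg (by simp) (by simp)).trans (Step.setReg (by simp) (by simp))
  have hB1 : s1.reg rB = s.reg rB := by simp [hs1]
  simp only [Expr.eval, State.setReg_reg]
  norm_num
  rw [← hs1]
  refine Ok.seq (convolve_ok (β := β) (F := Z) (G := B)
    (hacc.congr (s' := s1) (by simp [hs1]) (by simp [hs1]) (by simp [hs1])
    (by simp [hs1]) (by simp [hs1])) ?_ ?_ (by omega)) ?_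
  · simpa [hs1, h20, h26] using hZ.step h01
  · simpa [hs1] using hB.step h01
  rintro s2 ⟨g1, g2, g3⟩
  have h02 := h01.trans (g1.mono (by simp))
  have hB2 : s2.reg rB = s.reg rB := (g1.reg rB (by simp)).trans hB1
  refine Ok.assign_seq (Ok.assign_seq ?_)
  set s3 := (s2.setReg rX (s2.reg 20 + (s2.reg 26 - s2.reg 22))).setReg rY (s2.reg 23) with hs3
  have h23 : Step n 31 s2 s3 :=
    (Step.setReg (by simp) (by simp)).trans (Step.setReg (by simp) (by simp))
  have hB3 : s3.reg rB = s.reg rB := by simp [hs3, hB2]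
  have h03 := h02.trans h23
  simp only [Expr.eval, State.setReg_reg]
  norm_num
  rw [← hs3]
  refine (convolve_ok (β := β) (F := Z') (G := A)
    (g3.congr (s' := s3) (by simp [hs3]) (by simp [hs3]) (by simp [hs3])
    (by simp [hs3]) (by simp [hs3])) ?_ ?_ (by omega)).weaken le_rfl ?_
  · have := hZ'.step h03
    simpa [hs3, h02.reg 20 (by simp), h02.reg 26 (by simp), h02.reg 22 (by simp), h20, h26, h22,
      Nat.sub_mul] using this
  · have := hA.step h03
    simpa [hs3, h02.reg 23 (by simp)] using this
  rintro s4 ⟨k1, k2, k3⟩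
  refine ⟨h03.trans (k1.mono (by simp)), ?_, ?_⟩
  · rw [k2]; simp [hs3, g2, hs1]
  · simpa [hB1, hB3] using k3

/-- Compute the table of a vertex after the absorption of a child. -/
def absorb : Cmd :=
  .assign 25 (.const 0) ;;
  .whileLT (.reg 25) (.reg rTimes)
    (.assign 26 (.const 0) ;;
      .whileLT (.reg 26) (.reg 21)
        (fillRow absorbEntry ;; .assign 26 (.add (.reg 26) (.reg rWid))) ;;
      .assign 20 (.add (.reg 20) (.reg 21)) ;;
      .assign 23 (.add (.reg 23) (.reg rWid)) ;;
      .assign 24 (.add (.reg 24) (.reg rWid)) ;;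
      .assign 25 (.add (.reg 25) (.const 1)))

/-- The body of the outer loop of `absorb`, without the updates at its end. -/
theorem absorbBlock_ok {s : State} {β Λ R w c : ℕ}
    {Z : ℕ → ℕ → Set (ℕ × Finset (Fin n))} {A B : ℕ → Set (ℕ × Finset (Fin n))}
    (hh : HeapOk n s) (hc : Consts n β Λ s)
    (h20 : s.reg 20 = c) (h21 : s.reg 21 = R * (β + 1)) (h22 : s.reg 22 = w * (β + 1))
    (hZ : ∀ σ < R, Row β s (c + σ * (β + 1)) (Z σ))
    (hA : Row β s (s.reg 23) A) (hB : Row β s (s.reg 24) B) :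
    Ok (.assign 26 (.const 0) ;; .whileLT (.reg 26) (.reg 21)
        (fillRow absorbEntry ;; .assign 26 (.add (.reg 26) (.reg rWid)))) s
      ((R + 2) * ((β + 3) * (160 * (β + 2) + 60) + 10))
      fun s' => Step n 26 s s' ∧ s'.reg rTop = s.reg rTop + R * (β + 1) ∧
        ∀ σ < R, Row β s' (s.reg rTop + σ * (β + 1))
          fun b => conv (Z σ) B b ∪ conv (Z (σ - w)) A b := by
  refine (Ok.assign_seq (Ok.weaken (Ok.forLT R ((β + 3) * (160 * (β + 2) + 20 + 40) + 4)
    (fun i s' => Step n 26 s s' ∧ s'.reg rTop = s.reg rTop + i * (β + 1) ∧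
      s'.reg 26 = i * (β + 1) ∧ ∀ σ < i, Row β s' (s.reg rTop + σ * (β + 1))
          fun b => conv (Z σ) B b ∪ conv (Z (σ - w)) A b)
    ?_ ?_ ?_) le_rfl ?_)).le ?_
  · exact ⟨.setReg (by simp) (by simp), by simp, by simp, by simp⟩
  · rintro i s' ⟨h1, -, h3, -⟩
    simp only [Expr.eval, h3, h1.reg 21 (by simp), h21]
    exact Nat.mul_lt_mul_right (Nat.succ_pos β)
  · rintro i s1 hi ⟨h1, h2, h3, h4⟩
    refine Ok.seq (fillRow_ok (F := fun b => conv (Z i) B b ∪ conv (Z (i - w)) A b) (β := β)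
      (c := 160 * (β + 2) + 20) (h1.heap hh) ((h1.reg 0 (by simp)).trans hc.num)
      ((h1.reg rWid (by simp)).trans hc.wid) ?_) ?_
    · intro s2 h12 hb hacc
      have h02 := h1.trans (h12.mono (by simp))
      have h26 : s2.reg 26 = i * (β + 1) := (h12.reg 26 (by simp)).trans h3
      have e23 := h02.reg 23 (by simp)
      have e24 := h02.reg 24 (by simp)
      refine absorbEntry_ok h26 ((h02.reg 22 (by simp)).trans h22)
        ((h02.reg 20 (by simp)).trans h20) ((hZ i hi).step h02)
        ((hZ (i - w) (by omega)).step h02) ?_ ?_ hb hacc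
      · rw [e23]; exact hA.step h02
      · rw [e24]; exact hB.step h02
    · rintro s2 ⟨g1, g2, g3⟩
      have h26 : s2.reg 26 = i * (β + 1) := (g1.reg 26 (by simp)).trans h3
      have g1' := g1.mono (r' := 26) (by simp)
      have hw2 : s2.reg rWid = β + 1 := ((h1.trans g1').reg rWid (by simp)).trans hc.wid
      have hset : Step n 26 s2 (s2.setReg 26 (i * (β + 1) + (β + 1))) :=
        .setReg (by simp) (by simp)
      refine Ok.assign ?_
      simp only [Expr.eval, h26, hw2]
      refine ⟨(h1.trans g1').trans hset, ?_, by simp; ring, fun σ hσ => ?_⟩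
      · simp [g2, h2]; ring
      · obtain hσ | rfl := Nat.lt_succ_iff_lt_or_eq.1 hσ
        · exact ((h4 σ hσ).step g1').step hset
        · rw [h2] at g3
          exact g3.step hset
  · rintro s' ⟨h1, h2, -, h4⟩
    exact ⟨h1, h2, h4⟩
  · simp only [Expr.steps]
    nlinarith

theorem absorb_ok {s : State} {β Λ R w zA aA bA : ℕ}
    {Z : ℕ → ℕ → ℕ → Set (ℕ × Finset (Fin n))} {A B : ℕ → ℕ → Set (ℕ × Finset (Fin n))}
    (hh : HeapOk n s) (hc : Consts n β Λ s)
    (h20 : s.reg 20 = zA) (h23 : s.reg 23 = aA) (h24 : s.reg 24 = bA)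
    (h21 : s.reg 21 = R * (β + 1)) (h22 : s.reg 22 = w * (β + 1))
    (hZ : Tab β Λ s zA R Z) (hA : Tab β Λ s aA 1 fun τ _ => A τ)
    (hB : Tab β Λ s bA 1 fun τ _ => B τ) :
    Ok absorb s ((Λ + 3) * ((R + 2) * ((β + 3) * (160 * (β + 2) + 60) + 10) + 30))
      fun s' => Step n 20 s s' ∧ s'.reg rTop = s.reg rTop + (Λ + 1) * (R * (β + 1)) ∧
      Tab β Λ s' (s.reg rTop) R fun τ σ b => conv (Z τ σ) (B τ) b ∪ conv (Z τ (σ - w)) (A τ) b := by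
  unfold absorb
  set d := (R + 2) * ((β + 3) * (160 * (β + 2) + 60) + 10) with hd
  refine (Ok.assign_seq (Ok.weaken (Ok.forLT (Λ + 1) (d + (4 + (4 + (4 + 4))))
    (fun i s' => Step n 20 s s' ∧ s'.reg rTop = s.reg rTop + i * (R * (β + 1)) ∧ s'.reg 25 = i ∧
      s'.reg 20 = zA + i * (R * (β + 1)) ∧ s'.reg 23 = aA + i * (β + 1) ∧
      s'.reg 24 = bA + i * (β + 1) ∧ s'.reg 21 = R * (β + 1) ∧ s'.reg 22 = w * (β + 1) ∧
      ∀ τ < i, ∀ σ < R, Row β s' (s.reg rTop + (τ * R + σ) * (β + 1))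
          fun b => conv (Z τ σ) (B τ) b ∪ conv (Z τ (σ - w)) (A τ) b)
    ?_ ?_ ?_) le_rfl ?_)).le ?_
  · exact ⟨.setReg (by simp) (by simp), by simp, by simp, by simp [h20], by simp [h23],
      by simp [h24], by simp [h21], by simp [h22], by simp⟩
  · rintro i s' ⟨h1, -, h3, -⟩
    simp only [Expr.eval, h3, h1.reg rTimes (by simp), hc.times]
  · rintro i s1 hi ⟨h1, h2, h3, k20, k23, k24, k21, k22, h4⟩
    have hblock := absorbBlock_ok (n := n) (s := s1) (β := β) (Λ := Λ) (R := R) (w := w)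
      (c := zA + i * (R * (β + 1))) (Z := Z i) (A := A i) (B := B i) (h1.heap hh)
      (hc.step h1 (by simp)) k20 k21 k22
      (fun σ hσ => by
        have := (hZ i (by omega) σ hσ).step h1
        have e : zA + (i * R + σ) * (β + 1) = zA + i * (R * (β + 1)) + σ * (β + 1) := by ring
        rwa [e] at this)
      (by simpa [k23] using (hA i (by omega) 0 (by simp)).step h1)
      (by simpa [k24] using (hB i (by omega) 0 (by simp)).step h1)
    refine Ok.seq_seq hblock ?_
    rintro s2 ⟨g1, g2, g3⟩
    have g1' := g1.mono (r' := 20) (by simp)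
    have e25 := g1.reg 25 (by simp)
    have e20 := g1.reg 20 (by simp)
    have e21 := g1.reg 21 (by simp)
    have e22 := g1.reg 22 (by simp)
    have e23 := g1.reg 23 (by simp)
    have e24 := g1.reg 24 (by simp)
    have ew := ((h1.trans g1').reg rWid (by simp)).trans hc.wid
    refine Ok.assign_seq (Ok.assign_seq (Ok.assign_seq (Ok.assign ?_)))
    simp only [Expr.eval, State.setReg_reg, e25, h3, e20, e21, k20, k21, e23, k23, e24, k24, ew]
    norm_num
    have hset := (((Step.setReg (n := n) (r := 20) (s := s2) (x := 20)
      (k := zA + i * (R * (β + 1)) + R * (β + 1)) (by simp) (by simp)).trans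
      (Step.setReg (x := 23) (k := aA + i * (β + 1) + (β + 1)) (by simp) (by simp))).trans
      (Step.setReg (x := 24) (k := bA + i * (β + 1) + (β + 1)) (by simp) (by simp))).trans
      (Step.setReg (x := 25) (k := i + 1) (by simp) (by simp))
    refine ⟨(h1.trans g1').trans hset, ?_, by ring, by ring, by ring, by rw [e22, k22],
      ?_⟩
    · simp [g2, h2]; ring
    · intro τ hτ σ hσ
      obtain hτ | rfl := Nat.lt_succ_iff_lt_or_eq.1 (Nat.lt_succ_iff.2 hτ)
      · exact ((h4 τ hτ σ hσ).step g1').step hset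
      · have := (g3 σ hσ).step hset
        rw [h2] at this
        have e : s.reg rTop + τ * (R * (β + 1)) + σ * (β + 1) =
          s.reg rTop + (τ * R + σ) * (β + 1) := by ring
        rwa [e] at this
  · rintro s' ⟨h1, h2, -, -, -, -, -, -, h4⟩
    exact ⟨h1, h2, fun τ hτ σ hσ => h4 τ (by omega) σ hσ⟩
  · simp only [Expr.steps]
    nlinarith

end

section

/-! ### Certificates for influence -/

namespace Network

variable {V : Type*} [Fintype V] (N : Network V)

open Classical in
/-- The weight of the arc `(x, u)`, or 0 if there is no such arc. -/
noncomputable def arc (x u : V) : ℕ := if N.graph.Adj x u then N.w x u else 0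

/-- `x` and `y` are joined by an arc, in some direction. -/
def Nbr (x y : V) : Prop := N.graph.Adj x y ∨ N.graph.Adj y x

variable {N} in
theorem nbr_of_arc_ne_zero {x u : V} (h : N.arc x u ≠ 0) : N.Nbr x u := by
  unfold arc at h
  exact .inl (by by_contra h'; simp [h'] at h)

/-- The weight that `u` receives from those vertices of `R` whose time in `a` is before `τ`. -/
noncomputable def support (R : Finset V) (a : V → ℕ) (τ : ℕ) (u : V) : ℕ :=
  ∑ x ∈ R, if a x < τ then N.arc x u else 0

/-- The times `a`, where `Λ` stands for "never", are justified at `u`: if `u` is influenced at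
time `a u`, it belongs to the target set, or it receives enough weight from vertices with earlier
times. -/
def Certified (Λ : ℕ) (a : V → ℕ) (u : V) : Prop :=
  a u = 0 ∨ a u = Λ ∨ N.t u ≤ N.support Finset.univ a (a u) u

variable {N}

theorem support_congr {R : Finset V} {a a' : V → ℕ} {τ : ℕ} {u : V}
    (h : ∀ x ∈ R, N.arc x u ≠ 0 → a x = a' x) : N.support R a τ u = N.support R a' τ u := by
  refine Finset.sum_congr rfl fun x hx => ?_
  by_cases h0 : N.arc x u = 0
  · simp [h0]
  · rw [h x hx h0]

theorem Certified.congr {Λ : ℕ} {a a' : V → ℕ} {u : V} (h : N.Certified Λ a u)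
    (hu : a' u = a u) (hx : ∀ x, N.Nbr u x → a' x = a x) : N.Certified Λ a' u := by
  unfold Certified
  rw [hu, support_congr fun x _ h0 => hx x (nbr_of_arc_ne_zero h0).symm]
  exact h

theorem influenced_mono (S : Finset V) : Monotone (N.influenced S) := by
  classical
  refine monotone_nat_of_le_succ fun τ => ?_
  rw [influenced]
  exact fun u hu => Finset.mem_union.2 (.inl hu)

/-- The sum in the definition of `influenced`, in terms of `support`. -/
theorem sum_inNbrs_inter (I : Finset V) (u : V) [DecidableEq V] :
    ∑ v ∈ N.inNbrs u ∩ I, N.w v u = ∑ x ∈ I, N.arc x u := by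
  classical
  have : N.inNbrs u ∩ I = I.filter fun v => N.graph.Adj v u := by
    ext v; simp [inNbrs, and_comm]
  rw [this, Finset.sum_filter]
  exact Finset.sum_congr rfl fun x _ => by unfold arc; congr

theorem mem_influenced_of_certified {lam : ℕ} {a : V → ℕ} {S : Finset V}
    (hS : ∀ u, a u = 0 → u ∈ S) (ha : ∀ u, N.Certified (lam + 1) a u) :
    ∀ τ u, a u = τ → τ ≤ lam → u ∈ N.influenced S τ := by
  classical
  intro τ
  induction τ using Nat.strong_induction_on with
  | _ τ ih =>
  intro u hu hτ
  obtain h | h | h := ha u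
  · obtain rfl : τ = 0 := by omega
    exact hS u h
  · omega
  · obtain _ | τ := τ
    · exact hS u hu
    rw [influenced]
    simp only [Finset.mem_union, Finset.mem_filter, Finset.mem_univ, true_and]
    right
    convert h.trans ?_
    rw [sum_inNbrs_inter, hu, support, ← Finset.sum_filter]
    refine Finset.sum_le_sum_of_subset fun x hx => ?_
    simp only [Finset.mem_filter, Finset.mem_univ, true_and] at hx
    exact influenced_mono S (Nat.lt_succ_iff.1 hx) (ih (a x) hx x rfl (by omega))

open Classical in
/-- The time at which `u` is influenced from `S`, where `lam + 1` stands for "not within round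
`lam`". -/
noncomputable def time (N : Network V) (S : Finset V) (lam : ℕ) (u : V) : ℕ :=
  if h : ∃ τ, τ ≤ lam ∧ u ∈ N.influenced S τ then Nat.find h else lam + 1

theorem time_le (S : Finset V) (lam : ℕ) (u : V) : N.time S lam u ≤ lam + 1 := by
  classical
  unfold time
  split_ifs with h
  · exact (Nat.find_spec h).1.trans (Nat.le_succ _)
  · exact le_rfl

theorem time_le_iff {S : Finset V} {lam τ : ℕ} {u : V} (hτ : τ ≤ lam) :
    N.time S lam u ≤ τ ↔ u ∈ N.influenced S τ := by
  classical
  unfold time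
  split_ifs with h
  · exact ⟨fun h' => influenced_mono S h' (Nat.find_spec h).2, fun h' => Nat.find_min' h ⟨hτ, h'⟩⟩
  · exact ⟨fun h' => by omega, fun h' => absurd ⟨τ, hτ, h'⟩ h⟩

theorem certified_time (S : Finset V) (lam : ℕ) (u : V) :
    N.Certified (lam + 1) (N.time S lam) u := by
  classical
  by_cases h0 : N.time S lam u = 0
  · exact .inl h0
  by_cases h1 : N.time S lam u = lam + 1
  · exact .inr (.inl h1)
  right; right
  have hle := N.time_le S lam u
  obtain ⟨τ, hτ⟩ := Nat.exists_eq_succ_of_ne_zero h0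
  have hτl : τ + 1 ≤ lam := by omega
  have hmem := (time_le_iff hτl).1 hτ.le
  have hnot : u ∉ N.influenced S τ := fun h => by
    have := (time_le_iff (lam := lam) (by omega)).2 h
    omega
  rw [influenced] at hmem
  simp only [Finset.mem_union, hnot, Finset.mem_filter, Finset.mem_univ, true_and, false_or]
    at hmem
  rw [sum_inNbrs_inter] at hmem
  refine hmem.trans_eq ?_
  rw [support, ← Finset.sum_filter, hτ]
  congr 1
  ext x
  simp only [Finset.mem_filter, Finset.mem_univ, true_and]
  rw [← time_le_iff (lam := lam) (by omega)]
  exact Nat.lt_succ_iff.symm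

/-! ### Partial solutions -/

variable [DecidableEq V]

/-- The partial solutions on the region `R` of cost at most `b`, for times `a` that satisfy `P`:
the number of vertices of `R` that are influenced, and the set of those in the target set. -/
def sol (N : Network V) (Λ : ℕ) (R : Finset V) (P : (V → ℕ) → Prop) (b : ℕ) :
    Set (ℕ × Finset V) :=
  {q | ∃ a : V → ℕ, (∀ u, a u ≤ Λ) ∧ P a ∧ N.cost (R.filter fun u => a u = 0) ≤ b ∧
    q = ((R.filter fun u => a u < Λ).card, R.filter fun u => a u = 0)}

/-- Partial solutions depend on the times only up to changes outside of the region. -/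
theorem sol_mono {Λ : ℕ} {R : Finset V} {P Q : (V → ℕ) → Prop}
    (h : ∀ a, (∀ u, a u ≤ Λ) → P a → ∃ a', (∀ u, a' u ≤ Λ) ∧ Q a' ∧ ∀ u ∈ R, a' u = a u) (b : ℕ) :
    N.sol Λ R P b ⊆ N.sol Λ R Q b := by
  rintro q ⟨a, ha, hP, hb, rfl⟩
  obtain ⟨a', ha', hQ, he⟩ := h a ha hP
  have e1 : (R.filter fun u => a' u = 0) = R.filter fun u => a u = 0 :=
    Finset.filter_congr fun u hu => by rw [he u hu]
  have e2 : (R.filter fun u => a' u < Λ) = R.filter fun u => a u < Λ :=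
    Finset.filter_congr fun u hu => by rw [he u hu]
  exact ⟨a', ha', hQ, by rwa [e1], by rw [e1, e2]⟩

theorem sol_congr {Λ : ℕ} {R : Finset V} {P Q : (V → ℕ) → Prop}
    (h : ∀ a, (∀ u, a u ≤ Λ) → (P a ↔ Q a)) (b : ℕ) : N.sol Λ R P b = N.sol Λ R Q b :=
  (sol_mono (fun a ha hP => ⟨a, ha, (h a ha).1 hP, fun _ _ => rfl⟩) b).antisymm
    (sol_mono (fun a ha hP => ⟨a, ha, (h a ha).2 hP, fun _ _ => rfl⟩) b)

theorem sol_union {Λ : ℕ} {R : Finset V} {P Q : (V → ℕ) → Prop} (b : ℕ) :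
    N.sol Λ R P b ∪ N.sol Λ R Q b = N.sol Λ R (fun a => P a ∨ Q a) b := by
  ext q
  constructor
  · rintro (⟨a, ha, hP, h⟩ | ⟨a, ha, hP, h⟩)
    exacts [⟨a, ha, .inl hP, h⟩, ⟨a, ha, .inr hP, h⟩]
  · rintro ⟨a, ha, hP | hP, h⟩
    exacts [.inl ⟨a, ha, hP, h⟩, .inr ⟨a, ha, hP, h⟩]

/-- The times `a₂` on `R`, and the times `a₁` elsewhere. -/
def glue (R : Finset V) (a₁ a₂ : V → ℕ) (u : V) : ℕ := if u ∈ R then a₂ u else a₁ u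

omit [Fintype V] in
theorem glue_of_mem {R : Finset V} {a₁ a₂ : V → ℕ} {u : V} (h : u ∈ R) :
    glue R a₁ a₂ u = a₂ u := if_pos h

omit [Fintype V] in
theorem glue_of_notMem {R : Finset V} {a₁ a₂ : V → ℕ} {u : V} (h : u ∉ R) :
    glue R a₁ a₂ u = a₁ u := if_neg h

/-- Partial solutions on disjoint regions are combined by convolution, provided that the conditions
on them can be checked separately. -/
theorem conv_sol {Λ : ℕ} {R₁ R₂ : Finset V} (hR : Disjoint R₁ R₂) {P₁ P₂ P : (V → ℕ) → Prop}
    (h₁ : ∀ a, P a → P₁ a ∧ P₂ a) (h₂ : ∀ a₁ a₂, P₁ a₁ → P₂ a₂ → P (glue R₂ a₁ a₂)) (b : ℕ) :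
    conv (N.sol Λ R₁ P₁) (N.sol Λ R₂ P₂) b = N.sol Λ (R₁ ∪ R₂) P b := by
  have hcost (a : V → ℕ) : N.cost ((R₁ ∪ R₂).filter fun u => a u = 0) =
      N.cost (R₁.filter fun u => a u = 0) + N.cost (R₂.filter fun u => a u = 0) := by
    rw [Finset.filter_union, cost, Finset.sum_union (Finset.disjoint_filter_filter hR)]
    rfl
  have hcard (a : V → ℕ) : ((R₁ ∪ R₂).filter fun u => a u < Λ).card =
      (R₁.filter fun u => a u < Λ).card + (R₂.filter fun u => a u < Λ).card := by
    rw [Finset.filter_union, Finset.card_union_of_disjoint (Finset.disjoint_filter_filter hR)]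
  ext q
  constructor
  · rintro ⟨j, hj, _, ⟨a₁, ha₁, hP₁, hb₁, rfl⟩, _, ⟨a₂, ha₂, hP₂, hb₂, rfl⟩, rfl⟩
    have g₁ : ∀ u ∈ R₁, glue R₂ a₁ a₂ u = a₁ u := fun u hu =>
      glue_of_notMem (Finset.disjoint_left.1 hR hu)
    have g₂ : ∀ u ∈ R₂, glue R₂ a₁ a₂ u = a₂ u := fun u hu => glue_of_mem hu
    have e1 : (R₁.filter fun u => glue R₂ a₁ a₂ u = 0) = R₁.filter fun u => a₁ u = 0 :=
      Finset.filter_congr fun u hu => by rw [g₁ u hu]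
    have e2 : (R₂.filter fun u => glue R₂ a₁ a₂ u = 0) = R₂.filter fun u => a₂ u = 0 :=
      Finset.filter_congr fun u hu => by rw [g₂ u hu]
    have e3 : (R₁.filter fun u => glue R₂ a₁ a₂ u < Λ) = R₁.filter fun u => a₁ u < Λ :=
      Finset.filter_congr fun u hu => by rw [g₁ u hu]
    have e4 : (R₂.filter fun u => glue R₂ a₁ a₂ u < Λ) = R₂.filter fun u => a₂ u < Λ :=
      Finset.filter_congr fun u hu => by rw [g₂ u hu]
    refine ⟨glue R₂ a₁ a₂, fun u => ?_, h₂ _ _ hP₁ hP₂, ?_, ?_⟩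
    · unfold glue; split_ifs
      exacts [ha₂ u, ha₁ u]
    · rw [hcost, e1, e2]; omega
    · rw [hcard, Finset.filter_union, e1, e2, e3, e4]
  · rintro ⟨a, ha, hP, hb, rfl⟩
    rw [hcost] at hb
    refine ⟨N.cost (R₁.filter fun u => a u = 0), by omega, _,
      ⟨a, ha, (h₁ a hP).1, le_rfl, rfl⟩, _, ⟨a, ha, (h₁ a hP).2, by omega, rfl⟩, ?_⟩
    rw [hcard, Finset.filter_union]

/-- The region `R` hangs on the vertex `u`: it is connected with other vertices through `u` only. -/
def Hangs (N : Network V) (u : V) (R : Finset V) : Prop :=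
  ∀ x ∈ R, x ≠ u → ∀ y, N.Nbr x y → y = u ∨ y ∈ R

/-- Partial solutions on a region `R` that hangs on `u`, where `u` has time `τ` and has to receive a
weight of at least `σ` from `R`. Whether `τ` is justified is left open. -/
def rooted (N : Network V) (Λ : ℕ) (R : Finset V) (u : V) (τ σ : ℕ) : ℕ → Set (ℕ × Finset V) :=
  N.sol Λ R fun a => a u = τ ∧ (∀ x ∈ R, x ≠ u → N.Certified Λ a x) ∧ σ ≤ N.support R a τ u

/-- Partial solutions on a region `R` that hangs on `v`, where `v` has a time below `ℓ` and gets the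
additional weight `δ τ` if it has time `τ`. -/
def supported (N : Network V) (Λ : ℕ) (R : Finset V) (v : V) (ℓ : ℕ) (δ : ℕ → ℕ) :
    ℕ → Set (ℕ × Finset V) :=
  N.sol Λ R fun a => a v < ℓ ∧ (∀ x ∈ R, x ≠ v → N.Certified Λ a x) ∧
    (a v = 0 ∨ a v = Λ ∨ N.t v ≤ N.support R a (a v) v + δ (a v))

/-- Partial solutions on the region `R` of a child `v` of `p`, where `p` has time `τp` and `v` has a
time below `ℓ`. -/
def childSol (N : Network V) (Λ : ℕ) (R : Finset V) (v p : V) (ℓ τp : ℕ) :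
    ℕ → Set (ℕ × Finset V) :=
  N.sol Λ R fun a => a p = τp ∧ a v < ℓ ∧ ∀ x ∈ R, N.Certified Λ a x

theorem support_union {R₁ R₂ : Finset V} (hR : Disjoint R₁ R₂) (a : V → ℕ) (τ : ℕ) (u : V) :
    N.support (R₁ ∪ R₂) a τ u = N.support R₁ a τ u + N.support R₂ a τ u :=
  Finset.sum_union hR

theorem support_le (R : Finset V) (a : V → ℕ) (τ : ℕ) (u : V) :
    N.support R a τ u ≤ ∑ x ∈ R, N.arc x u :=
  Finset.sum_le_sum fun x _ => by split_ifs <;> simp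

/-- With the threshold capped at one more than the total weight of the incoming arcs, `demand` is
what the region `R` has to supply. -/
theorem demand_le_iff {Λ τ τp w : ℕ} {R : Finset V} {v : V} {a : V → ℕ} (hτ : τ ≤ Λ)
    (hw : ∑ x ∈ R, N.arc x v + w ≤ ∑ x, N.arc x v) :
    demand Λ (min (N.t v) (∑ x, N.arc x v + 1)) w τp τ ≤ N.support R a τ v ↔
      τ = 0 ∨ τ = Λ ∨ N.t v ≤ N.support R a τ v + if τp < τ then w else 0 := by
  have := N.support_le R a τ v
  unfold demand
  split_ifs <;> omega

/-- Joining the two parts of the region of a vertex `v`, where the light part gives no weight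
to `v`. -/
theorem conv_rooted {Λ ℓ : ℕ} {R₁ R₂ : Finset V} {v : V} {d δ : ℕ → ℕ}
    (hR : Disjoint R₁ R₂) (hv : v ∈ R₁) (h₁ : N.Hangs v R₁) (h₂ : N.Hangs v R₂)
    (h0 : ∀ x ∈ R₁, x ≠ v → N.arc x v = 0)
    (hd : ∀ a : V → ℕ, ∀ τ < ℓ, d τ ≤ N.support R₂ a τ v ↔
      τ = 0 ∨ τ = Λ ∨ N.t v ≤ N.support R₂ a τ v + δ τ) (b : ℕ) :
    {q | ∃ τ < ℓ, q ∈ conv (N.rooted Λ R₁ v τ 0) (N.rooted Λ R₂ v τ (d τ)) b} =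
      N.supported Λ (R₁ ∪ R₂) v ℓ δ b := by
  have hv2 : v ∉ R₂ := Finset.disjoint_left.1 hR hv
  have hsupp (a : V → ℕ) : N.support (R₁ ∪ R₂) a (a v) v = N.support R₂ a (a v) v := by
    rw [support_union hR, add_eq_right]
    refine Finset.sum_eq_zero fun x hx => ?_
    by_cases hxv : x = v
    · simp [hxv]
    · simp [h0 x hx hxv]
  have key (τ : ℕ) (hτ : τ < ℓ) : conv (N.rooted Λ R₁ v τ 0) (N.rooted Λ R₂ v τ (d τ)) b =
      N.sol Λ (R₁ ∪ R₂) (fun a => a v = τ ∧ a v < ℓ ∧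
        (∀ x ∈ R₁ ∪ R₂, x ≠ v → N.Certified Λ a x) ∧
        (a v = 0 ∨ a v = Λ ∨ N.t v ≤ N.support (R₁ ∪ R₂) a (a v) v + δ (a v))) b := by
    refine conv_sol hR ?_ ?_ b
    · rintro a ⟨rfl, -, hc, h⟩
      rw [hsupp, ← hd a _ hτ] at h
      exact ⟨⟨rfl, fun x hx => hc x (Finset.mem_union_left _ hx), Nat.zero_le _⟩, rfl,
        fun x hx => hc x (Finset.mem_union_right _ hx), h⟩
    · rintro a₁ a₂ ⟨e₁, hc₁, -⟩ ⟨e₂, hc₂, h⟩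
      have ev : glue R₂ a₁ a₂ v = τ := by rw [glue_of_notMem hv2, e₁]
      refine ⟨ev, by omega, fun x hx hxv => ?_, ?_⟩
      · obtain hx | hx := Finset.mem_union.1 hx
        · refine (hc₁ x hx hxv).congr (glue_of_notMem (Finset.disjoint_left.1 hR hx))
            fun y hy => glue_of_notMem ?_
          obtain rfl | hy := h₁ x hx hxv y hy
          exacts [hv2, Finset.disjoint_left.1 hR hy]
        · refine (hc₂ x hx hxv).congr (glue_of_mem hx) fun y hy => ?_
          obtain rfl | hy := h₂ x hx hxv y hy
          exacts [ev.trans e₂.symm, glue_of_mem hy]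
      · rw [hsupp, ev, ← hd _ _ hτ, support_congr (a' := a₂) fun x hx _ => glue_of_mem hx]
        exact h
  ext q
  constructor
  · rintro ⟨τ, hτ, hq⟩
    rw [key τ hτ] at hq
    exact sol_mono (fun a ha h => ⟨a, ha, h.2, fun _ _ => rfl⟩) b hq
  · rintro ⟨a, ha, hP, h⟩
    refine ⟨a v, hP.1, ?_⟩
    rw [key _ hP.1]
    exact ⟨a, ha, ⟨rfl, hP⟩, h⟩

/-- The time of the parent matters for a child only through the weight of the arc from it. -/
theorem supported_eq_childSol {Λ ℓ τp : ℕ} {R : Finset V} {v p : V} (hv : v ∈ R) (hp : p ∉ R)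
    (hR : N.Hangs v R) (hvp : ∀ x, N.Nbr x v → x ∈ R ∨ x = p) (hτp : τp ≤ Λ) (b : ℕ) :
    N.supported Λ R v ℓ (fun τ => if τp < τ then N.arc p v else 0) b =
      N.childSol Λ R v p ℓ τp b := by
  have hne : ∀ x ∈ R, x ≠ p := fun x hx h => hp (h ▸ hx)
  have hsupp (a : V → ℕ) : N.support Finset.univ a (a v) v =
      N.support R a (a v) v + if a p < a v then N.arc p v else 0 := by
    unfold support
    rw [add_comm, ← Finset.sum_insert (f := fun x => if a x < a v then N.arc x v else 0) hp]
    refine (Finset.sum_subset (Finset.subset_univ _) fun x _ hx => ?_).symm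
    simp only [Finset.mem_insert, not_or] at hx
    have : N.arc x v = 0 := by
      by_contra h0
      obtain h | h := hvp x (nbr_of_arc_ne_zero h0)
      exacts [hx.2 h, hx.1 h]
    simp [this]
  refine (sol_mono (fun a ha h => ?_) b).antisymm (sol_mono (fun a ha h => ?_) b)
  · obtain ⟨hl, hc, h⟩ := h
    have e : ∀ x ∈ R, Function.update a p τp x = a x := fun x hx =>
      Function.update_of_ne (hne x hx) _ _
    refine ⟨Function.update a p τp, fun u => ?_, ⟨by simp, by rwa [e v hv], fun x hx => ?_⟩, e⟩
    · by_cases hu : u = p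
      · subst hu; simpa using hτp
      · simpa [hu] using ha u
    · by_cases hxv : x = v
      · subst hxv
        unfold Certified
        rw [hsupp, e x hx, support_congr fun y hy _ => e y hy]
        simpa using h
      · refine (hc x hx hxv).congr (e x hx) fun y hy => ?_
        obtain rfl | hy := hR x hx hxv y hy
        exacts [e _ hv, e _ hy]
  · obtain ⟨rfl, hl, hc⟩ := h
    refine ⟨a, ha, ⟨hl, fun x hx _ => hc x hx, ?_⟩, fun _ _ => rfl⟩
    have := hc v hv
    unfold Certified at this
    rwa [hsupp] at this

/-- The absorption of a child `v`, with region `C`, into the region of its parent `p`. -/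
theorem conv_childSol {Λ τ σ : ℕ} {R C : Finset V} {p v : V} (hR : Disjoint R C) (hv : v ∈ C)
    (hp : p ∉ C) (hRp : N.Hangs p R) (hCp : N.Hangs p C)
    (h0 : ∀ x ∈ C, x ≠ v → N.arc x p = 0) (b : ℕ) :
    conv (N.rooted Λ R p τ σ) (N.childSol Λ C v p (Λ + 1) τ) b ∪
      conv (N.rooted Λ R p τ (σ - N.arc v p)) (N.childSol Λ C v p τ τ) b =
      N.rooted Λ (R ∪ C) p τ σ b := by
  have hsuppC (a : V → ℕ) : N.support C a τ p = if a v < τ then N.arc v p else 0 :=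
    Finset.sum_eq_single_of_mem v hv fun x hx hxv => by simp [h0 x hx hxv]
  have key (ℓ σ' : ℕ) : conv (N.rooted Λ R p τ σ') (N.childSol Λ C v p ℓ τ) b =
      N.sol Λ (R ∪ C) (fun a => (a p = τ ∧ (∀ x ∈ R ∪ C, x ≠ p → N.Certified Λ a x)) ∧
        a v < ℓ ∧ σ' ≤ N.support R a τ p) b := by
    refine conv_sol hR ?_ ?_ b
    · rintro a ⟨⟨e, hc⟩, hl, h⟩
      exact ⟨⟨e, fun x hx => hc x (Finset.mem_union_left _ hx), h⟩, e, hl,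
        fun x hx => hc x (Finset.mem_union_right _ hx) fun hxp => hp (hxp ▸ hx)⟩
    · rintro a₁ a₂ ⟨e₁, hc₁, h⟩ ⟨e₂, hl, hc₂⟩
      have ep : glue C a₁ a₂ p = τ := by rw [glue_of_notMem hp, e₁]
      have eR : ∀ x ∈ R, glue C a₁ a₂ x = a₁ x := fun x hx =>
        glue_of_notMem (Finset.disjoint_left.1 hR hx)
      refine ⟨⟨ep, fun x hx hxp => ?_⟩, by rwa [glue_of_mem hv], ?_⟩
      · obtain hx | hx := Finset.mem_union.1 hx
        · refine (hc₁ x hx hxp).congr (eR x hx) fun y hy => ?_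
          obtain rfl | hy := hRp x hx hxp y hy
          exacts [ep.trans e₁.symm, eR y hy]
        · refine (hc₂ x hx).congr (glue_of_mem hx) fun y hy => ?_
          obtain rfl | hy := hCp x hx hxp y hy
          exacts [ep.trans e₂.symm, glue_of_mem hy]
      · rwa [support_congr (a' := a₁) fun x hx _ => eR x hx]
  rw [key, key, sol_union]
  refine sol_congr (fun a ha => ?_) b
  rw [support_union hR, hsuppC]
  have := ha v
  constructor
  · rintro (⟨⟨h1, h2⟩, h3, h4⟩ | ⟨⟨h1, h2⟩, h3, h4⟩)
    · exact ⟨h1, h2, by omega⟩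
    · exact ⟨h1, h2, by rw [if_pos h3]; omega⟩
  · rintro ⟨h1, h2, h3⟩
    by_cases h : a v < τ
    · rw [if_pos h] at h3
      exact .inr ⟨⟨h1, h2⟩, h, by omega⟩
    · rw [if_neg h] at h3
      exact .inl ⟨⟨h1, h2⟩, by omega, by omega⟩

theorem rooted_empty {Λ τ σ b : ℕ} {u : V} (hτ : τ ≤ Λ) :
    N.rooted Λ ∅ u τ σ b = if σ = 0 then {(0, ∅)} else ∅ := by
  ext q
  split_ifs with h
  · constructor
    · rintro ⟨a, -, -, -, rfl⟩; simp
    · rintro rfl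
      exact ⟨fun _ => τ, fun _ => hτ, by simp [h], by simp [cost], by simp⟩
  · simp only [Set.mem_empty_iff_false, iff_false]
    rintro ⟨a, -, ⟨-, -, h'⟩, -⟩
    simp [support] at h'
    omega

theorem rooted_singleton {Λ τ b : ℕ} {u : V} (hτ : τ ≤ Λ) :
    N.rooted Λ {u} u τ 0 b = if τ = 0 then if N.c u ≤ b then {(if 0 < Λ then 1 else 0, {u})} else ∅
      else if τ < Λ then {(1, ∅)} else {(0, ∅)} := by
  ext q
  have h : q ∈ N.rooted Λ {u} u τ 0 b ↔
      (if τ = 0 then N.c u else 0) ≤ b ∧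
        q = (if τ < Λ then 1 else 0, if τ = 0 then {u} else ∅) := by
    constructor
    · rintro ⟨a, -, ⟨rfl, -, -⟩, hb, rfl⟩
      rw [Finset.filter_singleton, Finset.filter_singleton] at *
      refine ⟨?_, ?_⟩
      · convert hb using 1
        split_ifs <;> simp [cost]
      · split_ifs <;> simp
    · rintro ⟨hb, rfl⟩
      refine ⟨fun _ => τ, fun _ => hτ, ⟨rfl, by simp, Nat.zero_le _⟩, ?_, ?_⟩
      · rw [Finset.filter_singleton]
        convert hb using 1
        split_ifs <;> simp [cost]
      · rw [Finset.filter_singleton, Finset.filter_singleton]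
        split_ifs <;> simp
  rw [h]
  split_ifs with h1 h2 h3 h4 <;> simp_all

/-- A best solution for the whole graph is an optimal target set. -/
theorem isMaxInfluencing_of_best {lam β k : ℕ} {S : Finset V} {r : V}
    (h : Best k S (N.supported (lam + 1) Finset.univ r (lam + 2) (fun _ => 0) β)) :
    N.IsMaxInfluencing lam β S := by
  have hsol : N.supported (lam + 1) Finset.univ r (lam + 2) (fun _ => 0) β =
      N.sol (lam + 1) Finset.univ (fun a => ∀ x, N.Certified (lam + 1) a x) β := by
    refine sol_congr (fun a ha => ⟨fun h x => ?_, fun h => ⟨?_, fun x _ _ => h x, h r⟩⟩) β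
    · by_cases hx : x = r
      · subst hx; exact h.2.2
      · exact h.2.1 x (Finset.mem_univ x) hx
    · have := ha r
      omega
  rw [hsol] at h
  have htime (S' : Finset V) (hS' : N.cost S' ≤ β) : ((N.influenced S' lam).card, S') ∈
      N.sol (lam + 1) Finset.univ (fun a => ∀ x, N.Certified (lam + 1) a x) β := by
    have e : (Finset.univ.filter fun u => N.time S' lam u = 0) = S' := by
      ext u
      have := N.time_le_iff (S := S') (u := u) (Nat.zero_le lam)
      rw [influenced] at this
      simp [← this]
    have e' : (Finset.univ.filter fun u => N.time S' lam u < lam + 1) = N.influenced S' lam := by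
      ext u
      simp only [Finset.mem_filter, Finset.mem_univ, true_and, Nat.lt_succ_iff]
      exact N.time_le_iff le_rfl
    exact ⟨N.time S' lam, N.time_le S' lam, N.certified_time S' lam, by rwa [e], by rw [e, e']⟩
  obtain ⟨-, h⟩ | ⟨k, -, ⟨a, ha, hc, hb, he⟩, hmax⟩ := h
  · exact absurd (htime ∅ (by simp [cost])) (by rw [h]; simp)
  · simp only [Prod.mk.injEq] at he
    obtain ⟨hk, rfl⟩ := he
    refine ⟨hb, fun S' hS' => (hmax _ (htime S' hS')).trans (hk ▸ Finset.card_le_card ?_)⟩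
    intro u hu
    simp only [Finset.mem_filter, Finset.mem_univ, true_and, Nat.lt_succ_iff] at hu
    exact influenced_mono _ hu (mem_influenced_of_certified (by simp) hc _ u rfl hu)

end Network

end

section

namespace Network

variable {V : Type*} [Fintype V] [DecidableEq V] {N : Network V}

/-! ### Removing leaves -/

/-- The vertices that have not been absorbed yet; `own x` is the vertex that has absorbed `x`,
directly or through other vertices. -/
def alive (own : V → V) : Finset V := Finset.univ.filter fun x => own x = x

/-- All vertices that `u` has absorbed, and `u` itself. -/
def cluster (own : V → V) (u : V) : Finset V := Finset.univ.filter fun x => own x = u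

/-- The vertices that `u` has absorbed together with a child whose arc into `u` is absent or has
weight 0, and `u` itself; `heavy x` tells whether `x` has been absorbed through an arc of positive
weight. -/
def lightPart (own : V → V) (heavy : V → Bool) (u : V) : Finset V :=
  Finset.univ.filter fun x => own x = u ∧ (x = u ∨ heavy x = false)

/-- The vertices that `u` has absorbed together with a child whose arc into `u` has positive
weight. -/
def heavyPart (own : V → V) (heavy : V → Bool) (u : V) : Finset V :=
  Finset.univ.filter fun x => own x = u ∧ x ≠ u ∧ heavy x = true

open Classical in
/-- The neighbours of `u` that have not been absorbed yet. -/
noncomputable def aliveNbrs (N : Network V) (own : V → V) (u : V) : Finset V :=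
  (alive own).filter fun x => N.Nbr u x

/-- The invariant of the removal of leaves. -/
structure Clustering (N : Network V) (own : V → V) (heavy : V → Bool) : Prop where
  idem : ∀ x, own (own x) = own x
  nbr : ∀ x y, N.Nbr x y → own x ≠ x →
    y = own x ∨ (own y = own x ∧ own y ≠ y ∧ heavy y = heavy x)
  light : ∀ x, own x ≠ x → heavy x = false → N.arc x (own x) = 0
  /-- The remaining graph is connected. -/
  cut : ∀ S : Finset V, ∀ x ∈ S, own x = x → ∀ y ∉ S, own y = y →
    ∃ x ∈ S, ∃ y ∉ S, own x = x ∧ own y = y ∧ N.Nbr x y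
  /-- The remaining graph has as many edges as a tree. -/
  count : ∑ u ∈ alive own, (N.aliveNbrs own u).card + 2 = 2 * (alive own).card

theorem Nbr.symm {x y : V} (h : N.Nbr x y) : N.Nbr y x := Or.symm h

theorem mem_alive {own : V → V} {x : V} : x ∈ alive own ↔ own x = x := by simp [alive]

theorem mem_aliveNbrs {own : V → V} {u x : V} :
    x ∈ N.aliveNbrs own u ↔ own x = x ∧ N.Nbr u x := by simp [aliveNbrs, alive]

theorem lightPart_union_heavyPart (own : V → V) (heavy : V → Bool) (u : V) :
    lightPart own heavy u ∪ heavyPart own heavy u = cluster own u := by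
  ext x
  simp only [lightPart, heavyPart, cluster, Finset.mem_union, Finset.mem_filter, Finset.mem_univ,
    true_and]
  cases heavy x <;> simp; tauto

theorem disjoint_lightPart_heavyPart (own : V → V) (heavy : V → Bool) (u : V) :
    Disjoint (lightPart own heavy u) (heavyPart own heavy u) := by
  rw [Finset.disjoint_left]
  intro x h h'
  simp only [lightPart, heavyPart, Finset.mem_filter, Finset.mem_univ, true_and] at h h'
  cases hx : heavy x <;> simp_all

/-- The clusters after the absorption of `v` by `p`. -/
def absorbOwn (own : V → V) (v p x : V) : V := if own x = v then p else own x

/-- The kinds of the vertices after the absorption of `v` by `p`. -/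
noncomputable def absorbHeavy (N : Network V) (own : V → V) (heavy : V → Bool) (v p x : V) : Bool :=
  if own x = v then decide (N.arc v p ≠ 0) else heavy x

namespace Clustering

variable {own : V → V} {heavy : V → Bool} (h : Clustering N own heavy)

include h

theorem mem_lightPart_self {u : V} (hu : own u = u) : u ∈ lightPart own heavy u := by
  simp [lightPart, hu]

theorem hangs_lightPart (u : V) : N.Hangs u (lightPart own heavy u) := by
  intro x hx hxu y hy
  simp only [lightPart, Finset.mem_filter, Finset.mem_univ, true_and] at hx ⊢
  obtain ⟨rfl, hx⟩ := hx
  obtain rfl | ⟨e, -, e'⟩ := h.nbr x y hy (Ne.symm hxu)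
  · exact .inl rfl
  · right
    refine ⟨e, .inr ?_⟩
    rw [e']
    exact hx.resolve_left hxu

theorem hangs_heavyPart (u : V) : N.Hangs u (heavyPart own heavy u) := by
  intro x hx hxu y hy
  simp only [heavyPart, Finset.mem_filter, Finset.mem_univ, true_and] at hx ⊢
  obtain ⟨rfl, hx⟩ := hx
  obtain rfl | ⟨e, e1, e'⟩ := h.nbr x y hy (Ne.symm hxu)
  · exact .inl rfl
  · right
    exact ⟨e, e ▸ e1.symm, e'.trans hx.2⟩

theorem hangs_cluster (u : V) : N.Hangs u (cluster own u) := by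
  rw [← lightPart_union_heavyPart own heavy u]
  intro x hx hxu y hy
  obtain hx | hx := Finset.mem_union.1 hx
  · exact (h.hangs_lightPart u x hx hxu y hy).imp_right (Finset.mem_union_left _)
  · exact (h.hangs_heavyPart u x hx hxu y hy).imp_right (Finset.mem_union_right _)

theorem arc_lightPart {u x : V} (hx : x ∈ lightPart own heavy u) (hxu : x ≠ u) :
    N.arc x u = 0 := by
  simp only [lightPart, Finset.mem_filter, Finset.mem_univ, true_and] at hx
  obtain ⟨rfl, hx⟩ := hx
  exact h.light x (Ne.symm hxu) (hx.resolve_left hxu)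

/-- A neighbour of a remaining vertex remains, or belongs to its cluster. -/
theorem own_of_nbr {u x : V} (hu : own u = u) (hx : N.Nbr x u) : own x = u ∨ own x = x := by
  by_contra! h'
  obtain e | ⟨-, e, -⟩ := h.nbr x u hx h'.2
  exacts [h'.1 e.symm, e hu]

section Leaf

variable {v p : V} (hv : own v = v) (hp : own p = p) (hleaf : N.aliveNbrs own v = {p}) (hne : p ≠ v)

include hv hleaf

theorem mem_cluster_or_eq {x : V} (hx : N.Nbr x v) : x ∈ cluster own v ∨ x = p := by
  obtain e | e := h.own_of_nbr hv hx
  · exact .inl (by simp [cluster, e])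
  · right
    have : x ∈ N.aliveNbrs own v := mem_aliveNbrs.2 ⟨e, hx.symm⟩
    simpa [hleaf] using this

include hp hne

omit h in
theorem not_nbr_of_alive {x : V} (hx : own x = x) (hxp : x ≠ p) : ¬ N.Nbr v x := by
  intro hn
  have : x ∈ N.aliveNbrs own v := mem_aliveNbrs.2 ⟨hx, hn⟩
  simp [hleaf, hxp] at this

/-- The cluster of a leaf hangs on its neighbour as well. -/
theorem hangs_cluster_parent : N.Hangs p (cluster own v) := by
  intro x hx _ y hy
  by_cases hxv : x = v
  · subst hxv
    exact (h.mem_cluster_or_eq hv hleaf hy.symm).symm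
  · right
    obtain rfl | hy := h.hangs_cluster v x hx hxv y hy
    · simp [cluster, hv]
    · exact hy

theorem arc_cluster {x : V} (hx : x ∈ cluster own v) (hxv : x ≠ v) : N.arc x p = 0 := by
  by_contra h0
  have := h.hangs_cluster v x hx hxv p (nbr_of_arc_ne_zero h0)
  simp [cluster, hp, hne] at this

theorem alive_absorbOwn : alive (absorbOwn own v p) = (alive own).erase v := by
  ext x
  simp only [mem_alive, absorbOwn, Finset.mem_erase]
  split_ifs with hx
  · constructor
    · rintro rfl
      exact absurd (hp.symm.trans hx) hne
    · rintro ⟨h1, h2⟩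
      exact absurd (h2.symm.trans hx) h1
  · constructor
    · exact fun e => ⟨fun e' => hx (by rw [e', hv]), e⟩
    · exact fun e => e.2

theorem aliveNbrs_absorbOwn_of_ne {u : V} (hu : own u = u) (hup : u ≠ p) :
    N.aliveNbrs (absorbOwn own v p) u = N.aliveNbrs own u := by
  unfold aliveNbrs
  rw [h.alive_absorbOwn hv hp hleaf hne, Finset.filter_erase, Finset.erase_eq_of_notMem]
  simp only [Finset.mem_filter, not_and]
  exact fun _ hn => not_nbr_of_alive hv hp hleaf hne hu hup hn.symm

theorem aliveNbrs_absorbOwn_self :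
    N.aliveNbrs (absorbOwn own v p) p = (N.aliveNbrs own p).erase v := by
  unfold aliveNbrs
  rw [h.alive_absorbOwn hv hp hleaf hne, Finset.filter_erase]

theorem absorb : Clustering N (absorbOwn own v p) (N.absorbHeavy own heavy v p) := by
  have hnbr : N.Nbr v p := (mem_aliveNbrs.1 (by simp [hleaf] : p ∈ N.aliveNbrs own v)).2
  have halive {x : V} : absorbOwn own v p x = x ↔ x ≠ v ∧ own x = x := by
    rw [← mem_alive, h.alive_absorbOwn hv hp hleaf hne, Finset.mem_erase, mem_alive]
  refine ⟨fun x => ?_, fun x y hxy hx => ?_, fun x hx hl => ?_, fun S x hx hox y hy hoy => ?_, ?_⟩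
  · rw [halive]
    unfold absorbOwn
    split_ifs with hx
    exacts [⟨hne, hp⟩, ⟨hx, h.idem x⟩]
  · have key (y : V) (hy : own y = v) : absorbOwn own v p y = p ∧ absorbOwn own v p y ≠ y ∧
        N.absorbHeavy own heavy v p y = decide (N.arc v p ≠ 0) := by
      simp only [absorbOwn, absorbHeavy, hy, if_true, true_and, and_true]
      rintro rfl
      exact hne (hp.symm.trans hy)
    by_cases hxv : own x = v
    · obtain ⟨e1, e2, e3⟩ := key x hxv
      rw [e1, e3]
      by_cases hyp : y = p
      · exact .inl hyp
      · right
        have hy : own y = v := by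
          by_cases hx' : x = v
          · subst hx'
            have := h.mem_cluster_or_eq hv hleaf hxy.symm
            simpa [cluster, hyp] using this
          · obtain rfl | ⟨e, -⟩ := h.nbr x y hxy (by rw [hxv]; exact Ne.symm hx')
            exacts [(h.idem x).trans hxv, e.trans hxv]
        exact key y hy
    · have hox : absorbOwn own v p x = own x := if_neg hxv
      rw [hox] at hx ⊢
      obtain e | ⟨e1, e2, e3⟩ := h.nbr x y hxy hx
      · exact .inl e
      · have hyv : own y ≠ v := e1 ▸ hxv
        right
        simp only [absorbOwn, absorbHeavy, hyv, hxv, if_false]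
        exact ⟨e1, e2, e3⟩
  · by_cases hxv : own x = v
    · simp only [absorbHeavy, hxv, if_true, decide_eq_false_iff_not, not_not] at hl
      simp only [absorbOwn, hxv, if_true]
      by_cases hx' : x = v
      · rwa [hx']
      · exact h.arc_cluster hv hp hleaf hne (by simp [cluster, hxv]) hx'
    · simp only [absorbOwn, absorbHeavy, hxv, if_false] at hx hl ⊢
      exact h.light x hx hl
  · rw [halive] at hox hoy
    -- A cut of the smaller graph becomes a cut of the larger one if `v` is put on the side of `p`.
    by_cases hpS : p ∈ S
    · obtain ⟨x', hx', y', hy', ox, oy, hn⟩ := h.cut (insert v S) x (Finset.mem_insert_of_mem hx)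
        hox.2 y (by simp [hoy.1, hy]) hoy.2
      simp only [Finset.mem_insert, not_or] at hx' hy'
      have hx'v : x' ≠ v := by
        rintro rfl
        exact not_nbr_of_alive hv hp hleaf hne oy (fun e => hy'.2 (e ▸ hpS)) hn
      exact ⟨x', hx'.resolve_left hx'v, y', hy'.2, halive.2 ⟨hx'v, ox⟩, halive.2 ⟨hy'.1, oy⟩, hn⟩
    · obtain ⟨x', hx', y', hy', ox, oy, hn⟩ := h.cut (S.erase v) x
        (Finset.mem_erase.2 ⟨hox.1, hx⟩) hox.2 y (by simp [hy]) hoy.2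
      rw [Finset.mem_erase] at hx'
      have hy'v : y' ≠ v := by
        rintro rfl
        exact not_nbr_of_alive hv hp hleaf hne ox (fun e => hpS (e ▸ hx'.2)) hn.symm
      refine ⟨x', hx'.2, y', fun hy'' => hy' (Finset.mem_erase.2 ⟨hy'v, hy''⟩),
        halive.2 ⟨hx'.1, ox⟩, halive.2 ⟨hy'v, oy⟩, hn⟩
  · rw [h.alive_absorbOwn hv hp hleaf hne]
    have hvA : v ∈ alive own := mem_alive.2 hv
    have hpA : p ∈ (alive own).erase v := Finset.mem_erase.2 ⟨hne, mem_alive.2 hp⟩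
    have hcount := h.count
    rw [← Finset.add_sum_erase _ _ hvA, hleaf, Finset.card_singleton,
      ← Finset.add_sum_erase _ _ hpA] at hcount
    have hsum : ∑ u ∈ ((alive own).erase v).erase p, (N.aliveNbrs (absorbOwn own v p) u).card =
        ∑ u ∈ ((alive own).erase v).erase p, (N.aliveNbrs own u).card :=
      Finset.sum_congr rfl fun u hu => by
        rw [Finset.mem_erase, Finset.mem_erase, mem_alive] at hu
        rw [h.aliveNbrs_absorbOwn_of_ne hv hp hleaf hne hu.2.2 hu.1]
    rw [← Finset.add_sum_erase _ _ hpA, h.aliveNbrs_absorbOwn_self hv hp hleaf hne, hsum]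
    have hvp : v ∈ N.aliveNbrs own p := mem_aliveNbrs.2 ⟨hv, hnbr.symm⟩
    have := Finset.card_erase_add_one hvp
    have := Finset.card_erase_add_one hvA
    omega

theorem cluster_disjoint_lightPart : Disjoint (lightPart own heavy p) (cluster own v) := by
  rw [Finset.disjoint_left]
  intro x h1 h2
  simp only [lightPart, cluster, Finset.mem_filter, Finset.mem_univ, true_and] at h1 h2
  exact hne (h1.1.symm.trans h2)

theorem cluster_disjoint_heavyPart : Disjoint (heavyPart own heavy p) (cluster own v) := by
  rw [Finset.disjoint_left]
  intro x h1 h2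
  simp only [heavyPart, cluster, Finset.mem_filter, Finset.mem_univ, true_and] at h1 h2
  exact hne (h1.1.symm.trans h2)

theorem lightPart_absorb :
    lightPart (absorbOwn own v p) (N.absorbHeavy own heavy v p) p =
      if N.arc v p = 0 then lightPart own heavy p ∪ cluster own v else lightPart own heavy p := by
  ext x
  split_ifs with h0
  all_goals
    simp only [lightPart, cluster, absorbOwn, absorbHeavy, Finset.mem_filter, Finset.mem_univ,
      true_and, Finset.mem_union]
    by_cases hx : own x = v
    · have : x ≠ p := by rintro rfl; exact hne (hp.symm.trans hx)
      simp [hx, h0, this, hne.symm]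
    · simp [hx]

theorem heavyPart_absorb :
    heavyPart (absorbOwn own v p) (N.absorbHeavy own heavy v p) p =
      if N.arc v p = 0 then heavyPart own heavy p else heavyPart own heavy p ∪ cluster own v := by
  ext x
  split_ifs with h0
  all_goals
    simp only [heavyPart, cluster, absorbOwn, absorbHeavy, Finset.mem_filter, Finset.mem_univ,
      true_and, Finset.mem_union]
    by_cases hx : own x = v
    · have : x ≠ p := by rintro rfl; exact hne (hp.symm.trans hx)
      simp [hx, h0, this, hne.symm]
    · simp [hx]

theorem lightPart_absorb_of_ne {u : V} (hup : u ≠ p) (huv : u ≠ v) :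
    lightPart (absorbOwn own v p) (N.absorbHeavy own heavy v p) u = lightPart own heavy u := by
  ext x
  simp only [lightPart, absorbOwn, absorbHeavy, Finset.mem_filter, Finset.mem_univ, true_and]
  by_cases hx : own x = v
  · simp [hx, hup.symm, huv.symm]
  · simp [hx]

theorem heavyPart_absorb_of_ne {u : V} (hup : u ≠ p) (huv : u ≠ v) :
    heavyPart (absorbOwn own v p) (N.absorbHeavy own heavy v p) u = heavyPart own heavy u := by
  ext x
  simp only [heavyPart, absorbOwn, absorbHeavy, Finset.mem_filter, Finset.mem_univ, true_and]
  by_cases hx : own x = v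
  · simp [hx, hup.symm, huv.symm]
  · simp [hx]

end Leaf

/-- When there are no leaves any more, only one vertex remains. -/
theorem cluster_eq_univ (hno : ∀ u, own u = u → (N.aliveNbrs own u).card ≠ 1) {r : V}
    (hr : own r = r) : cluster own r = Finset.univ := by
  have hone : ∀ y, own y = y → y = r := by
    by_contra! hy
    obtain ⟨y, hy, hyr⟩ := hy
    have h2 : ∀ u ∈ alive own, 2 ≤ (N.aliveNbrs own u).card := by
      intro u hu
      rw [mem_alive] at hu
      obtain ⟨z, hz, hzu⟩ : ∃ z, own z = z ∧ z ≠ u := by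
        by_cases e : r = u
        · exact ⟨y, hy, e ▸ hyr⟩
        · exact ⟨r, hr, e⟩
      obtain ⟨x', hx', y', -, -, oy, hn⟩ := h.cut {u} u (by simp) hu z (by simpa using hzu) hz
      rw [Finset.mem_singleton] at hx'
      subst hx'
      have := Finset.card_pos.2 ⟨y', mem_aliveNbrs.2 ⟨oy, hn⟩⟩
      have := hno x' hu
      omega
    have := Finset.card_nsmul_le_sum _ _ 2 h2
    have := h.count
    simp only [smul_eq_mul] at *
    omega
  ext x
  simpa [cluster] using hone _ (h.idem x)

end Clustering

/-- At the beginning no vertex is absorbed. -/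
theorem clustering_id (hN : N.IsDirectedTree) : Clustering N id fun _ => false := by
  classical
  obtain ⟨hloop, htree⟩ := hN
  have hadj (x y : V) : N.graph.toSimpleGraphInclusive.Adj x y ↔ N.Nbr x y := by
    rw [Digraph.toSimpleGraphInclusive, SimpleGraph.fromRel_adj]
    refine and_iff_right_of_imp ?_
    rintro h rfl
    exact hloop x (h.elim id id)
  refine ⟨fun _ => rfl, fun x y _ hx => absurd rfl hx, fun x hx => absurd rfl hx,
    fun S x hx _ y hy _ => ?_, ?_⟩
  · obtain ⟨w⟩ := htree.connected x y
    obtain ⟨d, -, h1, h2⟩ := w.exists_boundary_dart (S : Set V) hx hy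
    exact ⟨d.fst, h1, d.snd, h2, rfl, rfl, (hadj _ _).1 d.adj⟩
  · have h1 := htree.card_edgeFinset
    have h2 := N.graph.toSimpleGraphInclusive.sum_degrees_eq_twice_card_edges
    have h3 : alive (id : V → V) = Finset.univ := by ext; simp [alive]
    have h4 (u : V) : (N.aliveNbrs id u).card = N.graph.toSimpleGraphInclusive.degree u := by
      rw [← SimpleGraph.card_neighborFinset_eq_degree]
      congr 1
      ext x
      rw [mem_aliveNbrs, SimpleGraph.mem_neighborFinset, hadj]
      simp
    simp only [h3, h4, Finset.card_univ]
    omega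

end Network

end

section

open Network

variable {n : ℕ} {N : Network (Fin n)}

/-! ### Reading the arcs -/

open Classical in
/-- What the vertex `x` contributes to the entry of `u` in the arrays 6 to 11. These arrays hold,
for each remaining vertex, the number and the sum of its remaining in-neighbours, the number and the
sum of its remaining out-neighbours, and the total weights of the remaining arcs into and out of
it. -/
noncomputable def contribution (N : Network (Fin n)) (j : ℕ) (x u : Fin n) : ℕ :=
  match j with
  | 6 => if N.graph.Adj x u then 1 else 0
  | 7 => if N.graph.Adj x u then (x : ℕ) else 0
  | 8 => if N.graph.Adj u x then 1 else 0
  | 9 => if N.graph.Adj u x then (x : ℕ) else 0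
  | 10 => N.arc x u
  | 11 => N.arc u x
  | _ => 0

/-- What the arc `e` contributes to the entry of `u` in the arrays 6 to 11. -/
def arcContribution (N : Network (Fin n)) (j : ℕ) (u : Fin n) (e : Fin n × Fin n) : ℕ :=
  match j with
  | 6 => if e.2 = u then 1 else 0
  | 7 => if e.2 = u then (e.1 : ℕ) else 0
  | 8 => if e.1 = u then 1 else 0
  | 9 => if e.1 = u then (e.2 : ℕ) else 0
  | 10 => if e.2 = u then N.w e.1 e.2 else 0
  | 11 => if e.1 = u then N.w e.1 e.2 else 0
  | _ => 0

theorem IsArcList.sum_map {L : List (Fin n × Fin n)} (hL : IsArcList N L)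
    (f : Fin n × Fin n → ℕ) :
    (L.map f).sum = ∑ x, ∑ y, open Classical in if N.graph.Adj x y then f (x, y) else 0 := by
  classical
  rw [← List.sum_toFinset _ hL.1, ← Fintype.sum_prod_type', ← Finset.sum_filter]
  refine Finset.sum_congr ?_ fun _ _ => rfl
  ext ⟨x, y⟩
  simp [hL.2]

theorem IsArcList.sum_arcContribution {L : List (Fin n × Fin n)} (hL : IsArcList N L) (j : ℕ)
    (u : Fin n) : (L.map (arcContribution N j u)).sum = ∑ x, contribution N j x u := by
  classical
  rw [hL.sum_map]
  have swap (g : Fin n → Fin n → ℕ) (x : Fin n) :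
      ∑ y, (if N.graph.Adj x y then if y = u then g x y else 0 else 0) =
        if N.graph.Adj x u then g x u else 0 := by
    rw [Finset.sum_eq_single u (fun y _ hy => by simp [hy]) (by simp)]
    simp
  have swap' (g : Fin n → Fin n → ℕ) :
      ∑ x, ∑ y, (if N.graph.Adj x y then if x = u then g x y else 0 else 0) =
        ∑ y, if N.graph.Adj u y then g u y else 0 := by
    rw [Finset.sum_comm]
    refine Finset.sum_congr rfl fun y _ => ?_
    rw [Finset.sum_eq_single u (fun y _ hy => by simp [hy]) (by simp)]
    simp
  match j with
  | 6 => exact Finset.sum_congr rfl fun x _ => swap (fun _ _ => 1) x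
  | 7 => exact Finset.sum_congr rfl fun x _ => swap (fun x _ => (x : ℕ)) x
  | 10 => exact Finset.sum_congr rfl fun x _ => by
            simpa [arcContribution, contribution, arc] using swap N.w x
  | 8 => simp only [arcContribution, contribution]; exact swap' fun _ _ => 1
  | 9 => simp only [arcContribution, contribution]; exact swap' fun _ y => y
  | 11 => simp only [arcContribution, contribution]; exact swap' N.w
  | 0 | 1 | 2 | 3 | 4 | 5 | k + 12 => simp [arcContribution, contribution]

theorem IsArcList.sum_weights {L : List (Fin n × Fin n)} (hL : IsArcList N L) :
    (L.map fun e => N.w e.1 e.2).sum = ∑ x, ∑ y, N.arc x y := by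
  rw [hL.sum_map]
  rfl

/-- Increase the entry `i` of the array `a` by `e`. -/
def increase (a : ℕ) (i e : Expr) : Cmd := .store a i (.add (.read a i) e)

/-- Accumulate the contributions of all arcs. Register 7 is the sum of the weights. -/
def readArcs : Cmd :=
  .assign 8 (.const 0) ;;
  .whileLT (.reg 8) (.reg 1)
    (.assign 9 (.read 0 (.reg 8)) ;; .assign 10 (.read 1 (.reg 8)) ;;
      .assign 11 (.read 2 (.reg 8)) ;;
      increase 6 (.reg 10) (.const 1) ;; increase 7 (.reg 10) (.reg 9) ;;
      increase 8 (.reg 9) (.const 1) ;; increase 9 (.reg 9) (.reg 10) ;;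
      increase 10 (.reg 10) (.reg 11) ;; increase 11 (.reg 9) (.reg 11) ;;
      .assign 7 (.add (.reg 7) (.reg 11)) ;; .assign 8 (.add (.reg 8) (.const 1)))

theorem readArcs_ok {L : List (Fin n × Fin n)} {s : State} (hL : IsArcList N L)
    (h1 : s.reg 1 = L.length) (h7 : s.reg 7 = 0)
    (ha0 : ∀ i (h : i < L.length), s.arr 0 i = ((L[i]).1 : ℕ))
    (ha1 : ∀ i (h : i < L.length), s.arr 1 i = ((L[i]).2 : ℕ))
    (ha2 : ∀ i (h : i < L.length), s.arr 2 i = N.w (L[i]).1 (L[i]).2)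
    (hz : ∀ j, 6 ≤ j → j < 12 → ∀ i, s.arr j i = 0) :
    Ok readArcs s ((L.length + 2) * 100) fun s' =>
      (∀ x < 7, s'.reg x = s.reg x) ∧ s'.reg rTop = s.reg rTop ∧
      (∀ a, a < 6 ∨ 12 ≤ a → s'.arr a = s.arr a) ∧
      s'.reg 7 = ∑ x, ∑ y, N.arc x y ∧
      ∀ j, 6 ≤ j → j < 12 → ∀ u : Fin n, s'.arr j u = ∑ x, contribution N j x u := by
  unfold readArcs
  refine (Ok.assign_seq (Ok.weaken (Ok.forLT L.length 80
    (fun i s' => (∀ x < 7, s'.reg x = s.reg x) ∧ s'.reg rTop = s.reg rTop ∧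
      (∀ a, a < 6 ∨ 12 ≤ a → s'.arr a = s.arr a) ∧ s'.reg 8 = i ∧
      s'.reg 7 = ((L.take i).map fun e => N.w e.1 e.2).sum ∧
      ∀ j, 6 ≤ j → j < 12 → ∀ u : Fin n,
        s'.arr j u = ((L.take i).map (arcContribution N j u)).sum)
    ?_ ?_ ?_) le_rfl ?_)).le ?_
  · refine ⟨fun x hx => ?_, by simp, by simp, by simp, by simp [h7], fun j h1 h2 u => ?_⟩
    · simp; omega
    · simp [hz j h1 h2]
  · rintro i s' ⟨g1, -, -, g4, -⟩
    simp only [Expr.eval, g4, g1 1 (by simp), h1]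
  · rintro i s1 hi ⟨g1, g2, g3, g4, g5, g6⟩
    have e0 : s1.arr 0 i = ((L[i]).1 : ℕ) := by rw [g3 0 (by simp), ha0 i hi]
    have e1 : s1.arr 1 i = ((L[i]).2 : ℕ) := by rw [g3 1 (by simp), ha1 i hi]
    have e2 : s1.arr 2 i = N.w (L[i]).1 (L[i]).2 := by rw [g3 2 (by simp), ha2 i hi]
    have htake : L.take (i + 1) = L.take i ++ [L[i]] := (List.take_append_getElem hi).symm
    unfold increase
    refine (Ok.assign_seq (Ok.assign_seq (Ok.assign_seq (Ok.store_seq (Ok.store_seq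
      (Ok.store_seq (Ok.store_seq (Ok.store_seq (Ok.store_seq (Ok.assign_seq
      (Ok.assign ?_))))))))))).le (by simp)
    simp only [Expr.eval, State.setReg_reg, State.setReg_arr, State.setArr_reg, g4]
    norm_num [-List.map_take, e0, e1, e2]
    refine ⟨fun x hx => ?_, g2, fun a ha => ?_, ?_, fun j hj1 hj2 u => ?_⟩
    · rw [← g1 x hx]
      have : x ≠ 7 ∧ x ≠ 8 ∧ x ≠ 9 ∧ x ≠ 10 ∧ x ≠ 11 := by omega
      simp [this]
    · rw [← g3 a ha]
      have : a ≠ 6 ∧ a ≠ 7 ∧ a ≠ 8 ∧ a ≠ 9 ∧ a ≠ 10 ∧ a ≠ 11 := by omega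
      funext k
      simp [this]
    · rw [htake, g5, List.map_append, List.sum_append, List.map_singleton, List.sum_singleton]
    · rw [htake, List.map_append, List.sum_append, ← g6 j hj1 hj2 u]
      have c1 : (u : ℕ) = (L[i]).1 ↔ (L[i]).1 = u := by rw [Fin.val_inj, eq_comm]
      have c2 : (u : ℕ) = (L[i]).2 ↔ (L[i]).2 = u := by rw [Fin.val_inj, eq_comm]
      interval_cases j <;> simp [arcContribution, c1, c2] <;> split_ifs <;> simp_all
  · rintro s' ⟨g1, g2, g3, -, g5, g6⟩
    rw [List.take_length] at g5
    refine ⟨g1, g2, g3, by rw [g5, hL.sum_weights], fun j h1 h2 u => ?_⟩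
    rw [g6 j h1 h2, List.take_length, hL.sum_arcContribution]
  · simp only [Expr.steps]
    omega

/-- Tabulate the multiples of `β + 1` in the array 16. -/
def multiples : Cmd :=
  .assign 8 (.const 0) ;; .assign 9 (.const 0) ;;
  .whileLT (.reg 8) (.add (.reg 7) (.const 3))
    (.store 16 (.reg 8) (.reg 9) ;; .assign 9 (.add (.reg 9) (.reg rWid)) ;;
      .assign 8 (.add (.reg 8) (.const 1)))

theorem multiples_ok {s : State} {β : ℕ} (hw : s.reg rWid = β + 1) :
    Ok multiples s ((s.reg 7 + 5) * 30) fun s' =>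
      (∀ x < 7, s'.reg x = s.reg x) ∧ s'.reg rTop = s.reg rTop ∧
      (∀ a, a ≠ 16 → s'.arr a = s.arr a) ∧ ∀ i ≤ s.reg 7 + 2, s'.arr 16 i = i * (β + 1) := by
  unfold multiples
  refine (Ok.assign_seq (Ok.assign_seq (Ok.weaken (Ok.forLT (s.reg 7 + 3) 20
    (fun i s' => (∀ x < 8, s'.reg x = s.reg x) ∧ s'.reg rTop = s.reg rTop ∧
      (∀ a, a ≠ 16 → s'.arr a = s.arr a) ∧ s'.reg 8 = i ∧ s'.reg 9 = i * (β + 1) ∧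
      ∀ k < i, s'.arr 16 k = k * (β + 1)) ?_ ?_ ?_) le_rfl ?_))).le ?_
  · refine ⟨fun x hx => ?_, by simp, by simp, by simp, by simp, by simp⟩
    have : x ≠ 8 ∧ x ≠ 9 := by omega
    simp [this]
  · rintro i s' ⟨g1, -, -, g4, -⟩
    simp only [Expr.eval, g4, g1 7 (by simp)]
  · rintro i s1 hi ⟨g1, g2, g3, g4, g5, g6⟩
    refine (Ok.store_seq (Ok.assign_seq (Ok.assign ?_))).le (by simp)
    have e4 := (g1 rWid (by simp)).trans hw
    simp only [Expr.eval, State.setReg_reg, State.setArr_reg, g4, g5, e4]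
    norm_num
    refine ⟨fun x hx => ?_, g2, fun a ha => ?_, by ring, fun k hk => ?_⟩
    · rw [← g1 x hx]
      have : x ≠ 8 ∧ x ≠ 9 := by omega
      simp [this]
    · rw [← g3 a ha]
      funext k
      simp [ha]
    · split_ifs with h
      · rw [h]
      · exact g6 k (by omega)
  · rintro s' ⟨g1, g2, g3, -, -, g6⟩
    exact ⟨fun x hx => g1 x (by omega), g2, g3, fun i hi => g6 i (by omega)⟩
  · simp only [Expr.steps]
    omega

/-! ### The initial tables -/

/-- Compute an entry of the table of a vertex that has not absorbed any other vertex through an arc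
of weight 0. -/
def initLightEntry : Cmd :=
  .ifLE (.reg 25) (.const 0)
    (.ifLE (.read 4 (.reg 8)) (.reg rB)
      (.assign rVal (.const 2) ;; .assign rL (.reg 8) ;; .assign rR (.reg 0))
      .skip)
    (.assign rL (.reg 0) ;; .assign rR (.reg 0) ;;
      .ifLE (.reg rInf) (.reg 25) (.assign rVal (.const 1)) (.assign rVal (.const 2)))

theorem Best.singleton {V : Type*} (k : ℕ) (S : Finset V) : Best (k + 1) S {(k, S)} :=
  .inr ⟨k, rfl, rfl, by simp⟩

theorem initLightEntry_ok {s : State} {β Λ τ : ℕ} {v : Fin n} (hh : HeapOk n s)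
    (hc : Consts n β Λ s) (h25 : s.reg 25 = τ) (hτ : τ ≤ Λ) (hΛ : 0 < Λ) (h8 : s.reg 8 = v)
    (hcost : s.arr 4 v = N.c v) (hacc : Acc s (∅ : Set (ℕ × Finset (Fin n)))) :
    Ok initLightEntry s 30 fun s' => Step n 31 s s' ∧ s'.reg rTop = s.reg rTop ∧
      Acc s' (N.rooted Λ {v} v τ 0 (s.reg rB)) := by
  have hnt := hh.lt_top
  unfold initLightEntry
  refine (Ok.ifLE (k := 20) (fun g1 => (Ok.ifLE (k := 10) (fun g2 => ?_) fun g2 => ?_).le ?_)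
    fun g1 => (Ok.assign_seq (Ok.assign_seq (Ok.ifLE (k := 2) (fun g2 => ?_) fun g2 => ?_))).le
      ?_).le ?_
  all_goals try simp only [Expr.eval, h25] at g1
  all_goals try simp only [Expr.eval, h8, hcost, State.setReg_reg, hc.inf] at g2
  all_goals try simp only [Expr.eval, State.setReg_reg, hc.num]
  · refine (Ok.assign_seq (Ok.assign_seq (Ok.assign ⟨?_, ?_, ?_, ?_, ?_⟩))).le (by simp)
    · exact ((Step.setReg (by simp) (by simp)).trans (Step.setReg (by simp) (by simp))).trans
        (Step.setReg (by simp) (by simp))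
    · simp
    · simp [h8]; omega
    · simp [hc.num]; omega
    · rw [rooted_singleton hτ, if_pos (by omega), if_pos g2, if_pos hΛ]
      simpa [h8, hc.num, State.cell, cellSet_of_lt, cellSet_self] using Best.singleton 1 {v}
  · refine (Ok.skip ⟨.rfl', rfl, ?_⟩).le (by simp)
    rwa [rooted_singleton hτ, if_pos (by omega), if_neg (by omega)]
  · simp
  · refine Ok.assign ⟨?_, ?_, ?_, ?_, ?_⟩
    · exact ((Step.setReg (by simp) (by simp)).trans (Step.setReg (by simp) (by simp))).trans
        (Step.setReg (by simp) (by simp))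
    · simp
    · simp; omega
    · simp; omega
    · norm_num [h25] at g2
      rw [rooted_singleton hτ, if_neg (show τ ≠ 0 by omega), if_neg (show ¬ τ < Λ by omega)]
      simpa [State.cell, cellSet_self] using Best.singleton 0 (∅ : Finset (Fin n))
  · refine Ok.assign ⟨?_, ?_, ?_, ?_, ?_⟩
    · exact ((Step.setReg (by simp) (by simp)).trans (Step.setReg (by simp) (by simp))).trans
        (Step.setReg (by simp) (by simp))
    · simp
    · simp; omega
    · simp; omega
    · norm_num [h25] at g2
      rw [rooted_singleton hτ, if_neg (show τ ≠ 0 by omega), if_pos (show τ < Λ by omega)]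
      simpa [State.cell, cellSet_self] using Best.singleton 1 (∅ : Finset (Fin n))
  · simp
  · simp

/-- Compute the table of a vertex that has not absorbed any other vertex through an arc of
weight 0. -/
def initLight : Cmd :=
  .assign 25 (.const 0) ;;
  .whileLT (.reg 25) (.reg rTimes)
    (fillRow initLightEntry ;; .assign 25 (.add (.reg 25) (.const 1)))

theorem initLight_ok {s : State} {β Λ : ℕ} {v : Fin n} (hh : HeapOk n s)
    (hc : Consts n β Λ s) (hΛ : 0 < Λ) (h8 : s.reg 8 = v) (hcost : s.arr 4 v = N.c v) :
    Ok initLight s ((Λ + 3) * ((β + 3) * 70 + 10)) fun s' => Step n 25 s s' ∧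
      s'.reg rTop = s.reg rTop + (Λ + 1) * (β + 1) ∧
      Tab β Λ s' (s.reg rTop) 1 fun τ _ => N.rooted Λ {v} v τ 0 := by
  unfold initLight
  refine (Ok.assign_seq (Ok.weaken (Ok.forLT (Λ + 1) ((β + 3) * (30 + 40) + 4)
    (fun i s' => Step n 25 s s' ∧ s'.reg rTop = s.reg rTop + i * (β + 1) ∧ s'.reg 25 = i ∧
      ∀ τ < i, Row β s' (s.reg rTop + τ * (β + 1)) (N.rooted Λ {v} v τ 0))
    ?_ ?_ ?_) le_rfl ?_)).le ?_
  · exact ⟨.setReg (by simp) (by simp), by simp, by simp, by simp⟩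
  · rintro i s' ⟨h1, -, h3, -⟩
    simp only [Expr.eval, h3, h1.reg rTimes (by simp), hc.times]
  · rintro i s1 hi ⟨h1, h2, h3, h4⟩
    refine Ok.seq (fillRow_ok (F := N.rooted Λ {v} v i 0) (β := β)
      (c := 30) (h1.heap hh) ((h1.reg 0 (by simp)).trans hc.num)
      ((h1.reg rWid (by simp)).trans hc.wid) ?_) ?_
    · intro s2 h12 hb hacc
      have h02 := h1.trans (h12.mono (by simp))
      exact initLightEntry_ok (h02.heap hh) (hc.step h02 (by simp))
        ((h12.reg 25 (by simp)).trans h3) (by omega) hΛ ((h02.reg 8 (by simp)).trans h8)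
        ((h02.arr 4 (by simp) _).trans hcost) hacc
    · rintro s2 ⟨g1, g2, g3⟩
      have h25 : s2.reg 25 = i := (g1.reg 25 (by simp)).trans h3
      have hset : Step n 25 s2 (s2.setReg 25 (i + 1)) := .setReg (by simp) (by simp)
      refine Ok.assign ?_
      simp only [Expr.eval, h25]
      have g1' := g1.mono (r' := 25) (by simp)
      refine ⟨(h1.trans g1').trans hset, ?_, by simp, fun τ hτ => ?_⟩
      · simp [g2, h2]; ring
      · obtain hτ | rfl := Nat.lt_succ_iff_lt_or_eq.1 hτ
        · exact ((h4 τ hτ).step g1').step hset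
        · rw [h2] at g3
          exact g3.step hset
  · rintro s' ⟨h1, h2, -, h4⟩
    refine ⟨h1, h2, fun τ hτ σ hσ => ?_⟩
    obtain rfl : σ = 0 := by omega
    simpa using h4 τ (by omega)
  · simp only [Expr.steps]
    nlinarith

/-- Compute an entry of the table of a vertex that has not absorbed any other vertex through an arc
of positive weight. -/
def initHeavyEntry : Cmd :=
  .ifLE (.reg 26) (.const 0)
    (.assign rVal (.const 1) ;; .assign rL (.reg 0) ;; .assign rR (.reg 0))
    .skip

theorem initHeavyEntry_ok {s : State} {Λ τ σ : ℕ} {v : Fin n} (hh : HeapOk n s)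
    (hn : s.reg 0 = n) (h26 : s.reg 26 = σ) (hτ : τ ≤ Λ)
    (hacc : Acc s (∅ : Set (ℕ × Finset (Fin n)))) :
    Ok initHeavyEntry s 20 fun s' => Step n 31 s s' ∧ s'.reg rTop = s.reg rTop ∧
      Acc s' (N.rooted Λ ∅ v τ σ (s.reg rB)) := by
  have hnt := hh.lt_top
  unfold initHeavyEntry
  refine (Ok.ifLE (k := 16) (fun g1 => ?_) fun g1 => ?_).le (by simp)
  all_goals simp only [Expr.eval, h26] at g1
  · refine (Ok.assign_seq (Ok.assign_seq (Ok.assign ⟨?_, ?_, ?_, ?_, ?_⟩))).le (by simp)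
    · exact ((Step.setReg (by simp) (by simp)).trans (Step.setReg (by simp) (by simp))).trans
        (Step.setReg (by simp) (by simp))
    · simp
    · simp [hn]; omega
    · simp [hn]; omega
    · rw [rooted_empty hτ, if_pos (by omega)]
      simpa [State.cell, cellSet_self, hn] using Best.singleton 0 (∅ : Finset (Fin n))
  · refine (Ok.skip ⟨.rfl', rfl, ?_⟩).le (by simp)
    rwa [rooted_empty hτ, if_neg (by omega)]

/-- Compute the table, with a number of rows given by register 10, of a vertex that has not absorbed
any other vertex through an arc of positive weight. -/
def initHeavy : Cmd :=
  .assign 25 (.const 0) ;;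
  .whileLT (.reg 25) (.reg rTimes)
    (.assign 26 (.const 0) ;;
      .whileLT (.reg 26) (.reg 10)
        (fillRow initHeavyEntry ;; .assign 26 (.add (.reg 26) (.const 1))) ;;
      .assign 25 (.add (.reg 25) (.const 1)))

theorem initHeavy_ok {s : State} {β Λ R : ℕ} {v : Fin n} (hh : HeapOk n s)
    (hc : Consts n β Λ s) (h10 : s.reg 10 = R) :
    Ok initHeavy s ((Λ + 3) * ((R + 2) * ((β + 3) * 60 + 10) + 10)) fun s' => Step n 25 s s' ∧
      s'.reg rTop = s.reg rTop + (Λ + 1) * (R * (β + 1)) ∧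
      Tab β Λ s' (s.reg rTop) R fun τ σ => N.rooted Λ ∅ v τ σ := by
  unfold initHeavy
  set d := (R + 2) * ((β + 3) * 60 + 10) with hd
  refine (Ok.assign_seq (Ok.weaken (Ok.forLT (Λ + 1) (d + 4)
    (fun i s' => Step n 25 s s' ∧ s'.reg rTop = s.reg rTop + i * (R * (β + 1)) ∧ s'.reg 25 = i ∧
      ∀ τ < i, ∀ σ < R, Row β s' (s.reg rTop + (τ * R + σ) * (β + 1)) (N.rooted Λ ∅ v τ σ))
    ?_ ?_ ?_) le_rfl ?_)).le ?_
  · exact ⟨.setReg (by simp) (by simp), by simp, by simp, by simp⟩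
  · rintro i s' ⟨h1, -, h3, -⟩
    simp only [Expr.eval, h3, h1.reg rTimes (by simp), hc.times]
  · rintro i s1 hi ⟨h1, h2, h3, h4⟩
    refine Ok.seq_seq (k := d) (R := fun s' => Step n 26 s1 s' ∧
      s'.reg rTop = s1.reg rTop + R * (β + 1) ∧
      ∀ σ < R, Row β s' (s1.reg rTop + σ * (β + 1)) (N.rooted Λ ∅ v i σ)) ?_ ?_
    · refine (Ok.assign_seq (Ok.weaken (Ok.forLT R ((β + 3) * (20 + 40) + 4)
        (fun k s' => Step n 26 s1 s' ∧ s'.reg rTop = s1.reg rTop + k * (β + 1) ∧ s'.reg 26 = k ∧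
          ∀ σ < k, Row β s' (s1.reg rTop + σ * (β + 1)) (N.rooted Λ ∅ v i σ))
        ?_ ?_ ?_) le_rfl ?_)).le ?_
      · exact ⟨.setReg (by simp) (by simp), by simp, by simp, by simp⟩
      · rintro k s' ⟨g1, -, g3, -⟩
        simp only [Expr.eval, g3, g1.reg 10 (by simp), h1.reg 10 (by simp), h10]
      · rintro k s2 hk ⟨g1, g2, g3, g4⟩
        have h02 := h1.trans (g1.mono (by simp))
        refine Ok.seq (fillRow_ok (F := N.rooted Λ ∅ v i k) (β := β)
          (c := 20) (h02.heap hh) ((h02.reg 0 (by simp)).trans hc.num)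
          ((h02.reg rWid (by simp)).trans hc.wid) ?_) ?_
        · intro s3 h23 hb hacc
          have h03 := h02.trans (h23.mono (by simp))
          exact initHeavyEntry_ok (h03.heap hh) ((h03.reg 0 (by simp)).trans hc.num)
            ((h23.reg 26 (by simp)).trans g3) (by omega) hacc
        · rintro s3 ⟨k1, k2, k3⟩
          have h26 : s3.reg 26 = k := (k1.reg 26 (by simp)).trans g3
          have hset : Step n 26 s3 (s3.setReg 26 (k + 1)) := .setReg (by simp) (by simp)
          refine Ok.assign ?_
          simp only [Expr.eval, h26]
          have k1' := k1.mono (r' := 26) (by simp)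
          refine ⟨(g1.trans k1').trans hset, ?_, by simp, fun σ hσ => ?_⟩
          · simp [k2, g2]; ring
          · obtain hσ | rfl := Nat.lt_succ_iff_lt_or_eq.1 hσ
            · exact ((g4 σ hσ).step k1').step hset
            · rw [g2] at k3
              exact k3.step hset
      · rintro s' ⟨g1, g2, -, g4⟩
        exact ⟨g1, g2, g4⟩
      · simp only [Expr.steps]
        nlinarith
    · rintro s2 ⟨g1, g2, g3⟩
      have h25 : s2.reg 25 = i := (g1.reg 25 (by simp)).trans h3
      have hset : Step n 25 s2 (s2.setReg 25 (i + 1)) := .setReg (by simp) (by simp)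
      refine Ok.assign ?_
      simp only [Expr.eval, h25]
      have g1' := g1.mono (r' := 25) (by simp)
      refine ⟨(h1.trans g1').trans hset, ?_, by simp, fun τ hτ σ hσ => ?_⟩
      · simp [g2, h2]; ring
      · obtain hτ | rfl := Nat.lt_succ_iff_lt_or_eq.1 hτ
        · exact ((h4 τ hτ σ hσ).step g1').step hset
        · have := (g3 σ hσ).step hset
          rw [h2] at this
          have e : s.reg rTop + τ * (R * (β + 1)) + σ * (β + 1) =
            s.reg rTop + (τ * R + σ) * (β + 1) := by ring
          rwa [e] at this
  · rintro s' ⟨h1, h2, -, h4⟩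
    exact ⟨h1, h2, fun τ hτ σ hσ => h4 τ (by omega) σ hσ⟩
  · simp only [Expr.steps]
    nlinarith

end

section

open Network

variable {n : ℕ} {N : Network (Fin n)}

/-! ### Recognising and detaching leaves -/

theorem contribution_eq_zero {x u : Fin n} (h : ¬ N.Nbr u x) (j : ℕ) :
    contribution N j x u = 0 := by
  unfold Nbr at h
  push Not at h
  unfold contribution
  split <;> simp [h, arc]

theorem sum_contribution_leaf {own : Fin n → Fin n} {v p : Fin n}
    (hleaf : N.aliveNbrs own v = {p}) (j : ℕ) :
    ∑ x ∈ alive own, contribution N j x v = contribution N j p v := by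
  have hp : own p = p ∧ N.Nbr v p := mem_aliveNbrs.1 (by simp [hleaf])
  refine Finset.sum_eq_single_of_mem p (mem_alive.2 hp.1) fun x hx hxp => ?_
  refine contribution_eq_zero (fun hn => hxp ?_) j
  have : x ∈ N.aliveNbrs own v := mem_aliveNbrs.2 ⟨mem_alive.1 hx, hn⟩
  simpa [hleaf] using this

/-- A leaf is recognised from the numbers and the sums of its in- and out-neighbours. -/
theorem card_aliveNbrs_eq_one_iff (own : Fin n → Fin n) (v : Fin n) {A : ℕ → ℕ}
    (hA : ∀ j, 6 ≤ j → j < 12 → A j = ∑ x ∈ alive own, contribution N j x v) :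
    (N.aliveNbrs own v).card = 1 ↔
      A 6 ≤ 1 ∧ A 8 ≤ 1 ∧ 1 ≤ A 6 + A 8 ∧ (A 6 + A 8 ≤ 1 ∨ A 7 = A 9) := by
  classical
  rw [hA 6 (by simp) (by simp), hA 7 (by simp) (by simp), hA 8 (by simp) (by simp),
    hA 9 (by simp) (by simp)]
  constructor
  · intro h
    obtain ⟨p, hp⟩ := Finset.card_eq_one.1 h
    have hn : N.Nbr v p := (mem_aliveNbrs.1 (by simp [hp] : p ∈ N.aliveNbrs own v)).2
    rw [sum_contribution_leaf hp, sum_contribution_leaf hp, sum_contribution_leaf hp,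
      sum_contribution_leaf hp]
    simp only [contribution]
    unfold Nbr at hn
    split_ifs <;> simp_all
  · set I := (alive own).filter fun x => N.graph.Adj x v with hI
    set O := (alive own).filter fun x => N.graph.Adj v x with hO
    have e : N.aliveNbrs own v = I ∪ O := by
      ext x
      simp only [mem_aliveNbrs, hI, hO, Finset.mem_union, Finset.mem_filter, mem_alive, Nbr]
      tauto
    have e6 : ∑ x ∈ alive own, contribution N 6 x v = I.card := by
      simp [contribution, hI]
    have e8 : ∑ x ∈ alive own, contribution N 8 x v = O.card := by
      simp [contribution, hO]
    have e7 : ∑ x ∈ alive own, contribution N 7 x v = ∑ x ∈ I, (x : ℕ) := by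
      simp [contribution, hI, Finset.sum_filter]
    have e9 : ∑ x ∈ alive own, contribution N 9 x v = ∑ x ∈ O, (x : ℕ) := by
      simp [contribution, hO, Finset.sum_filter]
    rw [e, e6, e7, e8, e9]
    rintro ⟨h6, h8, h1, h⟩
    obtain h6 | h6 : I.card = 0 ∨ I.card = 1 := by omega
    · rw [Finset.card_eq_zero.1 h6, Finset.empty_union]
      omega
    · obtain h8 | h8 : O.card = 0 ∨ O.card = 1 := by omega
      · rw [Finset.card_eq_zero.1 h8, Finset.union_empty]
        omega
      · obtain ⟨x, hx⟩ := Finset.card_eq_one.1 h6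
        obtain ⟨y, hy⟩ := Finset.card_eq_one.1 h8
        have h' := h.resolve_left (by omega)
        rw [hx, hy, Finset.sum_singleton, Finset.sum_singleton, Fin.val_inj] at h'
        rw [hx, hy, h', Finset.union_self, Finset.card_singleton]

/-- Set register 12 to 1 if the vertex in register 9 is a leaf of the remaining graph, and to 0
otherwise. -/
def leafTest : Cmd :=
  .assign 12 (.const 0) ;;
  .ifLE (.read 6 (.reg 9)) (.const 1)
    (.ifLE (.read 8 (.reg 9)) (.const 1)
      (.ifLE (.const 1) (.add (.read 6 (.reg 9)) (.read 8 (.reg 9)))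
        (.ifLE (.add (.read 6 (.reg 9)) (.read 8 (.reg 9))) (.const 1)
          (.assign 12 (.const 1))
          (.ifLE (.read 7 (.reg 9)) (.read 9 (.reg 9))
            (.ifLE (.read 9 (.reg 9)) (.read 7 (.reg 9)) (.assign 12 (.const 1)) .skip)
            .skip))
        .skip)
      .skip)
    .skip

theorem leafTest_ok (s : State) :
    Ok leafTest s 60 fun s' => ∃ k, s' = s.setReg 12 k ∧ (1 ≤ k ↔
      s.arr 6 (s.reg 9) ≤ 1 ∧ s.arr 8 (s.reg 9) ≤ 1 ∧ 1 ≤ s.arr 6 (s.reg 9) + s.arr 8 (s.reg 9) ∧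
      (s.arr 6 (s.reg 9) + s.arr 8 (s.reg 9) ≤ 1 ∨ s.arr 7 (s.reg 9) = s.arr 9 (s.reg 9))) := by
  have hset : (s.setReg 12 0).setReg 12 1 = s.setReg 12 1 := by
    simp [State.setReg]
  unfold leafTest
  refine (Ok.assign_seq (Ok.ifLE (k := 45) (fun h1 => (Ok.ifLE (k := 38) (fun h2 =>
    (Ok.ifLE (k := 30) (fun h3 => (Ok.ifLE (k := 20) (fun h4 => ?_) fun h4 =>
    (Ok.ifLE (k := 10) (fun h5 => (Ok.ifLE (k := 2) (fun h6 => ?_) fun h6 => ?_).le ?_)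
      fun h5 => ?_).le ?_).le ?_) fun h3 => ?_).le ?_) fun h2 => ?_).le ?_) fun h1 => ?_)).le ?_
  all_goals try simp only [Expr.eval, State.setReg_reg, State.setReg_arr] at h1
  all_goals try simp only [Expr.eval, State.setReg_reg, State.setReg_arr] at h2
  all_goals try simp only [Expr.eval, State.setReg_reg, State.setReg_arr] at h3
  all_goals try simp only [Expr.eval, State.setReg_reg, State.setReg_arr] at h4
  all_goals try simp only [Expr.eval, State.setReg_reg, State.setReg_arr] at h5
  all_goals try simp only [Expr.eval, State.setReg_reg, State.setReg_arr] at h6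
  all_goals norm_num at *
  · refine (Ok.assign ⟨1, hset, ?_⟩).le (by simp)
    omega
  · refine (Ok.assign ⟨1, hset, ?_⟩).le (by simp)
    omega
  all_goals
    refine (Ok.skip ⟨0, rfl, ?_⟩).le (by simp)
    omega

/-- Update the information on the vertex in register 11 after the removal of the leaf in register 9,
which is its neighbour. -/
def detach : Cmd :=
  .ifLE (.const 1) (.read 8 (.reg 9))
    (.store 7 (.reg 11) (.sub (.read 7 (.reg 11)) (.reg 9))) .skip ;;
  .ifLE (.const 1) (.read 6 (.reg 9))
    (.store 9 (.reg 11) (.sub (.read 9 (.reg 11)) (.reg 9))) .skip ;;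
  .store 6 (.reg 11) (.sub (.read 6 (.reg 11)) (.read 8 (.reg 9))) ;;
  .store 8 (.reg 11) (.sub (.read 8 (.reg 11)) (.read 6 (.reg 9))) ;;
  .store 10 (.reg 11) (.sub (.read 10 (.reg 11)) (.read 11 (.reg 9))) ;;
  .store 11 (.reg 11) (.sub (.read 11 (.reg 11)) (.read 10 (.reg 9))) ;;
  .store 6 (.reg 9) (.const 0) ;; .store 8 (.reg 9) (.const 0)

theorem State.setArr_self (s : State) (a i : ℕ) : s.setArr a i (s.arr a i) = s := by
  simp [State.setArr]

theorem detach_ok {s : State} {v p : Fin n} (hne : p ≠ v) (h9 : s.reg 9 = v) (h11 : s.reg 11 = p)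
    (hv : ∀ j, 6 ≤ j → j < 12 → s.arr j v = contribution N j p v) :
    Ok detach s 100 fun s' => s'.reg = s.reg ∧ (∀ a, a < 6 ∨ 12 ≤ a → s'.arr a = s.arr a) ∧
      (∀ j, 6 ≤ j → j < 12 → ∀ u : Fin n, u ≠ v → u ≠ p → s'.arr j u = s.arr j u) ∧
      (∀ j, 6 ≤ j → j < 12 → s'.arr j p = s.arr j p - contribution N j v p) ∧
      s'.arr 6 v = 0 ∧ s'.arr 8 v = 0 := by
  classical
  have hpv : (p : ℕ) ≠ v := by rwa [Ne, Fin.val_inj]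
  unfold detach
  refine Ok.le (k := 12 + (12 + 70)) (Ok.seq (R := fun s' => s' = s.setArr 7 p (s.arr 7 p -
    contribution N 7 v p)) ?_ ?_) (by simp)
  · refine (Ok.ifLE (k := 7) (fun g => ?_) fun g => ?_).le (by simp)
    all_goals
      simp only [Expr.eval, h9, hv 8 (by simp) (by simp), contribution] at g
    · refine (Ok.store ?_).le (by simp)
      simp only [Expr.eval, h9, h11, contribution]
      split_ifs at g ⊢ with hg
      · rfl
      · omega
    · refine (Ok.skip ?_).le (by simp)
      split_ifs at g with hg
      · omega
      · simp [contribution, hg, State.setArr_self]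
  rintro s1 hs1
  refine Ok.seq (R := fun s' => s' = s1.setArr 9 p (s1.arr 9 p - contribution N 9 v p)) ?_ ?_
  · refine (Ok.ifLE (k := 7) (fun g => ?_) fun g => ?_).le (by simp)
    all_goals
      simp only [Expr.eval, hs1, State.setArr_reg, h9, State.setArr_arr] at g
      norm_num at g
      simp only [hv 6 (by simp) (by simp), contribution] at g
    · refine (Ok.store ?_).le (by simp)
      rw [show contribution N 9 v p = v by simp only [contribution]; split_ifs at g ⊢ <;> omega]
      simp only [Expr.eval, hs1, State.setArr_reg, h9, h11]
    · refine (Ok.skip ?_).le (by simp)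
      split_ifs at g with hg
      simp [contribution, hg, State.setArr_self]
  rintro s2 hs2
  refine (Ok.store_seq (Ok.store_seq (Ok.store_seq (Ok.store_seq (Ok.store_seq
    (Ok.store ?_)))))).le (by simp)
  have hc : contribution N 6 v p = contribution N 8 p v ∧
      contribution N 8 v p = contribution N 6 p v ∧
      contribution N 10 v p = contribution N 11 p v ∧
      contribution N 11 v p = contribution N 10 p v := by simp [contribution]
  simp only [Expr.eval, hs1, hs2, State.setArr_reg, h9, h11]
  refine ⟨trivial, fun a ha => ?_, fun j h1 h2 u hu1 hu2 => ?_, fun j h1 h2 => ?_, ?_, ?_⟩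
  · funext i
    have : a ≠ 6 ∧ a ≠ 7 ∧ a ≠ 8 ∧ a ≠ 9 ∧ a ≠ 10 ∧ a ≠ 11 := by omega
    simp [this]
  · have e1 : (u : ℕ) ≠ v := by rwa [Ne, Fin.val_inj]
    have e2 : (u : ℕ) ≠ p := by rwa [Ne, Fin.val_inj]
    simp [e1, e2]
  · interval_cases j <;> simp [hpv, hpv.symm, hv, hc]
  · simp [hpv.symm]
  · simp

end

section

open Network

variable {n : ℕ} {N : Network (Fin n)}

/-! ### The tables of a vertex -/

/-- The total weight of the arcs into `v`. -/
noncomputable def Network.inWeight (N : Network (Fin n)) (v : Fin n) : ℕ := ∑ x, N.arc x v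

/-- The total weight of all arcs. -/
noncomputable def Network.weight (N : Network (Fin n)) : ℕ := ∑ v, N.inWeight v

/-- The threshold of `v`, where a threshold that cannot be reached is replaced by the smallest such
number. -/
noncomputable def Network.cap (N : Network (Fin n)) (v : Fin n) : ℕ :=
  min (N.t v) (N.inWeight v + 1)

theorem Network.inWeight_le (v : Fin n) : N.inWeight v ≤ N.weight :=
  Finset.single_le_sum (f := N.inWeight) (fun _ _ => Nat.zero_le _) (Finset.mem_univ v)

theorem Network.cap_le (v : Fin n) : N.cap v ≤ N.weight + 1 :=
  (min_le_right _ _).trans (Nat.succ_le_succ (N.inWeight_le v))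

/-- The part of the memory that does not change between the initialisation and the output, and the
heap, which only grows. -/
structure Globals (N : Network (Fin n)) (β Λ : ℕ) (s : State) : Prop where
  consts : Consts n β Λ s
  heap : HeapOk n s
  mark : ∀ i, s.arr 5 i = 0
  mul : ∀ i ≤ N.weight + 2, s.arr 16 i = i * (β + 1)

theorem Globals.congr {β Λ : ℕ} {s s' : State} (h : Globals N β Λ s)
    (hr : ∀ x < 7, s'.reg x = s.reg x) (hg : Grow n s s') (h5 : ∀ i, s'.arr 5 i = s.arr 5 i)
    (h16 : ∀ i, s'.arr 16 i = s.arr 16 i) : Globals N β Λ s' where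
  consts := ⟨(hr _ (by simp)).trans h.consts.num, (hr _ (by simp)).trans h.consts.wid,
    (hr _ (by simp)).trans h.consts.inf, (hr _ (by simp)).trans h.consts.times⟩
  heap := hg.heap h.heap
  mark i := (h5 i).trans (h.mark i)
  mul i hi := (h16 i).trans (h.mul i hi)

theorem Globals.step {β Λ r : ℕ} {s s' : State} (h : Globals N β Λ s) (hs : Step n r s s')
    (hr : 7 ≤ r) : Globals N β Λ s' :=
  h.congr (fun x hx => hs.reg x (by omega)) hs.grow (hs.arr 5 (by simp)) (hs.arr 16 (by simp))

/-- The information on a vertex `u` that has absorbed the vertices of `Rl` and `Rh` other than `u`,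
those of `Rh` through arcs of positive weight. -/
structure Tables (N : Network (Fin n)) (β Λ : ℕ) (Rl Rh : Finset (Fin n)) (s : State)
    (u : Fin n) : Prop where
  cap : s.arr 12 u = N.cap u * (β + 1)
  rows : s.arr 15 u = (N.cap u + 1) * (β + 1)
  light : Tab β Λ s (s.arr 13 u) 1 fun τ _ => N.rooted Λ Rl u τ 0
  heavy : Tab β Λ s (s.arr 14 u) (N.cap u + 1) fun τ σ => N.rooted Λ Rh u τ σ

theorem Tables.congr {β Λ : ℕ} {Rl Rh : Finset (Fin n)} {s s' : State} {u : Fin n}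
    (h : Tables N β Λ Rl Rh s u) (hg : Grow n s s')
    (ha : ∀ a, 12 ≤ a → a ≤ 15 → s'.arr a u = s.arr a u) : Tables N β Λ Rl Rh s' u where
  cap := (ha 12 (by simp) (by simp)).trans h.cap
  rows := (ha 15 (by simp) (by simp)).trans h.rows
  light := by rw [ha 13 (by simp) (by simp)]; exact h.light.grow hg
  heavy := by rw [ha 14 (by simp) (by simp)]; exact h.heavy.grow hg

/-- Create the tables of the vertex in register 8. -/
def initVertex : Cmd :=
  .ifLE (.read 3 (.reg 8)) (.add (.read 10 (.reg 8)) (.const 1))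
    (.assign 9 (.read 3 (.reg 8)))
    (.assign 9 (.add (.read 10 (.reg 8)) (.const 1))) ;;
  .store 12 (.reg 8) (.read 16 (.reg 9)) ;;
  .store 15 (.reg 8) (.read 16 (.add (.reg 9) (.const 1))) ;;
  .store 13 (.reg 8) (.reg rTop) ;; initLight ;;
  .store 14 (.reg 8) (.reg rTop) ;; .assign 10 (.add (.reg 9) (.const 1)) ;; initHeavy

theorem initVertex_ok {s : State} {β Λ : ℕ} {v : Fin n} (hg : Globals N β Λ s) (hΛ : 0 < Λ)
    (h8 : s.reg 8 = v) (ht : s.arr 3 v = N.t v) (hc : s.arr 4 v = N.c v)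
    (hw : s.arr 10 v = N.inWeight v) :
    Ok initVertex s (50 + (Λ + 3) * ((β + 3) * 70 + 10) +
      (Λ + 3) * ((N.cap v + 3) * ((β + 3) * 60 + 10) + 10)) fun s' =>
      Grow n s s' ∧ (∀ x < 9, s'.reg x = s.reg x) ∧
      (∀ a < 20, ∀ i : ℕ, a < 12 ∨ 15 < a ∨ i ≠ (v : ℕ) → s'.arr a i = s.arr a i) ∧
      s'.reg rTop = s.reg rTop + (Λ + 1) * (β + 1) * (N.cap v + 2) ∧
      Tables N β Λ {v} ∅ s' v := by
  unfold initVertex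
  have hcapdef : N.cap v = min (N.t v) (N.inWeight v + 1) := rfl
  have hcap := N.cap_le v
  refine Ok.le (k := 13 + (4 + (6 + (3 + ((Λ + 3) * ((β + 3) * 70 + 10) + (3 + (4 +
    (Λ + 3) * ((N.cap v + 3) * ((β + 3) * 60 + 10) + 10)))))))) (Ok.seq
    (R := fun s' => s' = s.setReg 9 (N.cap v)) ?_ ?_) (by omega)
  · refine (Ok.ifLE (k := 5) (fun g => ?_) fun g => ?_).le (by simp)
    all_goals simp only [Expr.eval, h8, ht, hw] at g
    · refine (Ok.assign ?_).le (by simp)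
      simp only [Expr.eval, h8, ht]
      congr 1
      omega
    · refine (Ok.assign ?_).le (by simp)
      simp only [Expr.eval, h8, hw]
      congr 1
      omega
  rintro s1 hs1
  set s2 := ((s1.setArr 12 v (N.cap v * (β + 1))).setArr 15 v ((N.cap v + 1) * (β + 1))).setArr 13 v
    (s.reg rTop) with hs2
  refine Ok.store_seq (Ok.store_seq (Ok.store_seq ?_))
  have e : (((s1.setArr 12 ((Expr.reg 8).eval s1) ((Expr.read 16 (.reg 9)).eval s1)).setArr 15
      ((Expr.reg 8).eval (s1.setArr 12 ((Expr.reg 8).eval s1) ((Expr.read 16 (.reg 9)).eval s1)))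
      ((Expr.read 16 (.add (.reg 9) (.const 1))).eval (s1.setArr 12 ((Expr.reg 8).eval s1)
        ((Expr.read 16 (.reg 9)).eval s1))))) =
      (s1.setArr 12 v (N.cap v * (β + 1))).setArr 15 v ((N.cap v + 1) * (β + 1)) := by
    simp [hs1, h8, hg.mul (N.cap v) (by omega), hg.mul (N.cap v + 1) (by omega)]
  rw [e]
  have e' : ((s1.setArr 12 v (N.cap v * (β + 1))).setArr 15 v ((N.cap v + 1) * (β + 1))).setArr 13
      ((Expr.reg 8).eval ((s1.setArr 12 v (N.cap v * (β + 1))).setArr 15 v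
        ((N.cap v + 1) * (β + 1))))
      ((Expr.reg rTop).eval ((s1.setArr 12 v (N.cap v * (β + 1))).setArr 15 v
        ((N.cap v + 1) * (β + 1)))) = s2 := by
    simp [hs2, hs1, h8]
  rw [e']
  have hgrow2 : Grow n s s2 := by
    refine .of_eq (by simp [hs2, hs1]) fun a ha => ?_
    have : a ≠ 12 ∧ a ≠ 13 ∧ a ≠ 15 := by omega
    funext i
    simp [hs2, hs1, this]
  have hreg2 : ∀ x < 9, s2.reg x = s.reg x := fun x hx => by simp [hs2, hs1]; omega
  have harr2 : ∀ a, (a ≠ 12 ∧ a ≠ 13 ∧ a ≠ 15) → ∀ i, s2.arr a i = s.arr a i := fun a ha i => by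
    simp [hs2, hs1, ha]
  have hg2 : Globals N β Λ s2 := hg.congr (fun x hx => hreg2 x (by omega)) hgrow2
    (harr2 5 (by simp)) (harr2 16 (by simp))
  have htop2 : s2.reg rTop = s.reg rTop := by simp [hs2, hs1]
  refine Ok.seq (initLight_ok (N := N) (v := v) hg2.heap hg2.consts hΛ
    ((hreg2 8 (by simp)).trans h8) ((harr2 4 (by simp) _).trans hc)) ?_
  rintro s3 ⟨k1, k2, k3⟩
  refine Ok.store_seq (Ok.assign_seq ?_)
  set s4 := (s3.setArr 14 v (s3.reg rTop)).setReg 10 (N.cap v + 1) with hs4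
  have e4 : (s3.setArr 14 ((Expr.reg 8).eval s3) ((Expr.reg rTop).eval s3)).setReg 10
      (((Expr.reg 9).add (.const 1)).eval
        (s3.setArr 14 ((Expr.reg 8).eval s3) ((Expr.reg rTop).eval s3))) = s4 := by
    simp [hs4, k1.reg 8 (by simp), k1.reg 9 (by simp), hs2, hs1, h8]
  rw [e4]
  have hgrow4 : Grow n s3 s4 := by
    refine .of_eq (by simp [hs4]) fun a ha => ?_
    have : a ≠ 14 := by omega
    funext i
    simp [hs4, this]
  have hg3 := hg2.step k1 (by simp)
  have hg4 : Globals N β Λ s4 := hg3.congr (fun x hx => by simp [hs4]; omega) hgrow4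
    (by simp [hs4]) (by simp [hs4])
  refine (initHeavy_ok (N := N) (v := v) (R := N.cap v + 1) hg4.heap hg4.consts
    (by simp [hs4])).weaken (le_of_eq (by ring)) ?_
  rintro s5 ⟨l1, l2, l3⟩
  have htop4 : s4.reg rTop = s3.reg rTop := by simp [hs4]
  refine ⟨hgrow2.trans (k1.grow.trans (hgrow4.trans l1.grow)), fun x hx => ?_, fun a ha i hi => ?_,
    ?_, ?_, ?_, ?_, ?_⟩
  · rw [l1.reg x (by omega), ← hreg2 x hx, ← k1.reg x (by omega)]
    simp [hs4]; omega
  · rw [l1.arr a ha]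
    have : ¬ (a = 14 ∧ i = (v : ℕ)) := by omega
    simp only [hs4, State.setReg_arr, State.setArr_arr, this, if_false]
    rw [k1.arr a ha]
    have h1 : ¬ (a = 12 ∧ i = (v : ℕ)) := by omega
    have h2 : ¬ (a = 13 ∧ i = (v : ℕ)) := by omega
    have h3 : ¬ (a = 15 ∧ i = (v : ℕ)) := by omega
    simp [hs2, hs1, h1, h2, h3]
  · rw [l2, htop4, k2, htop2]; ring
  · rw [l1.arr 12 (by simp)]
    simp [hs4, k1.arr 12 (by simp), hs2]
  · rw [l1.arr 15 (by simp)]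
    simp [hs4, k1.arr 15 (by simp), hs2]
  · have e : s5.arr 13 v = s2.reg rTop := by
      rw [l1.arr 13 (by simp)]
      simp [hs4, k1.arr 13 (by simp), hs2, hs1]
    rw [e]
    exact (k3.grow hgrow4).step l1
  · have e : s5.arr 14 v = s4.reg rTop := by
      rw [l1.arr 14 (by simp)]
      simp [hs4]
    rw [e]
    exact l3

/-- Compute the tables that describe the vertex in register 9 from the point of view of its parent,
for the case that the vertex helps its parent (address in register 13) and for the general case
(address in register 14). -/
def childTables : Cmd :=
  .assign 20 (.read 13 (.reg 9)) ;; .assign 21 (.read 14 (.reg 9)) ;;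
  .assign 22 (.read 15 (.reg 9)) ;; .assign 23 (.read 12 (.reg 9)) ;;
  .assign 24 (.read 16 (.read 10 (.reg 9))) ;;
  .assign 13 (.reg rTop) ;; combine 25 ;; .assign 14 (.reg rTop) ;; combine rTimes

/-- A bound for the steps of `combine`. -/
def combineCost (β Λ : ℕ) : ℕ :=
  (Λ + 3) * ((β + 3) * ((Λ + 3) * (80 * (β + 2) + 60) + 40) + 10)

theorem childTables_ok {s : State} {β Λ w : ℕ} {Rl Rh : Finset (Fin n)} {v : Fin n}
    (hg : Globals N β Λ s) (ht : Tables N β Λ Rl Rh s v) (h9 : s.reg 9 = v)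
    (h10 : s.arr 10 v = w) (hd : Disjoint Rl Rh) (hv : v ∈ Rl) (hl : N.Hangs v Rl)
    (hh : N.Hangs v Rh) (h0 : ∀ x ∈ Rl, x ≠ v → N.arc x v = 0)
    (hw : ∑ x ∈ Rh, N.arc x v + w ≤ N.inWeight v) :
    Ok childTables s (2 * combineCost β Λ + 50) fun s' =>
      Step n 13 s s' ∧ s'.reg rTop = s.reg rTop + 2 * ((Λ + 1) * (β + 1)) ∧
      Tab β Λ s' (s'.reg 13) 1 (fun τp _ =>
        N.supported Λ (Rl ∪ Rh) v τp fun τ => if τp < τ then w else 0) ∧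
      Tab β Λ s' (s'.reg 14) 1 (fun τp _ =>
        N.supported Λ (Rl ∪ Rh) v (Λ + 1) fun τ => if τp < τ then w else 0) ∧
      s'.reg 14 + (Λ + 1) * (β + 1) = s'.reg rTop := by
  have hwW : w ≤ N.weight + 2 := by have := N.inWeight_le v; omega
  have hfam (ℓ τp : ℕ) (hℓ : ℓ ≤ Λ + 1) : (fun b => {q | ∃ τ < ℓ, q ∈ conv (N.rooted Λ Rl v τ 0)
      (N.rooted Λ Rh v τ (demand Λ (N.cap v) w τp τ)) b}) =
      N.supported Λ (Rl ∪ Rh) v ℓ fun τ => if τp < τ then w else 0 :=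
    funext fun b => conv_rooted hd hv hl hh h0 (fun a τ hτ => demand_le_iff (by omega) hw) b
  unfold childTables
  refine Ok.le (k := 3 + (3 + (3 + (3 + (4 + (2 + (combineCost β Λ + (2 +
    combineCost β Λ)))))))) (Ok.assign_seq (Ok.assign_seq (Ok.assign_seq (Ok.assign_seq
    (Ok.assign_seq (Ok.assign_seq ?_)))))) (by omega)
  set s1 := (((((s.setReg 20 (s.arr 13 v)).setReg 21 (s.arr 14 v)).setReg 22
    ((N.cap v + 1) * (β + 1))).setReg 23 (N.cap v * (β + 1))).setReg 24 (w * (β + 1))).setReg 13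
    (s.reg rTop) with hs1
  simp only [Expr.eval, State.setReg_reg, State.setReg_arr, h9]
  norm_num
  simp only [h10, ht.cap, ht.rows, hg.mul w hwW, ← hs1]
  have h01 : Step n 13 s s1 := by
    exact (((((Step.setReg (by simp) (by simp)).trans (.setReg (by simp) (by simp))).trans
      (.setReg (by simp) (by simp))).trans (.setReg (by simp) (by simp))).trans
      (.setReg (by simp) (by simp))).trans (.setReg (by simp) (by simp))
  have hg1 := hg.step h01 (by simp)
  refine Ok.seq (combine_ok (ℓ := fun τp => τp) (T := N.cap v) (w := w)
    (H := fun τ => N.rooted Λ Rl v τ 0) (G := fun τ σ => N.rooted Λ Rh v τ σ)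
    hg1.heap hg1.consts (by simp) (fun _ _ => rfl) (fun i hi => by omega) ?_ ?_
    (by simp [hs1]) (by simp [hs1]) (by simp [hs1])) ?_
  · simpa [hs1] using ht.light.step h01
  · simpa [hs1] using ht.heavy.step h01
  rintro s2 ⟨k1, k2, k3⟩
  have htop1 : s1.reg rTop = s.reg rTop := by simp [hs1]
  refine Ok.assign_seq ?_
  simp only [Expr.eval]
  set s3 := s2.setReg 14 (s2.reg rTop) with hs3
  have h23 : Step n 14 s2 s3 := .setReg (by simp) (by simp)
  have h23' := h23.mono (r' := 13) (by simp)
  have h03 := (h01.trans (k1.mono (by simp))).trans h23'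
  have hg3 := hg.step h03 (by simp)
  have r20 : s3.reg 20 = s.arr 13 v := by simp [hs3, k1.reg 20 (by simp), hs1]
  have r21 : s3.reg 21 = s.arr 14 v := by simp [hs3, k1.reg 21 (by simp), hs1]
  refine (combine_ok (s := s3) (x := rTimes) (ℓ := fun _ => Λ + 1) (T := N.cap v) (w := w)
    (H := fun τ => N.rooted Λ Rl v τ 0) (G := fun τ σ => N.rooted Λ Rh v τ σ)
    hg3.heap hg3.consts (by simp) (fun s' h' => ?_) (fun i hi => le_rfl) ?_ ?_
    (by simp [hs3, k1.reg 22 (by simp), hs1]) (by simp [hs3, k1.reg 23 (by simp), hs1])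
    (by simp [hs3, k1.reg 24 (by simp), hs1])).weaken le_rfl ?_
  · exact (h'.reg rTimes (by simp)).trans hg3.consts.times
  · rw [r20]; exact ht.light.step h03
  · rw [r21]; exact ht.heavy.step h03
  rintro s4 ⟨l1, l2, l3⟩
  have htop3 : s3.reg rTop = s2.reg rTop := by simp [hs3]
  have e13 : s4.reg 13 = s1.reg rTop := by
    rw [l1.reg 13 (by simp)]
    simp [hs3, k1.reg 13 (by simp), hs1]
  have e14 : s4.reg 14 = s3.reg rTop := by
    rw [l1.reg 14 (by simp)]
    simp [hs3]
  refine ⟨h03.trans (l1.mono (by simp)), by omega, ?_, ?_, by omega⟩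
  · rw [e13]
    intro τ hτ σ hσ
    have := ((k3 τ hτ σ hσ).step h23).step l1
    simp only [hfam τ τ (by omega)] at this
    exact this
  · rw [e14]
    intro τ hτ σ hσ
    have := l3 τ hτ σ hσ
    simp only [hfam (Λ + 1) τ le_rfl] at this
    exact this

/-- Let the vertex in register 11 absorb the vertex in register 9. -/
def absorbChild : Cmd :=
  .assign 15 (.reg rTop) ;; .assign 23 (.reg 13) ;; .assign 24 (.reg 14) ;;
  .assign 22 (.read 16 (.read 11 (.reg 9))) ;;
  .ifLE (.read 11 (.reg 9)) (.const 0)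
    (.assign 20 (.read 13 (.reg 11)) ;; .assign 21 (.reg rWid) ;; absorb ;;
      .store 13 (.reg 11) (.reg 15))
    (.assign 20 (.read 14 (.reg 11)) ;; .assign 21 (.read 15 (.reg 11)) ;; absorb ;;
      .store 14 (.reg 11) (.reg 15))

/-- A bound for the steps of `absorb`, per row of the table. -/
def absorbCost (β Λ : ℕ) : ℕ :=
  (Λ + 3) * (3 * ((β + 3) * (160 * (β + 2) + 60) + 10) + 30)

theorem absorb_cost_le {β Λ R : ℕ} (hR : 1 ≤ R) :
    (Λ + 3) * ((R + 2) * ((β + 3) * (160 * (β + 2) + 60) + 10) + 30) ≤ R * absorbCost β Λ := by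
  unfold absorbCost
  rw [mul_left_comm]
  refine Nat.mul_le_mul_left _ ?_
  generalize (β + 3) * (160 * (β + 2) + 60) + 10 = x
  nlinarith

theorem absorbChild_ok {s : State} {β Λ w R : ℕ} {Rl Rh C : Finset (Fin n)} {v p : Fin n}
    (hg : Globals N β Λ s) (ht : Tables N β Λ Rl Rh s p) (h9 : s.reg 9 = v) (h11 : s.reg 11 = p)
    (hw11 : s.arr 11 v = w) (hwarc : w = N.arc v p) (hR : R = if w = 0 then 1 else N.cap p + 1)
    (hA : Tab β Λ s (s.reg 13) 1 fun τ _ => N.childSol Λ C v p τ τ)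
    (hB : Tab β Λ s (s.reg 14) 1 fun τ _ => N.childSol Λ C v p (Λ + 1) τ)
    (hlC : Disjoint Rl C) (hhC : Disjoint Rh C) (hv : v ∈ C) (hp : p ∉ C) (hl : N.Hangs p Rl)
    (hh : N.Hangs p Rh) (hC : N.Hangs p C) (h0 : ∀ x ∈ C, x ≠ v → N.arc x p = 0) :
    Ok absorbChild s (R * absorbCost β Λ + 50) fun s' =>
      Grow n s s' ∧ (∀ x < 13, s'.reg x = s.reg x) ∧
      (∀ a < 20, ∀ i : ℕ, (a ≠ 13 ∧ a ≠ 14) ∨ i ≠ (p : ℕ) → s'.arr a i = s.arr a i) ∧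
      s'.reg rTop = s.reg rTop + R * ((Λ + 1) * (β + 1)) ∧
      Tables N β Λ (if w = 0 then Rl ∪ C else Rl) (if w = 0 then Rh else Rh ∪ C) s' p := by
  have hwW : w ≤ N.weight + 2 := by
    have h1 := N.inWeight_le p
    have h2 : N.arc v p ≤ N.inWeight p :=
      Finset.single_le_sum (f := fun x => N.arc x p) (fun _ _ => Nat.zero_le _) (Finset.mem_univ v)
    omega
  have hR1 : 1 ≤ R := by rw [hR]; split_ifs <;> omega
  have hcost := absorb_cost_le (β := β) (Λ := Λ) hR1
  unfold absorbChild
  refine Ok.le (k := 2 + (2 + (2 + (4 + (4 + (12 + R * absorbCost β Λ)))))) (Ok.assign_seq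
    (Ok.assign_seq (Ok.assign_seq (Ok.assign_seq ?_)))) (by omega)
  set s1 := (((s.setReg 15 (s.reg rTop)).setReg 23 (s.reg 13)).setReg 24 (s.reg 14)).setReg 22
    (w * (β + 1)) with hs1
  have h01 : Step n 15 s s1 := by
    exact (((Step.setReg (by simp) (by simp)).trans (.setReg (by simp) (by simp))).trans
      (.setReg (by simp) (by simp))).trans (.setReg (by simp) (by simp))
  simp only [Expr.eval, State.setReg_reg, State.setReg_arr, h9]
  norm_num
  simp only [hw11, hg.mul w hwW, ← hs1]
  -- The two branches differ only in the table and in the array that holds its address.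
  have key (a : ℕ) (ha : a = 13 ∨ a = 14) (e21 : Expr) (F : ℕ → ℕ → ℕ → Set (ℕ × Finset (Fin n)))
      (F' : ℕ → ℕ → ℕ → Set (ℕ × Finset (Fin n)))
      (he : ∀ k, e21.eval (s1.setReg 20 k) = R * (β + 1)) (hsteps : e21.steps ≤ 3)
      (hF : Tab β Λ s (s.arr a p) R F)
      (hF' : ∀ τ σ b, conv (F τ σ) (N.childSol Λ C v p (Λ + 1) τ) b ∪
        conv (F τ (σ - w)) (N.childSol Λ C v p τ τ) b = F' τ σ b) :
      Ok (.assign 20 (.read a (.reg 11)) ;; .assign 21 e21 ;; absorb ;;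
        .store a (.reg 11) (.reg 15)) s1 (12 + R * absorbCost β Λ) fun s' =>
        Grow n s s' ∧ (∀ x < 13, s'.reg x = s.reg x) ∧
        (∀ a' < 20, ∀ i : ℕ, a' ≠ a ∨ i ≠ (p : ℕ) → s'.arr a' i = s.arr a' i) ∧
        s'.reg rTop = s.reg rTop + R * ((Λ + 1) * (β + 1)) ∧
        Tab β Λ s' (s'.arr a p) R F' := by
    refine Ok.le (k := 3 + (e21.steps + 1 + (R * absorbCost β Λ + 3))) (Ok.assign_seq
      (Ok.assign_seq ?_)) (by omega)
    set s2 := (s1.setReg 20 (s.arr a p)).setReg 21 (R * (β + 1)) with hs2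
    have e11 : s1.reg 11 = p := by simp [hs1, h11]
    have earr : s1.arr = s.arr := by simp [hs1]
    simp only [Expr.eval, e11, earr, he, ← hs2]
    have h12 : Step n 15 s1 s2 := (Step.setReg (by simp) (by simp)).trans
      (.setReg (by simp) (by simp))
    have h02 := h01.trans h12
    have hg2 := hg.step h02 (by simp)
    refine Ok.seq ((absorb_ok (s := s2) (R := R) (w := w) (zA := s.arr a p) (aA := s.reg 13)
      (bA := s.reg 14) (Z := F) (A := fun τ => N.childSol Λ C v p τ τ)
      (B := fun τ => N.childSol Λ C v p (Λ + 1) τ) hg2.heap hg2.consts (by simp [hs2])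
      (by simp [hs2, hs1]) (by simp [hs2, hs1]) (by simp [hs2]) (by simp [hs2, hs1])
      (hF.step h02) (hA.step h02) (hB.step h02)).le hcost) ?_
    rintro s3 ⟨k1, k2, k3⟩
    have h03 := h02.trans (k1.mono (by simp))
    have htop2 : s2.reg rTop = s.reg rTop := by simp [hs2, hs1]
    refine Ok.store ?_
    have e3 : s3.reg 11 = p := (k1.reg 11 (by simp)).trans (by simp [hs2, e11])
    have e15 : s3.reg 15 = s.reg rTop := (k1.reg 15 (by simp)).trans (by simp [hs2, hs1])
    simp only [Expr.eval, e3, e15]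
    have hgrow : Grow n s3 (s3.setArr a p (s.reg rTop)) := by
      refine .of_eq rfl fun a' ha' => ?_
      have : a' ≠ a := by omega
      funext i
      simp [this]
    refine ⟨h03.grow.trans hgrow, fun x hx => h03.reg x (by omega), fun a' ha' i hi => ?_, ?_, ?_⟩
    · have : ¬ (a' = a ∧ i = (p : ℕ)) := by omega
      simp only [State.setArr_arr, this, if_false]
      exact h03.arr a' ha' i
    · rw [State.setArr_reg, k2, htop2]; ring
    · have : (s3.setArr a p (s.reg rTop)).arr a p = s.reg rTop := by simp
      rw [this]
      intro τ hτ σ hσ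
      have := k3.grow hgrow τ hτ σ hσ
      rw [htop2] at this
      simpa only [hF'] using this
  refine Ok.ifLE (fun g => ?_) fun g => ?_
  all_goals
    have e9 : s1.reg 9 = v := by simp [hs1, h9]
    have earr : s1.arr = s.arr := by simp [hs1]
    simp only [Expr.eval, e9, earr, hw11] at g
  · have hw0 : w = 0 := by omega
    simp only [hw0, if_true] at hR ⊢
    refine (key 13 (.inl rfl) (.reg rWid) (fun τ _ => N.rooted Λ Rl p τ 0)
      (fun τ _ => N.rooted Λ (Rl ∪ C) p τ 0) (fun k => ?_) (by simp) ?_ fun τ σ b => ?_).weaken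
      le_rfl ?_
    · simp [hs1, hg.consts.wid, hR]
    · rw [hR]; exact ht.light
    · exact (by simpa using conv_childSol (τ := τ) (σ := 0) hlC hv hp hl hC h0 b)
    · rintro s' ⟨g1, g2, g3, g4, g5⟩
      rw [hR] at g5
      exact ⟨g1, g2, fun a ha i hi => g3 a ha i (by omega), by simpa [hw0] using g4,
        (g3 12 (by simp) p (by simp)).trans ht.cap, (g3 15 (by simp) p (by simp)).trans ht.rows,
        g5, by rw [g3 14 (by simp) p (by simp)]; exact ht.heavy.grow g1⟩
  · have hw0 : w ≠ 0 := by omega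
    simp only [hw0, if_false] at hR ⊢
    refine (key 14 (.inr rfl) (.read 15 (.reg 11)) (fun τ σ => N.rooted Λ Rh p τ σ)
      (fun τ σ => N.rooted Λ (Rh ∪ C) p τ σ) (fun k => ?_) (by simp) ?_ fun τ σ b => ?_).weaken
      le_rfl ?_
    · simp [hs1, h11, ht.rows, hR]
    · rw [hR]; exact ht.heavy
    · rw [hwarc]
      exact conv_childSol (τ := τ) (σ := σ) hhC hv hp hh hC h0 b
    · rintro s' ⟨g1, g2, g3, g4, g5⟩
      rw [hR] at g5
      exact ⟨g1, g2, fun a ha i hi => g3 a ha i (by omega), g4,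
        (g3 12 (by simp) p (by simp)).trans ht.cap, (g3 15 (by simp) p (by simp)).trans ht.rows,
        by rw [g3 13 (by simp) p (by simp)]; exact ht.light.grow g1, g5⟩

end

section

open Network

variable {n : ℕ} {N : Network (Fin n)}

/-! ### The absorption of a leaf -/

/-- The state of the memory while leaves are removed. -/
structure Inv (N : Network (Fin n)) (β Λ : ℕ) (own : Fin n → Fin n) (heavy : Fin n → Bool)
    (s : State) : Prop where
  glob : Globals N β Λ s
  clus : Clustering N own heavy
  tabs : ∀ u, own u = u → Tables N β Λ (lightPart own heavy u) (heavyPart own heavy u) s u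
  nbrs : ∀ u, own u = u → ∀ j, 6 ≤ j → j < 12 →
    s.arr j u = ∑ x ∈ alive own, contribution N j x u
  /-- Absorbed vertices do not look like leaves. -/
  dead : ∀ u, own u ≠ u → s.arr 6 u = 0 ∧ s.arr 8 u = 0
  root : ∃ r, own r = r ∧ s.reg 10 = (r : ℕ)

/-- Let the leaf in register 9 be absorbed by its neighbour, and continue with the neighbour. -/
def absorbLeaf : Cmd :=
  .ifLE (.const 1) (.read 6 (.reg 9)) (.assign 11 (.read 7 (.reg 9)))
    (.assign 11 (.read 9 (.reg 9))) ;;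
  childTables ;; absorbChild ;; detach ;; .assign 10 (.reg 11) ;; .assign 9 (.reg 11)

/-- The number of rows that have to be computed for each time when `p` absorbs `v`. -/
noncomputable def Network.rowsFor (N : Network (Fin n)) (v p : Fin n) : ℕ :=
  if N.arc v p = 0 then 1 else N.cap p + 1

theorem absorbLeaf_ok {s : State} {β Λ : ℕ} {own : Fin n → Fin n} {heavy : Fin n → Bool}
    {v p : Fin n} (hI : Inv N β Λ own heavy s) (h9 : s.reg 9 = v) (hv : own v = v)
    (hleaf : N.aliveNbrs own v = {p}) (hne : p ≠ v) :
    Ok absorbLeaf s (N.rowsFor v p * absorbCost β Λ + 2 * combineCost β Λ + 300) fun s' =>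
      Inv N β Λ (absorbOwn own v p) (N.absorbHeavy own heavy v p) s' ∧
      s'.reg 8 = s.reg 8 ∧ s'.reg 9 = p ∧
      s'.reg rTop = s.reg rTop + (2 + N.rowsFor v p) * ((Λ + 1) * (β + 1)) := by
  have hc := hI.clus
  obtain ⟨hp, hn⟩ : own p = p ∧ N.Nbr v p := mem_aliveNbrs.1 (by simp [hleaf])
  have hpv : (p : ℕ) ≠ v := by rwa [Ne, Fin.val_inj]
  have harr (j : ℕ) (h1 : 6 ≤ j) (h2 : j < 12) : s.arr j v = contribution N j p v := by
    rw [hI.nbrs v hv j h1 h2, sum_contribution_leaf hleaf]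
  have hunion := lightPart_union_heavyPart own heavy v
  have hpC : p ∉ cluster own v := by simp [cluster, hp, hne]
  have hvC : v ∈ cluster own v := by simp [cluster, hv]
  unfold absorbLeaf
  refine Ok.le (k := 10 + ((2 * combineCost β Λ + 50) + ((N.rowsFor v p * absorbCost β Λ + 50) +
    (100 + (2 + 2))))) (Ok.seq (R := fun s' => s' = s.setReg 11 p) ?_ ?_) (by omega)
  · have h6 := harr 6 (by simp) (by simp)
    have h7 := harr 7 (by simp) (by simp)
    have h9' := harr 9 (by simp) (by simp)
    simp only [contribution] at h6 h7 h9'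
    refine (Ok.ifLE (k := 4) (fun g => ?_) fun g => ?_).le (by simp)
    all_goals
      simp only [Expr.eval, h9, h6] at g
      refine (Ok.assign ?_).le (by simp)
      simp only [Expr.eval, h9, h7, h9']
    · split_ifs at g ⊢ with h
      · rfl
      · omega
    · split_ifs at g with h
      · omega
      · rw [if_pos (hn.resolve_right h)]
  rintro s1 hs1
  have h01 : Step n 9 s s1 := by rw [hs1]; exact .setReg (by simp) (by simp)
  have hg1 := hI.glob.step h01 (by simp)
  refine Ok.seq (childTables_ok (v := v) (w := N.arc p v) hg1
    ((hI.tabs v hv).congr h01.grow fun a _ _ => h01.arr a (by omega) _) (by simp [hs1, h9])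
    (by rw [h01.arr 10 (by simp), harr 10 (by simp) (by simp)]; rfl)
    (disjoint_lightPart_heavyPart own heavy v) (hc.mem_lightPart_self hv) (hc.hangs_lightPart v)
    (hc.hangs_heavyPart v) (fun x => hc.arc_lightPart) ?_) ?_
  · have hpH : p ∉ heavyPart own heavy v := by simp [heavyPart, hp, hne]
    rw [add_comm, ← Finset.sum_insert (f := fun x => N.arc x v) hpH]
    exact Finset.sum_le_sum_of_subset (Finset.subset_univ _)
  rintro s2 ⟨k1, k2, k3, k4, -⟩
  have hg2 := hg1.step k1 (by simp)
  have h02 := h01.trans (k1.mono (by simp))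
  rw [hunion] at k3 k4
  have hsup (ℓ τ : ℕ) (hτ : τ ≤ Λ) :
      (N.supported Λ (cluster own v) v ℓ fun τ' => if τ < τ' then N.arc p v else 0) =
        N.childSol Λ (cluster own v) v p ℓ τ :=
    funext fun b => supported_eq_childSol hvC hpC (hc.hangs_cluster v)
      (fun x hx => hc.mem_cluster_or_eq hv hleaf hx) hτ b
  refine Ok.seq (absorbChild_ok (w := N.arc v p) (C := cluster own v) hg2
    ((hI.tabs p hp).congr h02.grow fun a _ _ => h02.arr a (by omega) _)
    (by rw [k1.reg 9 (by simp)]; simp [hs1, h9]) (by rw [k1.reg 11 (by simp)]; simp [hs1])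
    (by rw [h02.arr 11 (by simp), harr 11 (by simp) (by simp)]; rfl) rfl rfl
    (fun τ hτ σ hσ => by beta_reduce; rw [← hsup τ τ hτ]; exact k3 τ hτ σ hσ)
    (fun τ hτ σ hσ => by beta_reduce; rw [← hsup (Λ + 1) τ hτ]; exact k4 τ hτ σ hσ)
    (hc.cluster_disjoint_lightPart hv hp hleaf hne) (hc.cluster_disjoint_heavyPart hv hp hleaf hne)
    hvC hpC (hc.hangs_lightPart p) (hc.hangs_heavyPart p) (hc.hangs_cluster_parent hv hp hleaf hne)
    fun x => hc.arc_cluster hv hp hleaf hne) ?_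
  rintro s3 ⟨l1, l2, l3, l4, l5⟩
  have hreg3 (x : ℕ) (hx : x < 9) : s3.reg x = s.reg x := by
    rw [l2 x (by omega), h02.reg x hx]
  have harr3 (a : ℕ) (ha : a < 20) (i : ℕ) (hi : (a ≠ 13 ∧ a ≠ 14) ∨ i ≠ (p : ℕ)) :
      s3.arr a i = s.arr a i := by
    rw [l3 a ha i hi, h02.arr a ha i]
  have h911 : s3.reg 9 = v ∧ s3.reg 11 = p := by
    rw [l2 9 (by simp), l2 11 (by simp), k1.reg 9 (by simp), k1.reg 11 (by simp)]
    simp [hs1, h9]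
  refine Ok.seq (detach_ok (N := N) hne h911.1 h911.2 fun j h1 h2 => ?_) ?_
  · rw [harr3 j (by omega) v (by omega), harr j h1 h2]
  rintro s4 ⟨m1, m2, m3, m4, m5, m6⟩
  refine Ok.assign_seq (Ok.assign ?_)
  set s5 := (s4.setReg 10 (s4.reg 11)).setReg 9 p with hs5
  have e5 : ((s4.setReg 10 ((Expr.reg 11).eval s4)).setReg 9
      ((Expr.reg 11).eval (s4.setReg 10 ((Expr.reg 11).eval s4)))) = s5 := by
    simp [hs5, m1, h911.2]
  rw [e5]
  have hreg5 (x : ℕ) (hx : x ≠ 9 ∧ x ≠ 10) : s5.reg x = s3.reg x := by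
    simp [hs5, hx, m1]
  have harr5 (a : ℕ) (ha : a < 6 ∨ 12 ≤ a) : s5.arr a = s3.arr a := m2 a ha
  have h35 : Grow n s3 s5 := .of_eq (hreg5 _ (by simp)) fun a ha => harr5 a (by omega)
  have h05 := h02.grow.trans (l1.trans h35)
  have halive := hc.alive_absorbOwn hv hp hleaf hne
  have hown {u : Fin n} : absorbOwn own v p u = u ↔ u ≠ v ∧ own u = u := by
    rw [← mem_alive, halive, Finset.mem_erase, mem_alive]
  refine ⟨⟨?_, hc.absorb hv hp hleaf hne, fun u hu => ?_, fun u hu j h1 h2 => ?_, fun u hu => ?_,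
    p, hown.2 ⟨hne, hp⟩, ?_⟩, ?_, by simp [hs5], ?_⟩
  · refine hI.glob.congr (fun x hx => ?_) h05 (fun i => ?_) fun i => ?_
    · rw [hreg5 x (by omega), hreg3 x (by omega)]
    · rw [harr5 5 (by simp), harr3 5 (by simp) i (by simp)]
    · rw [harr5 16 (by simp), harr3 16 (by simp) i (by simp)]
  · obtain ⟨huv, hu⟩ := hown.1 hu
    by_cases hup : u = p
    · subst hup
      rw [hc.lightPart_absorb hv hp hleaf hne, hc.heavyPart_absorb hv hp hleaf hne]
      exact l5.congr h35 fun a h1 h2 => by rw [harr5 a (by omega)]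
    · rw [hc.lightPart_absorb_of_ne hv hp hleaf hne hup huv,
        hc.heavyPart_absorb_of_ne hv hp hleaf hne hup huv]
      refine (hI.tabs u hu).congr h05 fun a h1 h2 => ?_
      rw [harr5 a (by omega), harr3 a (by omega) u (.inr (by rwa [Ne, Fin.val_inj]))]
  · obtain ⟨huv, hu⟩ := hown.1 hu
    have hold := hI.nbrs u hu j h1 h2
    rw [← Finset.add_sum_erase _ _ (mem_alive.2 hv), ← halive] at hold
    change s4.arr j u = _
    by_cases hup : u = p
    · subst hup
      rw [m4 j h1 h2, harr3 j (by omega) u (by omega), hold]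
      omega
    · rw [m3 j h1 h2 u huv hup, harr3 j (by omega) u (by omega), hold,
        contribution_eq_zero fun hn' =>
          Clustering.not_nbr_of_alive hv hp hleaf hne hu hup hn'.symm, zero_add]
  · by_cases huv : u = v
    · rw [huv]; exact ⟨m5, m6⟩
    · have hu' : own u ≠ u := fun e => hu (hown.2 ⟨huv, e⟩)
      have hup : u ≠ p := by rintro rfl; exact hu' hp
      obtain ⟨d1, d2⟩ := hI.dead u hu'
      constructor
      · exact (m3 6 (by simp) (by simp) u huv hup).trans
          ((harr3 6 (by simp) u (by simp)).trans d1)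
      · exact (m3 8 (by simp) (by simp) u huv hup).trans
          ((harr3 8 (by simp) u (by simp)).trans d2)
  · simp [hs5, m1, h911.2]
  · rw [hreg5 8 (by simp), hreg3 8 (by simp)]
  · rw [hreg5 rTop (by simp), l4, k2]
    have : s1.reg rTop = s.reg rTop := by simp [hs1]
    rw [this]
    change _ + N.rowsFor v p * _ = _
    ring

/-! ### The removal of all leaves -/

/-- A bound for the number of rows that have still to be computed for each time. The absorption of
`v` by `p` uses up the summand 1 of `v` and the summand of the arc from `v` to `p`. -/
noncomputable def Network.potential (N : Network (Fin n)) (own : Fin n → Fin n) : ℕ :=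
  ∑ u ∈ alive own, (1 + ∑ x ∈ alive own, if N.arc x u = 0 then 0 else N.inWeight u + 2)

theorem Network.Clustering.potential_absorbOwn {own : Fin n → Fin n} {heavy : Fin n → Bool}
    {v p : Fin n} (h : Clustering N own heavy) (hv : own v = v) (hp : own p = p)
    (hleaf : N.aliveNbrs own v = {p}) (hne : p ≠ v) :
    N.potential (absorbOwn own v p) + N.rowsFor v p ≤ N.potential own := by
  unfold potential
  have hvA : v ∈ alive own := mem_alive.2 hv
  have hpA : p ∈ (alive own).erase v := Finset.mem_erase.2 ⟨hne, mem_alive.2 hp⟩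
  rw [h.alive_absorbOwn hv hp hleaf hne, ← Finset.add_sum_erase _ _ hvA,
    ← Finset.add_sum_erase _ _ hpA]
  set A := (alive own).erase v with hA
  rw [← Finset.add_sum_erase (a := p) A (fun u => 1 + ∑ x ∈ alive own, _) hpA,
    ← Finset.add_sum_erase (a := v) (alive own)
      (fun x => if N.arc x p = 0 then 0 else N.inWeight p + 2) hvA]
  have hmono : ∑ u ∈ A.erase p, (1 + ∑ x ∈ A, if N.arc x u = 0 then 0 else N.inWeight u + 2) ≤
      ∑ u ∈ A.erase p, (1 + ∑ x ∈ alive own, if N.arc x u = 0 then 0 else N.inWeight u + 2) :=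
    Finset.sum_le_sum fun u _ => Nat.add_le_add_left
      (Finset.sum_le_sum_of_subset (Finset.erase_subset v _)) 1
  have hrows : N.rowsFor v p ≤ 1 + if N.arc v p = 0 then 0 else N.inWeight p + 2 := by
    have hcap : N.cap p ≤ N.inWeight p + 1 := min_le_right _ _
    unfold rowsFor
    split_ifs <;> omega
  rw [← hA]
  omega

/-- As long as possible, let a leaf be absorbed by its neighbour. Register 8 runs through the
vertices; after the absorption of a leaf, its neighbour is examined next. -/
def removeLeaves : Cmd :=
  .whileLT (.reg 8) (.reg 0)
    (leafTest ;; .ifLE (.const 1) (.reg 12) absorbLeaf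
      (.assign 8 (.add (.reg 8) (.const 1)) ;; .assign 9 (.reg 8)))

/-- A bound for the steps for each unit of `Network.potential`. -/
def leafCost (β Λ : ℕ) : ℕ := absorbCost β Λ + 2 * combineCost β Λ + 400

theorem Inv.setReg {s : State} {β Λ : ℕ} {own : Fin n → Fin n} {heavy : Fin n → Bool}
    (hI : Inv N β Λ own heavy s) {x : ℕ} (k : ℕ) (hx : 7 ≤ x ∧ x ≠ 10 ∧ x ≠ rTop) :
    Inv N β Λ own heavy (s.setReg x k) where
  glob := hI.glob.step (Step.setReg (r := 7) hx.1 hx.2.2) le_rfl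
  clus := hI.clus
  tabs u hu := (hI.tabs u hu).congr (Step.setReg (r := 7) hx.1 hx.2.2).grow fun _ _ _ => rfl
  nbrs := hI.nbrs
  dead := hI.dead
  root := by
    obtain ⟨r, h1, h2⟩ := hI.root
    exact ⟨r, h1, by rw [State.setReg_reg, if_neg hx.2.1.symm, h2]⟩

theorem removeLeaves_ok {s : State} {β Λ : ℕ} {own : Fin n → Fin n} {heavy : Fin n → Bool}
    (hloop : ∀ v, ¬ N.graph.Adj v v) (hI : Inv N β Λ own heavy s) (h8 : s.reg 8 = 0)
    (h9 : s.reg 9 = 0) (hn : 0 < n) :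
    Ok removeLeaves s (leafCost β Λ * (N.potential own + n) + 3) fun s' => ∃ own' heavy',
      Inv N β Λ own' heavy' s' ∧ (∀ u, own' u = u → (N.aliveNbrs own' u).card ≠ 1) ∧
      s'.reg rTop ≤ s.reg rTop + 3 * ((Λ + 1) * (β + 1)) * N.potential own := by
  unfold removeLeaves
  -- Each leaf of the remaining graph is the vertex in register 9 or comes after register 8. The
  -- only new leaf that an absorption can create is the parent, which is examined next.
  refine Ok.whileLT (fun m s' => ∃ own' heavy', Inv N β Λ own' heavy' s' ∧
    (s'.reg 8 < n ∧ s'.reg 9 < n ∨ s'.reg 8 = n ∧ s'.reg 9 = n) ∧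
    (∀ u, own' u = u → (N.aliveNbrs own' u).card = 1 → (u : ℕ) = s'.reg 9 ∨ s'.reg 8 < u) ∧
    m = leafCost β Λ * (N.potential own' + (n - s'.reg 8)) + 3 ∧
    s'.reg rTop + 3 * ((Λ + 1) * (β + 1)) * N.potential own' ≤
      s.reg rTop + 3 * ((Λ + 1) * (β + 1)) * N.potential own) ?_ ?_ _ s
    ⟨own, heavy, hI, .inl ⟨by omega, by omega⟩, fun u _ _ => by omega, by rw [h8, Nat.sub_zero],
      le_rfl⟩
  · rintro _ s' ⟨own', heavy', hI', hpos, hleaves, rfl, htop⟩ ht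
    simp only [Expr.eval, hI'.glob.consts.num] at ht
    obtain ⟨-, hv⟩ := hpos.resolve_right (by omega)
    set v : Fin n := ⟨s'.reg 9, hv⟩ with hvdef
    have h9v : s'.reg 9 = v := rfl
    have hiff : (s'.arr 6 (s'.reg 9) ≤ 1 ∧ s'.arr 8 (s'.reg 9) ≤ 1 ∧
        1 ≤ s'.arr 6 (s'.reg 9) + s'.arr 8 (s'.reg 9) ∧
        (s'.arr 6 (s'.reg 9) + s'.arr 8 (s'.reg 9) ≤ 1 ∨
          s'.arr 7 (s'.reg 9) = s'.arr 9 (s'.reg 9))) ↔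
        own' v = v ∧ (N.aliveNbrs own' v).card = 1 := by
      by_cases hov : own' v = v
      · simp only [hov, true_and]
        rw [card_aliveNbrs_eq_one_iff (A := fun j => s'.arr j v) own' v (hI'.nbrs v hov)]
      · obtain ⟨d1, d2⟩ := hI'.dead v hov
        rw [h9v, d1, d2]
        simp [hov]
    have htest := leafTest_ok s'
    rw [hiff] at htest
    by_cases hl : own' v = v ∧ (N.aliveNbrs own' v).card = 1
    · obtain ⟨hov, hcard⟩ := hl
      obtain ⟨p, hp⟩ := Finset.card_eq_one.1 hcard
      obtain ⟨hop, hn'⟩ : own' p = p ∧ N.Nbr v p := mem_aliveNbrs.1 (by simp [hp])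
      have hne : p ≠ v := by
        rintro rfl
        exact hloop _ (hn'.elim id id)
      have hpot := hI'.clus.potential_absorbOwn hov hop hp hne
      have hR : 1 ≤ N.rowsFor v p := by unfold rowsFor; split_ifs <;> omega
      set R := N.rowsFor v p with hRdef
      set own'' := absorbOwn own' v p with hown''
      refine ⟨60 + (3 + (R * absorbCost β Λ + 2 * combineCost β Λ + 300)),
        leafCost β Λ * (N.potential own'' + (n - s'.reg 8)) + 3, Ok.seq htest ?_, ?_⟩
      · rintro s1 ⟨k, hs1, hk⟩
        refine Ok.ifLE (fun _ => ?_) fun g => ?_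
        · have hr (x : ℕ) (hx : x ≠ 12) : s1.reg x = s'.reg x := by simp [hs1, hx]
          refine (absorbLeaf_ok (s := s1) (hs1 ▸ hI'.setReg k (by simp))
            ((hr 9 (by simp)).trans h9v) hov hp hne).weaken le_rfl ?_
          rintro s2 ⟨g1, g2, g3, g4⟩
          rw [hr 8 (by simp)] at g2
          rw [hr rTop (by simp), ← hRdef] at g4
          refine ⟨own'', _, g1, .inl ⟨by omega, by omega⟩, fun u hu hcard' => ?_, by rw [g2], ?_⟩
          · obtain ⟨huv, hou⟩ : u ≠ v ∧ own' u = u := by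
              rwa [← mem_alive, hI'.clus.alive_absorbOwn hov hop hp hne, Finset.mem_erase,
                mem_alive] at hu
            by_cases hup : u = p
            · left; rw [g3, hup]
            · rw [hI'.clus.aliveNbrs_absorbOwn_of_ne hov hop hp hne hou hup] at hcard'
              right
              rw [g2]
              exact (hleaves u hou hcard').resolve_left fun e => huv (Fin.ext e)
          · rw [g4]
            have h1 : (2 + R) * ((Λ + 1) * (β + 1)) ≤ 3 * ((Λ + 1) * (β + 1)) * R := by
              rw [mul_comm 3, mul_assoc, mul_comm]
              exact Nat.mul_le_mul_left _ (by omega)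
            have h2 := Nat.mul_le_mul_left (3 * ((Λ + 1) * (β + 1))) hpot
            rw [mul_add] at h2
            omega
        · simp only [Expr.eval] at g
          have := hk.2 ⟨hov, hcard⟩
          rw [hs1, State.setReg_reg, if_pos rfl] at g
          omega
      · have h2 := Nat.mul_le_mul_left (leafCost β Λ) hpot
        have h3 : R * absorbCost β Λ + 2 * combineCost β Λ + 400 ≤ leafCost β Λ * R := by
          unfold leafCost
          nlinarith [Nat.zero_le (combineCost β Λ)]
        rw [mul_add] at h2
        rw [mul_add, mul_add]
        simp only [Expr.steps]
        omega
    · refine ⟨60 + (3 + 6), leafCost β Λ * (N.potential own' + (n - (s'.reg 8 + 1))) + 3,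
        Ok.seq htest ?_, ?_⟩
      · rintro s1 ⟨k, hs1, hk⟩
        refine Ok.ifLE (fun g => ?_) fun _ => ?_
        · simp only [Expr.eval] at g
          rw [hs1, State.setReg_reg, if_pos rfl] at g
          exact absurd (hk.1 g) hl
        · refine (Ok.assign_seq (Ok.assign ?_)).le (by simp)
          set s2 := (s1.setReg 8 (s'.reg 8 + 1)).setReg 9 (s'.reg 8 + 1) with hs2
          have e2 : ((s1.setReg 8 (((Expr.reg 8).add (.const 1)).eval s1)).setReg 9
              ((Expr.reg 8).eval (s1.setReg 8 (((Expr.reg 8).add (.const 1)).eval s1)))) = s2 := by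
            simp [hs2, hs1]
          rw [e2]
          have r8 : s2.reg 8 = s'.reg 8 + 1 := by simp [hs2]
          have r9 : s2.reg 9 = s'.reg 8 + 1 := by simp [hs2]
          have rt : s2.reg rTop = s'.reg rTop := by simp [hs2, hs1]
          refine ⟨own', heavy', ?_, by omega, fun u hu hcard => ?_, by rw [r8], by rwa [rt]⟩
          · rw [hs2, hs1]
            exact ((hI'.setReg k (by simp)).setReg _ (by simp)).setReg _ (by simp)
          · have := hleaves u hu hcard
            have : (u : ℕ) ≠ s'.reg 9 := by
              intro e
              obtain rfl : u = v := Fin.ext e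
              exact hl ⟨hu, hcard⟩
            omega
      · have h3 : 400 ≤ leafCost β Λ := Nat.le_add_left _ _
        have h4 : N.potential own' + (n - s'.reg 8) =
            N.potential own' + (n - (s'.reg 8 + 1)) + 1 := by omega
        rw [h4, mul_add_one (leafCost β Λ)]
        simp only [Expr.steps]
        omega
  · rintro _ s' ⟨own', heavy', hI', hpos, hleaves, rfl, htop⟩ ht
    simp only [Expr.eval, hI'.glob.consts.num] at ht
    obtain ⟨h8', h9'⟩ := hpos.resolve_left (by omega)
    refine ⟨by simp, own', heavy', hI', fun u hu hcard => ?_, by omega⟩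
    have := hleaves u hu hcard
    omega

end

section

open Network

variable {n : ℕ} {N : Network (Fin n)}

/-! ### The output -/

/-- Mark the vertices that belong to the set of the last cell of the heap. -/
def markCells : Cmd :=
  .store 5 (.sub (.reg rTop) (.const 1)) (.const 1) ;; .assign 8 (.reg rTop) ;;
  .whileLT (.add (.reg 0) (.const 1)) (.reg 8)
    (.assign 8 (.sub (.reg 8) (.const 1)) ;;
      .ifLE (.const 1) (.read 5 (.reg 8))
        (.store 5 (.read aL (.reg 8)) (.const 1) ;; .store 5 (.read aR (.reg 8)) (.const 1))
        .skip)

theorem markCells_ok {s : State} (hh : HeapOk n s) (h0 : s.reg 0 = n)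
    (hmark : ∀ i, s.arr 5 i = 0) :
    Ok markCells s ((s.reg rTop + 1) * 30) fun s' =>
      outputSet n s' = s.cell n (s.reg rTop - 1) := by
  unfold markCells
  set S := s.cell n (s.reg rTop - 1) with hS
  have hlt := hh.lt_top
  refine (Ok.store_seq (Ok.assign_seq (Ok.weaken (Ok.forLT (s.reg rTop - (n + 1)) 16
    -- The set is the union of the sets of the marked cells that have not been visited yet.
    (fun k s' => s'.reg 0 = n ∧ s'.reg 8 = s.reg rTop - k ∧ (∀ a, 20 ≤ a → s'.arr a = s.arr a) ∧
      (∀ i, s'.arr 5 i ≠ 0 → s.cell n i ⊆ S) ∧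
      ∀ x ∈ S, ∃ i < s.reg rTop - k, s'.arr 5 i ≠ 0 ∧ x ∈ s.cell n i)
    ?_ ?_ ?_) le_rfl ?_))).le ?_
  · refine ⟨by simpa using h0, by simp, fun a ha => ?_, fun i hi => ?_, fun x hx => ?_⟩
    · have : a ≠ 5 := by omega
      funext i
      simp [this]
    · simp only [State.setReg_arr, State.setArr_arr, Expr.eval, true_and, hmark] at hi
      split_ifs at hi with h
      · rw [h]
      · exact absurd rfl hi
    · exact ⟨s.reg rTop - 1, by omega, by simp, hx⟩
  · rintro k s' ⟨g1, g2, -⟩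
    simp only [Expr.eval, g1, g2]
    omega
  · rintro k s1 hk ⟨g1, g2, g3, g4, g5⟩
    set j := s.reg rTop - (k + 1) with hj
    have hcell : s.cell n j = s.cell n (s.arr aL j) ∪ s.cell n (s.arr aR j) :=
      cellSet_of_gt (by omega) (hh.left j (by omega) (by omega)) (hh.right j (by omega) (by omega))
    have hl := hh.left j (by omega) (by omega)
    have hr := hh.right j (by omega) (by omega)
    have e1 : s1.setReg 8 (((Expr.reg 8).sub (.const 1)).eval s1) = s1.setReg 8 j := by
      simp only [Expr.eval, g2]
      congr 1
    refine (Ok.assign_seq (k := 12) ?_).le (by simp)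
    rw [e1]
    refine (Ok.ifLE (k := 8) (fun g => ?_) fun g => ?_).le (by simp)
    all_goals simp only [Expr.eval, State.setReg_reg, State.setReg_arr, if_true] at g
    · have hjS := g4 j (by omega)
      rw [hcell, Finset.union_subset_iff] at hjS
      refine (Ok.store_seq (Ok.store ?_)).le (by simp)
      simp only [Expr.eval, State.setArr_reg, State.setReg_reg, if_true, State.setReg_arr,
        State.setArr_arr]
      norm_num
      rw [g3 aL (by simp), g3 aR (by simp)]
      refine ⟨g1, fun a ha => ?_, fun i hi => ?_, fun x hx => ?_⟩
      · have : a ≠ 5 := by omega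
        rw [← g3 a ha]
        funext i
        simp [this]
      · by_cases h1 : i = s.arr aR j
        · rw [h1]; exact hjS.2
        · by_cases h2 : i = s.arr aL j
          · rw [h2]; exact hjS.1
          · exact g4 i (by simpa [h1, h2] using hi)
      · obtain ⟨i, hi, hne, hx⟩ := g5 x hx
        by_cases hij : i = j
        · rw [hij, hcell, Finset.mem_union] at hx
          obtain hx | hx := hx
          · exact ⟨_, hl, by simp, hx⟩
          · exact ⟨_, hr, by simp, hx⟩
        · refine ⟨i, by omega, ?_, hx⟩
          split_ifs <;> simp [hne]
    · refine (Ok.skip ?_).le (by simp)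
      refine ⟨by simpa using g1, by simp, g3, g4, fun x hx => ?_⟩
      obtain ⟨i, hi, hne, hx⟩ := g5 x hx
      have hij : i ≠ j := by
        rintro rfl
        exact hne (by simpa using g)
      exact ⟨i, by omega, hne, hx⟩
  · rintro s' ⟨-, -, -, g4, g5⟩
    ext x
    simp only [outputSet, Finset.mem_filter, Finset.mem_univ, true_and]
    constructor
    · intro hx
      have := g4 x hx
      rw [State.cell, cellSet_of_lt x.2] at this
      exact this (by simp)
    · intro hx
      obtain ⟨i, hi, hne, hx⟩ := g5 x hx
      obtain hi' | rfl : i < n ∨ i = n := by omega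
      · rw [State.cell, cellSet_of_lt hi', Finset.mem_singleton] at hx
        rw [hx]
        exact hne
      · rw [State.cell, cellSet_self] at hx
        simp at hx
  · simp only [Expr.steps]
    have : s.reg rTop - (n + 1) + 1 ≤ s.reg rTop := by omega
    nlinarith

/-- Read off the solution from the tables of the vertex in register 10. -/
def writeSolution : Cmd := .assign 9 (.reg 10) ;; childTables ;; markCells

theorem writeSolution_ok {s : State} {β lam : ℕ} {own : Fin n → Fin n} {heavy : Fin n → Bool}
    (hloop : ∀ v, ¬ N.graph.Adj v v) (hI : Inv N β (lam + 1) own heavy s)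
    (hno : ∀ u, own u = u → (N.aliveNbrs own u).card ≠ 1) :
    Ok writeSolution s (2 * combineCost β (lam + 1) + 52 +
      (s.reg rTop + 2 * ((lam + 2) * (β + 1)) + 1) * 30) fun s' =>
      N.IsMaxInfluencing lam β (outputSet n s') := by
  obtain ⟨r, hr, h10⟩ := hI.root
  have hc := hI.clus
  have huniv := hc.cluster_eq_univ hno hr
  have halive : alive own = {r} := by
    ext x
    rw [mem_alive, Finset.mem_singleton]
    constructor
    · intro hx
      have : x ∈ cluster own r := huniv ▸ Finset.mem_univ x
      rw [cluster, Finset.mem_filter] at this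
      exact hx.symm.trans this.2
    · rintro rfl
      exact hr
  have harr : s.arr 10 r = 0 := by
    rw [hI.nbrs r hr 10 (by simp) (by simp), halive, Finset.sum_singleton,
      contribution_eq_zero fun h => hloop r (h.elim id id)]
  unfold writeSolution
  have h01 : Step n 9 s (s.setReg 9 r) := .setReg (by simp) (by simp)
  refine Ok.le (k := 2 + ((2 * combineCost β (lam + 1) + 50) +
      (s.reg rTop + 2 * ((lam + 2) * (β + 1)) + 1) * 30)) (Ok.assign_seq ?_) (by omega)
  simp only [Expr.eval, h10]
  have hg1 := hI.glob.step h01 (by simp)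
  refine Ok.seq (childTables_ok (v := r) (w := 0) hg1
    ((hI.tabs r hr).congr h01.grow fun a _ _ => h01.arr a (by omega) _) (by simp)
    harr (disjoint_lightPart_heavyPart own heavy r) (hc.mem_lightPart_self hr)
    (hc.hangs_lightPart r) (hc.hangs_heavyPart r) (fun x => hc.arc_lightPart)
    (by rw [add_zero]; exact Finset.sum_le_sum_of_subset (Finset.subset_univ _))) ?_
  rintro s2 ⟨k1, k2, -, k4, k5⟩
  rw [lightPart_union_heavyPart, huniv] at k4
  have hopt := (k4 (lam + 1) le_rfl 0 (by simp) β le_rfl).2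
  -- The absence of a parent amounts to a parent that is never influenced, so that the optimum is
  -- the entry for the time `lam + 1` of the parent and the budget `β`: the last cell of the heap.
  have haddr : s2.reg 14 + ((lam + 1) * 1 + 0) * (β + 1) + β = s2.reg rTop - 1 := by
    rw [← k5]
    have : (lam + 1 + 1) * (β + 1) = (lam + 1) * (β + 1) + (β + 1) := by ring
    rw [this, mul_one, add_zero]
    omega
  rw [haddr] at hopt
  have hg2 := hg1.step k1 (by simp)
  refine (markCells_ok hg2.heap hg2.consts.num hg2.mark).weaken ?_ ?_
  · rw [k2, State.setReg_reg, if_neg (by simp)]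
  · intro s3 hs3
    rw [hs3]
    refine isMaxInfluencing_of_best (k := s2.arr aVal (s2.reg rTop - 1)) (r := r) ?_
    simpa using hopt

end

section

open Network

variable {n : ℕ} {N : Network (Fin n)}

/-! ### The initialisation -/

/-- Set up the constants, the heap and the tables of all vertices. -/
def initialise : Cmd :=
  .assign rWid (.add (.reg 3) (.const 1)) ;; .assign rInf (.add (.reg 2) (.const 1)) ;;
  .assign rTimes (.add (.reg 2) (.const 2)) ;; .assign rTop (.add (.reg 0) (.const 1)) ;;
  .store aVal (.reg 0) (.const 1) ;; readArcs ;; multiples ;; .assign 8 (.const 0) ;;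
  .whileLT (.reg 8) (.reg 0) (initVertex ;; .assign 8 (.add (.reg 8) (.const 1))) ;;
  .assign 8 (.const 0) ;; .assign 9 (.const 0) ;; .assign 10 (.const 0)

/-- All costs are bounded by multiples of this number. -/
def unitCost (β Λ : ℕ) : ℕ := (Λ + 3) ^ 2 * (β + 3) ^ 2

theorem le_unitCost (β Λ : ℕ) : (Λ + 3) * (β + 3) ≤ unitCost β Λ := by
  unfold unitCost
  gcongr <;> exact Nat.le_self_pow (by simp) _

theorem one_le_unitCost (β Λ : ℕ) : 1 ≤ unitCost β Λ :=
  le_trans (by nlinarith [Nat.zero_le (Λ * β)]) (le_unitCost β Λ)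

theorem tabSize_le_unitCost (β Λ : ℕ) : (Λ + 1) * (β + 1) ≤ unitCost β Λ :=
  (Nat.mul_le_mul (by simp) (by simp)).trans (le_unitCost β Λ)

theorem combineCost_le (β Λ : ℕ) : combineCost β Λ ≤ 200 * unitCost β Λ := by
  obtain ⟨x, hx, hx3⟩ : ∃ x, Λ + 3 = x ∧ 1 ≤ x := ⟨_, rfl, by omega⟩
  obtain ⟨y, hy, hy1⟩ : ∃ y, β + 3 = y ∧ 1 ≤ y := ⟨_, rfl, by omega⟩
  unfold combineCost unitCost
  rw [hx, hy]
  have h1 : x * (80 * (β + 2) + 60) + 40 ≤ 180 * (x * y) := by nlinarith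
  calc x * (y * (x * (80 * (β + 2) + 60) + 40) + 10)
      ≤ x * (y * (180 * (x * y)) + 20 * (x * y ^ 2)) := by
        refine Nat.mul_le_mul_left _ (Nat.add_le_add (Nat.mul_le_mul_left _ h1) ?_)
        have := Nat.mul_le_mul hx3 (Nat.one_le_pow 2 y hy1)
        omega
    _ = 200 * (x ^ 2 * y ^ 2) := by ring

theorem absorbCost_le (β Λ : ℕ) : absorbCost β Λ ≤ 1000 * unitCost β Λ := by
  obtain ⟨y, hy, hy1⟩ : ∃ y, β + 3 = y ∧ 1 ≤ y := ⟨_, rfl, by omega⟩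
  unfold absorbCost unitCost
  rw [pow_two (Λ + 3), hy, mul_assoc, mul_left_comm]
  refine Nat.mul_le_mul_left _ ?_
  have h1 : 3 * (y * (160 * (β + 2) + 60) + 10) + 30 ≤ 1000 * y ^ 2 := by nlinarith
  calc _ ≤ 1000 * y ^ 2 := h1
    _ ≤ 1000 * ((Λ + 3) * y ^ 2) := by nlinarith [Nat.zero_le (Λ * y ^ 2)]

theorem leafCost_le (β Λ : ℕ) : leafCost β Λ ≤ 1800 * unitCost β Λ := by
  have h1 := absorbCost_le β Λ
  have h2 := combineCost_le β Λ
  have h3 := one_le_unitCost β Λ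
  unfold leafCost
  omega

theorem initVertexCost_le (β Λ R : ℕ) :
    50 + (Λ + 3) * ((β + 3) * 70 + 10) + (Λ + 3) * ((R + 3) * ((β + 3) * 60 + 10) + 10) ≤
      250 * unitCost β Λ * (R + 3) := by
  have h0 := le_unitCost β Λ
  have h1 := one_le_unitCost β Λ
  obtain ⟨y, hy, hy1⟩ : ∃ y, β + 3 = y ∧ 1 ≤ y := ⟨_, rfl, by omega⟩
  obtain ⟨x, hx, hx3⟩ : ∃ x, Λ + 3 = x ∧ 1 ≤ x := ⟨_, rfl, by omega⟩
  obtain ⟨z, hz, hz1⟩ : ∃ z, R + 3 = z ∧ 1 ≤ z := ⟨_, rfl, by omega⟩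
  rw [hx, hy] at h0 ⊢
  rw [hz]
  set U := unitCost β Λ
  have hxU : x ≤ U := (Nat.le_mul_of_pos_right x hy1).trans h0
  have a1 : x * (y * 70 + 10) ≤ 80 * U := by nlinarith
  have a2 : x * (z * (y * 60 + 10) + 10) ≤ 80 * (U * z) := by
    calc x * (z * (y * 60 + 10) + 10) = 60 * (x * y) * z + 10 * x * z + 10 * x := by ring
      _ ≤ 60 * U * z + 10 * U * z + 10 * U * z := by
        have : 10 * x ≤ 10 * U * z := by nlinarith
        gcongr
      _ = 80 * (U * z) := by ring
  have a3 : U ≤ U * z := Nat.le_mul_of_pos_right U hz1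
  calc _ ≤ 50 * (U * z) + 80 * (U * z) + 80 * (U * z) := by omega
    _ ≤ 250 * U * z := by nlinarith

theorem initialise_ok {L : List (Fin n × Fin n)} {lam β : ℕ} (hL : IsArcList N L)
    (hN : N.IsDirectedTree) (hn : 0 < n) :
    Ok initialise (inputState N L lam β) ((L.length + 2) * 100 + (N.weight + 5) * 30 + 50 +
      260 * unitCost β (lam + 1) * ∑ v, (N.cap v + 3)) fun s' =>
      Inv N β (lam + 1) id (fun _ => false) s' ∧ s'.reg 8 = 0 ∧ s'.reg 9 = 0 ∧
      s'.reg rTop = n + 1 + (lam + 2) * (β + 1) * ∑ v, (N.cap v + 2) := by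
  have hadd (f g : Fin n → ℕ) : ∑ v, (f v + g v) = ∑ v, f v + ∑ v, g v := Finset.sum_add_distrib
  set s0 := inputState N L lam β with hs0
  set Λ := lam + 1 with hΛ
  set U := unitCost β Λ with hU
  set s1 := ((((s0.setReg rWid (β + 1)).setReg rInf Λ).setReg rTimes (Λ + 1)).setReg rTop
    (n + 1)).setArr aVal n 1 with hs1
  set f : ℕ → ℕ := fun i => if h : i < n then N.cap ⟨i, h⟩ else 0 with hf
  have hfv (v : Fin n) : f v = N.cap v := by simp [hf]
  have hsum (k : ℕ) : ∑ v, (N.cap v + k) = ∑ i ∈ Finset.range n, (f i + k) := by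
    rw [Finset.sum_range]
    exact Finset.sum_congr rfl fun v _ => by rw [hfv]
  unfold initialise
  refine Ok.le (k := 4 + (4 + (4 + (4 + (3 + ((L.length + 2) * 100 + ((N.weight + 5) * 30 + (2 +
    ((∑ i ∈ Finset.range n, (3 + (250 * U * (f i + 3) + 4)) + 3) + (2 + (2 + 2))))))))))) ?_ ?_
  · refine Ok.assign_seq (Ok.assign_seq (Ok.assign_seq (Ok.assign_seq (Ok.store_seq ?_))))
    have r1 (x : ℕ) (hx : x < 4) : s1.reg x = s0.reg x := by
      have : x ≠ rWid ∧ x ≠ rInf ∧ x ≠ rTimes ∧ x ≠ rTop := by omega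
      simp [hs1, this]
    have a1 (a : ℕ) (ha : a ≠ 20) : s1.arr a = s0.arr a := by
      funext i
      simp [hs1, ha]
    change Ok _ s1 _ _
    refine Ok.seq (readArcs_ok hL (r1 1 (by simp)) (by simp [hs1, hs0, inputState])
      (fun i h => ?_) (fun i h => ?_) (fun i h => ?_) fun j h1 h2 i => ?_) ?_
    · rw [a1 0 (by simp)]; simp [hs0, inputState, h]
    · rw [a1 1 (by simp)]; simp [hs0, inputState, h]
    · rw [a1 2 (by simp)]; simp [hs0, inputState, h]
    · rw [a1 j (by omega)]
      interval_cases j <;> rfl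
    rintro s2 ⟨g1, g2, g3, g4, g5⟩
    have hweight : s2.reg 7 = N.weight := by
      rw [g4, Finset.sum_comm]; rfl
    refine Ok.seq ((multiples_ok (s := s2) (β := β) ?_).le (by rw [hweight])) ?_
    · rw [g1 rWid (by simp)]; simp [hs1]
    rintro s3 ⟨k1, k2, k3, k4⟩
    have r3 (x : ℕ) (hx : x < 7) : s3.reg x = s1.reg x := (k1 x hx).trans (g1 x hx)
    have a3 (a : ℕ) (ha : a < 6 ∨ 12 ≤ a) (ha' : a ≠ 16) : s3.arr a = s1.arr a :=
      (k3 a ha').trans (g3 a ha)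
    have htop3 : s3.reg rTop = n + 1 := by rw [k2, g2]; simp [hs1]
    have hG : Globals N β Λ s3 := by
      refine ⟨⟨?_, ?_, ?_, ?_⟩, ⟨?_, ?_, fun i h1 h2 => ?_, fun i h1 h2 => ?_⟩, fun i => ?_,
        fun i hi => k4 i (by omega)⟩
      · rw [r3 0 (by simp), r1 0 (by simp)]; rfl
      · rw [r3 rWid (by simp)]; simp [hs1]
      · rw [r3 rInf (by simp)]; simp [hs1]
      · rw [r3 rTimes (by simp)]; simp [hs1]
      · omega
      · rw [a3 aVal (by simp) (by simp)]; simp [hs1]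
      · omega
      · omega
      · rw [a3 5 (by simp) (by simp), a1 5 (by simp)]; rfl
    refine Ok.assign_seq (Ok.seq (Ok.forLT_sum n (fun i => 250 * U * (f i + 3) + 4)
      (fun k s' => Globals N β Λ s' ∧ s'.reg 8 = k ∧
        (∀ a < 12, s'.arr a = s3.arr a) ∧
        s'.reg rTop = n + 1 + (Λ + 1) * (β + 1) * ∑ i ∈ Finset.range k, (f i + 2) ∧
        ∀ v : Fin n, (v : ℕ) < k → Tables N β Λ {v} ∅ s' v) ?_ ?_ ?_) ?_)
    · exact ⟨hG.step (Step.setReg (r := 7) (by simp) (by simp)) le_rfl, by simp, fun a _ => rfl,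
        by simpa using htop3, fun v hv => absurd hv (Nat.not_lt_zero _)⟩
    · rintro i s' ⟨l1, l2, -⟩
      simp only [Expr.eval, l1.consts.num, l2]
    · rintro i s' hi ⟨l1, l2, l3, l4, l5⟩
      set v : Fin n := ⟨i, hi⟩ with hv
      have hcost := initVertexCost_le β Λ (N.cap v)
      refine Ok.seq ((initVertex_ok (v := v) l1 (by omega) l2 ?_ ?_ ?_).le (by
        rw [show f i = N.cap v from hfv v]; exact hcost)) ?_
      · rw [l3 3 (by simp), a3 3 (by simp) (by simp), a1 3 (by simp)]
        simp [hs0, inputState]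
      · rw [l3 4 (by simp), a3 4 (by simp) (by simp), a1 4 (by simp)]
        simp [hs0, inputState]
      · rw [l3 10 (by simp), k3 10 (by simp), g5 10 (by simp) (by simp)]
        rfl
      rintro s4 ⟨m1, m2, m3, m4, m5⟩
      refine Ok.assign ?_
      have h8 : s4.reg 8 = i := (m2 8 (by simp)).trans l2
      have h45 : Step n 7 s4 (s4.setReg 8 (i + 1)) := .setReg (by simp) (by simp)
      have hgrow := m1.trans h45.grow
      simp only [Expr.eval, h8]
      refine ⟨?_, by simp, fun a ha => ?_, ?_, fun u hu => ?_⟩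
      · refine (l1.congr (fun x hx => m2 x (by omega)) m1 (fun i => m3 5 (by simp) i (by simp))
          fun i => m3 16 (by simp) i (by simp)).step h45 le_rfl
      · rw [← l3 a ha]
        funext j
        exact m3 a (by omega) j (by omega)
      · rw [State.setReg_reg, if_neg (by simp), m4, l4, Finset.sum_range_succ,
          show f i = N.cap v from hfv v]
        ring
      · by_cases huv : u = v
        · rw [huv]
          exact m5.congr h45.grow fun _ _ _ => rfl
        · have hui : (u : ℕ) ≠ i := fun e => huv (Fin.ext e)
          exact (l5 u (by omega)).congr hgrow fun a h1 h2 => m3 a (by omega) u (.inr (.inr hui))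
    · rintro s4 ⟨l1, l2, l3, l4, l5⟩
      refine Ok.assign_seq (Ok.assign_seq (Ok.assign ?_))
      simp only [Expr.eval]
      set s5 := ((s4.setReg 8 0).setReg 9 0).setReg 10 0 with hs5
      have h45 : Step n 7 s4 s5 := ((Step.setReg (by simp) (by simp)).trans
        (.setReg (by simp) (by simp))).trans (.setReg (by simp) (by simp))
      refine ⟨⟨l1.step h45 le_rfl, clustering_id hN, fun u _ => ?_, fun u _ j h1 h2 => ?_,
        fun u hu => absurd rfl hu, ⟨⟨0, hn⟩, rfl, by simp [hs5]⟩⟩, by simp [hs5], by simp [hs5], ?_⟩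
      · have e1 : lightPart id (fun _ => false) u = {u} := by ext; simp [lightPart]
        have e2 : heavyPart id (fun _ => false) u = ∅ := by ext; simp [heavyPart]
        rw [e1, e2]
        exact (l5 u u.2).congr h45.grow fun _ _ _ => rfl
      · have e : alive (id : Fin n → Fin n) = Finset.univ := by ext; simp [alive]
        rw [e, ← g5 j h1 h2 u]
        change s4.arr j u = _
        rw [l3 j (by omega), k3 j (by omega)]
      · rw [hsum]
        simpa [hs5] using l4
  · rw [hsum, Finset.mul_sum]
    have : ∑ i ∈ Finset.range n, (3 + (250 * U * (f i + 3) + 4)) ≤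
        ∑ i ∈ Finset.range n, 260 * U * (f i + 3) := by
      refine Finset.sum_le_sum fun i _ => ?_
      have := one_le_unitCost β Λ
      nlinarith [Nat.zero_le (U * f i)]
    omega

end

section

open Network

variable {n : ℕ} {N : Network (Fin n)}

/-! ### The total cost -/

theorem Network.inWeight_eq (v : Fin n) : N.inWeight v = ∑ u ∈ N.inNbrs v, N.w u v := by
  classical
  rw [inWeight, inNbrs, Finset.sum_filter]
  rfl

theorem Network.weight_eq : N.weight = N.totalWeight :=
  Finset.sum_congr rfl fun v _ => N.inWeight_eq v

theorem Network.card_inNbrs_le (v : Fin n) : (N.inNbrs v).card ≤ N.maxInDegree :=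
  Finset.le_sup (f := fun v => (N.inNbrs v).card) (Finset.mem_univ v)

theorem Network.inWeight_le_maxInDegree_mul (v : Fin n) :
    N.inWeight v ≤ N.maxInDegree * N.inWeight v := by
  obtain h | h := Nat.eq_zero_or_pos (N.inWeight v)
  · simp [h]
  · refine Nat.le_mul_of_pos_left _ (lt_of_lt_of_le ?_ (N.card_inNbrs_le v))
    rw [Finset.card_pos, Finset.nonempty_iff_ne_empty]
    intro he
    rw [inWeight_eq, he, Finset.sum_empty] at h
    exact lt_irrefl 0 h

theorem Network.weight_le_maxInDegree_mul : N.weight ≤ N.maxInDegree * N.weight := by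
  unfold weight
  rw [Finset.mul_sum]
  exact Finset.sum_le_sum fun v _ => N.inWeight_le_maxInDegree_mul v

theorem alive_id : alive (id : Fin n → Fin n) = Finset.univ := by ext; simp [alive]

theorem Network.potential_id_le : N.potential id ≤ n + 3 * (N.maxInDegree * N.weight) := by
  classical
  unfold potential weight
  rw [alive_id, Finset.sum_add_distrib, Finset.mul_sum, Finset.mul_sum]
  refine Nat.add_le_add (by simp) (Finset.sum_le_sum fun u _ => ?_)
  have h1 : ∑ x, (if N.arc x u = 0 then 0 else N.inWeight u + 2) ≤
      ∑ x ∈ N.inNbrs u, 3 * N.inWeight u := by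
    rw [inNbrs, Finset.sum_filter]
    refine Finset.sum_le_sum fun x _ => ?_
    by_cases h0 : N.arc x u = 0
    · simp [h0]
    · have hadj : N.graph.Adj x u := by
        by_contra h
        exact h0 (by simp [arc, h])
      have h2 : N.arc x u ≤ N.inWeight u :=
        Finset.single_le_sum (f := fun x => N.arc x u) (fun _ _ => Nat.zero_le _)
          (Finset.mem_univ x)
      rw [if_neg h0, if_pos hadj]
      omega
  refine h1.trans ?_
  rw [Finset.sum_const, smul_eq_mul, mul_left_comm]
  exact Nat.mul_le_mul_left _ (Nat.mul_le_mul_right _ (N.card_inNbrs_le u))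

theorem Network.sum_cap_le (k : ℕ) : ∑ v, (N.cap v + k) ≤ N.weight + (k + 1) * n := by
  have : ∑ v, (N.cap v + k) ≤ ∑ v, (N.inWeight v + (k + 1)) :=
    Finset.sum_le_sum fun v _ => by
      have : N.cap v ≤ N.inWeight v + 1 := min_le_right _ _
      omega
  refine this.trans (le_of_eq ?_)
  rw [Finset.sum_add_distrib, weight]
  simp [mul_comm]

theorem sum_card_aliveNbrs_id (hN : N.IsDirectedTree) :
    ∑ u, (N.aliveNbrs id u).card + 2 = 2 * n := by
  have := (clustering_id hN).count
  rwa [alive_id, Finset.card_univ, Fintype.card_fin] at this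

theorem IsArcList.length_le {L : List (Fin n × Fin n)} (hL : IsArcList N L)
    (hN : N.IsDirectedTree) : L.length ≤ 2 * n := by
  classical
  have h1 : L.length = ∑ x, ∑ y, if N.graph.Adj x y then 1 else 0 := by
    have := hL.sum_map fun _ => 1
    rw [List.map_const', List.sum_replicate, smul_eq_mul, mul_one] at this
    rw [this]
  have h2 := sum_card_aliveNbrs_id hN
  have h3 : ∑ x, ∑ y, (if N.graph.Adj x y then 1 else 0) ≤ ∑ u, (N.aliveNbrs id u).card := by
    refine Finset.sum_le_sum fun x _ => ?_
    rw [Finset.sum_boole, Nat.cast_id]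
    refine Finset.card_le_card fun y hy => ?_
    rw [Finset.mem_filter] at hy
    exact mem_aliveNbrs.2 ⟨rfl, .inl hy.2⟩
  omega

/-- If the weights are positive, each edge of the tree contributes to the total weight. -/
theorem Network.IsDirectedTree.le_weight (hN : N.IsDirectedTree)
    (hw : ∀ u v, N.graph.Adj u v → 1 ≤ N.w u v) : n ≤ N.weight + 1 := by
  classical
  have h2 := sum_card_aliveNbrs_id hN
  have h3 : ∑ u, (N.aliveNbrs id u).card ≤ ∑ u, ∑ x, (N.arc u x + N.arc x u) := by
    refine Finset.sum_le_sum fun u _ => ?_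
    rw [aliveNbrs, alive_id, Finset.card_filter]
    refine Finset.sum_le_sum fun x _ => ?_
    split_ifs with h
    · unfold Nbr at h
      unfold arc
      obtain h | h := h
      · have := hw _ _ h
        rw [if_pos h]
        omega
      · have := hw _ _ h
        rw [if_pos h]
        omega
    · exact Nat.zero_le _
  simp only [Finset.sum_add_distrib] at h3
  rw [Finset.sum_comm (f := fun u x => N.arc u x)] at h3
  change _ ≤ N.weight + N.weight at h3
  omega

theorem unitCost_le {lam β : ℕ} (hl : 1 ≤ lam) (hβ : 1 ≤ β) :
    unitCost β (lam + 1) ≤ 400 * (lam ^ 2 * β ^ 3) := by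
  have h1 : (lam + 1 + 3) ^ 2 ≤ 25 * lam ^ 2 := by nlinarith
  have h2 : (β + 3) ^ 2 ≤ 16 * β ^ 3 := by
    have : (β + 3) ^ 2 ≤ (4 * β) ^ 2 := Nat.pow_le_pow_left (by omega) 2
    have : β ^ 2 ≤ β ^ 3 := Nat.pow_le_pow_right hβ (by simp)
    nlinarith
  calc unitCost β (lam + 1) ≤ 25 * lam ^ 2 * (16 * β ^ 3) := Nat.mul_le_mul h1 h2
    _ = 400 * (lam ^ 2 * β ^ 3) := by ring

/-- The program that solves the `(lam, β)`-MIS problem. -/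
def solve : Cmd := initialise ;; removeLeaves ;; writeSolution

theorem solve_ok {L : List (Fin n × Fin n)} {lam β : ℕ} (hN : N.IsDirectedTree)
    (hL : IsArcList N L) :
    Ok solve (inputState N L lam β)
      (11000 * unitCost β (lam + 1) * (N.maxInDegree * N.totalWeight + n)) fun s =>
      N.IsMaxInfluencing lam β (outputSet n s) := by
  have hn : 0 < n := by
    obtain ⟨v⟩ := hN.2.connected.nonempty
    exact v.pos
  have hlen := hL.length_le hN
  have hpot := N.potential_id_le
  have hcap2 := N.sum_cap_le 2
  have hcap3 := N.sum_cap_le 3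
  have hW := N.weight_le_maxInDegree_mul
  have hleaf := leafCost_le β (lam + 1)
  have hcomb := combineCost_le β (lam + 1)
  have hU := one_le_unitCost β (lam + 1)
  have hT : (lam + 2) * (β + 1) ≤ unitCost β (lam + 1) := tabSize_le_unitCost β (lam + 1)
  rw [← N.weight_eq]
  set M := N.maxInDegree * N.weight + n with hM
  have hMU : M ≤ unitCost β (lam + 1) * M :=
    Nat.le_mul_of_pos_left _ hU
  have hUM : unitCost β (lam + 1) ≤ unitCost β (lam + 1) * M :=
    Nat.le_mul_of_pos_right _ (by omega)
  have hA : 260 * unitCost β (lam + 1) * ∑ v, (N.cap v + 3) ≤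
      1300 * (unitCost β (lam + 1) * M) := by
    calc _ ≤ 260 * unitCost β (lam + 1) * (5 * M) := Nat.mul_le_mul_left _ (by omega)
      _ = _ := by ring
  have hB : leafCost β (lam + 1) * (N.potential id + n) ≤ 7200 * (unitCost β (lam + 1) * M) := by
    calc _ ≤ 1800 * unitCost β (lam + 1) * (4 * M) := Nat.mul_le_mul hleaf (by omega)
      _ = _ := by ring
  have hC : (lam + 2) * (β + 1) * ∑ v, (N.cap v + 2) ≤ 5 * (unitCost β (lam + 1) * M) := by
    calc _ ≤ unitCost β (lam + 1) * (5 * M) := Nat.mul_le_mul hT (by omega)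
      _ = _ := by ring
  have hD : 3 * ((lam + 1 + 1) * (β + 1)) * N.potential id ≤ 9 * (unitCost β (lam + 1) * M) := by
    calc _ ≤ 3 * unitCost β (lam + 1) * (3 * M) :=
        Nat.mul_le_mul (Nat.mul_le_mul_left 3 hT) (by omega)
      _ = _ := by ring
  unfold solve
  refine Ok.le (Ok.seq (initialise_ok hL hN hn) fun s1 ⟨hI, h8, h9, htop⟩ =>
    Ok.seq (removeLeaves_ok hN.1 hI h8 h9 hn) fun s2 ⟨own, heavy, hI', hno, htop'⟩ =>
    (writeSolution_ok hN.1 hI' hno).le (l := 1500 * (unitCost β (lam + 1) * M)) (by omega)) ?_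
  rw [mul_assoc _ _ M]
  omega

end

end MIS

theorem theorem3 :
    ∃ (P : MIS.Cmd) (K : ℕ),
      ∀ (n : ℕ) (N : MIS.Network (Fin n)) (L : List (Fin n × Fin n)) (lam β : ℕ),
        N.IsDirectedTree → MIS.IsArcList N L → 1 ≤ lam → 1 ≤ β →
        ∃ (steps : ℕ) (s : MIS.State),
          MIS.Exec P (MIS.inputState N L lam β) steps s ∧
          N.IsMaxInfluencing lam β (MIS.outputSet n s) ∧
          steps ≤ K * ((N.maxInDegree * N.totalWeight + n) * lam ^ 2 * β ^ 3) ∧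
          (2 ≤ n → (∀ u v, N.graph.Adj u v → 1 ≤ N.w u v) →
            steps ≤ K * (N.maxInDegree * lam ^ 2 * N.totalWeight * β ^ 3)) := by
  refine ⟨MIS.solve, 11000 * 400 * 3, fun n N L lam β hN hL hl hβ => ?_⟩
  obtain ⟨steps, s, hexec, hsteps, hopt⟩ := MIS.solve_ok (lam := lam) (β := β) hN hL
  have hU := MIS.unitCost_le hl hβ
  have hbound : steps ≤ 11000 * 400 *
      ((N.maxInDegree * N.totalWeight + n) * lam ^ 2 * β ^ 3) := by
    calc steps ≤ 11000 * MIS.unitCost β (lam + 1) * (N.maxInDegree * N.totalWeight + n) := hsteps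
      _ ≤ 11000 * (400 * (lam ^ 2 * β ^ 3)) * (N.maxInDegree * N.totalWeight + n) := by gcongr
      _ = _ := by ring
  refine ⟨steps, s, hexec, hopt, hbound.trans ?_, fun hn hw => ?_⟩
  · exact Nat.mul_le_mul_right _ (by norm_num)
  · have hW := hN.le_weight hw
    have hW' := N.weight_le_maxInDegree_mul
    rw [N.weight_eq] at hW hW'
    have h3 : N.maxInDegree * N.totalWeight + n ≤ 3 * (N.maxInDegree * N.totalWeight) := by omega
    calc steps ≤ 11000 * 400 * ((N.maxInDegree * N.totalWeight + n) * lam ^ 2 * β ^ 3) := hbound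
      _ ≤ 11000 * 400 * (3 * (N.maxInDegree * N.totalWeight) * lam ^ 2 * β ^ 3) := by gcongr
      _ = _ := by ring
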